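/- Let $n\ge 2$, let $I\subset\mathbb{R}$ be an open interval, let $\Omega\subset\mathbb{C}$ be open with $I\subset\Omega$, and let $A:\mathbb{R}\times\Omega\to\mathbb{C}^{n\times n}$ satisfy: (A) $A$ is continuous on $\mathbb{R}\times\Omega$, real-valued on $\mathbb{R}\times I$, and $\lambda\mapsto A(x;\lambda)$ is analytic on $\Omega$ for every $x$. (B) The limits $A_\pm(\lambda)=\lim_{x\to\pm\infty}A(x;\lambda)$ exist for $\lambda\in\Omega$, uniformly on compact subsets of $\Omega$. (C) For each $\lambda\in\Omega$, each of $A_\pm(\lambda)$ has a unique eigenvalue $\mu_\pm(\lambda)$ of largest real part, which is simple; $\mu_\pm$ is analytic on $\Omega$, and there are analytic right and left eigenvectors of $A_\pm(\lambda)$ for $\mu_\pm(\lambda)$, with product (left times right) equal to $1$. (D) With $E(x;\lambda)=A(x;\lambda)-A_-(\lambda)$ for $x<0$ and $E(x;\lambda)=A(x;\lambda)-A_+(\lambda)$ for $x>0$, the integral $\int_{\mathbb{R}}|E(x;\lambda)|\,dx$ is finite for all $\lambda\in\Omega$ and converges uniformly on compact subsets of $\Omega$. For $v,\mathcal{V}\in\mathbb{C}^n$,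 regarded as the 1-form $\sum_i v_ie_i$ and the $(n-1)$-form $\mathcal{V}_1\,e_1\wedge\dots\wedge e_{n-1}+\mathcal{V}_2\,e_1\wedge\dots\wedge e_{n-2}\wedge e_n+\dots+\mathcal{V}_n\,e_2\wedge\dots\wedge e_n$, write $v\wedge\mathcal{V}=\sum_{i=1}^n(-1)^{i+1}v_i\mathcal{V}_{n+1-i}$ (the coefficient of $e_1\wedge\dots\wedge e_n$ in their exterior product). For a matrix $A=(a_{ij})$ let $\tilde A$ be the matrix with entries $\tilde a_{ij}=(-1)^{i+j+1}a_{(n+1-j)(n+1-i)}$, and let $\tilde A_\pm(\lambda)$ be the matrices so obtained from $A_\pm(\lambda)$. For $\lambda\in\Omega$ let $v^\pm(\lambda)$ be eigenvectors of $A_\pm(\lambda)$ for the eigenvalue $\mu_\pm(\lambda)$, and $\tilde{\mathcal{V}}^\pm(\lambda)$ eigenvectors of $\tilde A_\pm(\lambda)$ for the eigenvalue $-\mu_\pm(\lambda)$, where $v^-$ and $\tilde{\mathcal{V}}^+$ are analytic on $\Omega$. Then for every $\lambda\in\Omega$ there is a unique solution $\eta^-(\cdot;\lambda)$ on $\mathbb{R}$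 of $y'=A(x;\lambda)y$ with $\lim_{x\to-\infty}e^{-\mu_-(\lambda)x}\eta^-(x;\lambda)=v^-(\lambda)$, and a unique solution $\tilde{\mathcal{Y}}^+(\cdot;\lambda)$ on $\mathbb{R}$ of $\mathcal{Y}'=\tilde A(x;\lambda)\mathcal{Y}$ with $\lim_{x\to+\infty}e^{\mu_+(\lambda)x}\tilde{\mathcal{Y}}^+(x;\lambda)=\tilde{\mathcal{V}}^+(\lambda)$, and the Evans function $$D(\lambda):=\eta^-(x;\lambda)\wedge\tilde{\mathcal{Y}}^+(x;\lambda)$$ does not depend on $x\in\mathbb{R}$. Moreover, for every $\lambda\in I$, the numbers $v^\pm(\lambda)\wedge\tilde{\mathcal{V}}^\pm(\lambda)$ are nonzero, the integrals below converge absolutely, $D$ is complex differentiable at $\lambda$, and $$\begin{aligned} D'(\lambda)&=\Big(\frac{v^{-\,\prime}(\lambda)\wedge\tilde{\mathcal{V}}^-(\lambda)}{v^-(\lambda)\wedge\tilde{\mathcal{V}}^-(\lambda)}+\frac{v^+(\lambda)\wedge\tilde{\mathcal{V}}^{+\,\prime}(\lambda)}{v^+(\lambda)\wedge\tilde{\mathcal{V}}^+(\lambda)}\Big)D(\lambda)\\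 &\quad+\int_{-\infty}^0\Big((A_\lambda(x;\lambda)-\mu_-'(\lambda)I_n)\,\eta^-(x;\lambda)\Big)\wedge\tilde{\mathcal{Y}}^+(x;\lambda)\,dx\\ &\quad+\int_0^{+\infty}\Big((A_\lambda(x;\lambda)-\mu_+'(\lambda)I_n)\,\eta^-(x;\lambda)\Big)\wedge\tilde{\mathcal{Y}}^+(x;\lambda)\,dx, \end{aligned}$$ where $A_\lambda=\partial A/\partial\lambda$, $I_n$ is the identity matrix, and $'$ on functions of $\lambda$ is $d/d\lambda$. -/

import Mathlib

open Filter Topology MeasureTheory Matrix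

attribute [local instance] Matrix.linftyOpNormedAddCommGroup Matrix.linftyOpNormedSpace

namespace EvansWedge

noncomputable section

/-- The wedge product of a vector `v`, read as the 1-form `v₁ e₁ + ⋯ + vₙ eₙ`, with a vector `V`,
read as the `(n-1)`-form
`V₁ e₁ ∧ ⋯ ∧ eₙ₋₁ + V₂ e₁ ∧ ⋯ ∧ eₙ₋₂ ∧ eₙ + ⋯ + Vₙ e₂ ∧ ⋯ ∧ eₙ`
(the `j`-th basis form omits `e_{n+1-j}`). The `n`-form `v ∧ V` is identified with its coefficient
along `e₁ ∧ ⋯ ∧ eₙ`, which is `∑ (-1)^(i+1) v_i V_{n+1-i}` with indices starting from 1. -/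
def wedge {n : ℕ} (v V : Fin n → ℂ) : ℂ :=
  ∑ i : Fin n, (-1) ^ (i : ℕ) * v i * V i.rev

/-- The `(n-1)`-form attached to a vector, in the exterior algebra of `ℂⁿ` (`n = m + 1`). -/
def coform {m : ℕ} (V : Fin (m + 1) → ℂ) : ExteriorAlgebra ℂ (Fin (m + 1) → ℂ) :=
  ∑ j : Fin (m + 1),
    V j • ExteriorAlgebra.ιMulti ℂ m (fun k : Fin m => Pi.single (j.rev.succAbove k) (1 : ℂ))

/-- `wedge v V` is the coefficient of the exterior product of `v` with the form attached to `V`. -/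
theorem ι_mul_coform {m : ℕ} (v V : Fin (m + 1) → ℂ) :
    ExteriorAlgebra.ι ℂ v * coform V =
      wedge v V • ExteriorAlgebra.ιMulti ℂ (m + 1)
        (fun k : Fin (m + 1) => (Pi.single k (1 : ℂ) : Fin (m + 1) → ℂ)) := by
  set e : Fin (m + 1) → (Fin (m + 1) → ℂ) := fun k => Pi.single k (1 : ℂ) with he
  have hcons : ∀ k i : Fin (m + 1),
      ExteriorAlgebra.ι ℂ (e k) * ExteriorAlgebra.ιMulti ℂ m (fun l => e (i.succAbove l)) =
        ExteriorAlgebra.ιMulti ℂ (m + 1)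
          (Fin.cons (e k) (fun l => e (i.succAbove l)) : Fin (m + 1) → Fin (m + 1) → ℂ) := by
    intro k i
    rw [ExteriorAlgebra.ιMulti_succ_apply]
    rfl
  have hne : ∀ k i : Fin (m + 1), k ≠ i →
      ExteriorAlgebra.ι ℂ (e k) * ExteriorAlgebra.ιMulti ℂ m (fun l => e (i.succAbove l)) = 0 := by
    intro k i hk
    obtain ⟨l, hl⟩ := Fin.exists_succAbove_eq hk
    rw [hcons]
    refine AlternatingMap.map_eq_zero_of_eq _ _ (i := 0) (j := l.succ) ?_ (Fin.succ_ne_zero l).symm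
    simp [hl]
  have heq : ∀ i : Fin (m + 1),
      ExteriorAlgebra.ι ℂ (e i) * ExteriorAlgebra.ιMulti ℂ m (fun l => e (i.succAbove l)) =
        ((-1 : ℂ) ^ (i : ℕ)) • ExteriorAlgebra.ιMulti ℂ (m + 1) e := by
    intro i
    rw [hcons]
    have h : (Fin.cons (e i) (fun l => e (i.succAbove l)) : Fin (m + 1) → Fin (m + 1) → ℂ) =
        e ∘ (i.cycleRange.symm) := by
      funext k
      refine Fin.cases ?_ (fun l => ?_) k
      · simp
      · simp
    rw [h, AlternatingMap.map_perm, Equiv.Perm.sign_symm, Fin.sign_cycleRange]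
    rcases Nat.even_or_odd (i : ℕ) with hi | hi
    · simp [hi.neg_one_pow]
    · simp [hi.neg_one_pow]
  have hv : v = ∑ k, v k • e k := by
    funext j
    simp [he, Finset.sum_apply, Pi.single_apply]
  have hV : coform V =
      ∑ i : Fin (m + 1), V i.rev • ExteriorAlgebra.ιMulti ℂ m (fun l => e (i.succAbove l)) := by
    unfold coform
    refine Fintype.sum_equiv Fin.revPerm _ _ (fun j => ?_)
    simp [he]
  have hι : ExteriorAlgebra.ι ℂ v = ∑ k, v k • ExteriorAlgebra.ι ℂ (e k) := by
    conv_lhs => rw [hv]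
    simp
  rw [hι, hV, Finset.sum_mul_sum, wedge, Finset.sum_smul]
  refine Finset.sum_congr rfl (fun k _ => ?_)
  rw [Finset.sum_eq_single k]
  · rw [smul_mul_smul_comm, heq, smul_smul]
    congr 1
    ring
  · intro i _ hi
    rw [smul_mul_smul_comm, hne k i hi.symm, smul_zero]
  · simp

/-- The matrix `Ã` attached to `A`: with indices starting from 1,
`ã_{ij} = (-1)^(i+j+1) a_{(n+1-j)(n+1-i)}`. -/
def tilde {n : ℕ} (A : Matrix (Fin n) (Fin n) ℂ) : Matrix (Fin n) (Fin n) ℂ :=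
  Matrix.of fun i j => (-1) ^ ((i : ℕ) + (j : ℕ) + 1) * A j.rev i.rev

/-- Assumption (A): `A` is continuous on `ℝ × Ω`, real on `ℝ × I`, and analytic in `λ ∈ Ω`. -/
structure AssumptionA {n : ℕ} (I : Set ℝ) (Ω : Set ℂ)
    (A : ℝ → ℂ → Matrix (Fin n) (Fin n) ℂ) : Prop where
  isOpen : IsOpen Ω
  subset : ∀ t ∈ I, (t : ℂ) ∈ Ω
  continuousOn : ContinuousOn (fun p : ℝ × ℂ => A p.1 p.2) (Set.univ ×ˢ Ω)
  real : ∀ x : ℝ, ∀ t ∈ I, ∀ i j, (A x (t : ℂ) i j).im = 0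
  analytic : ∀ x : ℝ, AnalyticOnNhd ℂ (A x) Ω

/-- Assumption (B): `A(x; λ) → A_±(λ)` as `x → ±∞`, uniformly for `λ` in compact subsets
of `Ω`. -/
structure AssumptionB {n : ℕ} (Ω : Set ℂ) (A : ℝ → ℂ → Matrix (Fin n) (Fin n) ℂ)
    (Aminus Aplus : ℂ → Matrix (Fin n) (Fin n) ℂ) : Prop where
  tendsto_bot : ∀ K ⊆ Ω, IsCompact K → TendstoUniformlyOn A Aminus atBot K
  tendsto_top : ∀ K ⊆ Ω, IsCompact K → TendstoUniformlyOn A Aplus atTop K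

/-- Assumption (C) for one of the two limit matrices `L(λ)`: `μ(λ)` is its unique eigenvalue of
largest real part, is algebraically simple and analytic in `λ`, and there are analytic right and
left eigenvectors normalized by `w v = 1`. -/
structure AssumptionC {n : ℕ} (Ω : Set ℂ) (L : ℂ → Matrix (Fin n) (Fin n) ℂ)
    (μ : ℂ → ℂ) : Prop where
  simple : ∀ lam ∈ Ω, (L lam).charpoly.rootMultiplicity (μ lam) = 1
  dominant : ∀ lam ∈ Ω, ∀ ν ∈ spectrum ℂ (L lam), ν ≠ μ lam → ν.re < (μ lam).re
  analytic : AnalyticOnNhd ℂ μ Ω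
  eigenvectors : ∃ v w : ℂ → Fin n → ℂ, AnalyticOnNhd ℂ v Ω ∧ AnalyticOnNhd ℂ w Ω ∧
    ∀ lam ∈ Ω, L lam *ᵥ v lam = μ lam • v lam ∧ w lam ᵥ* L lam = μ lam • w lam ∧
      w lam ⬝ᵥ v lam = 1

/-- `E(x; λ)`; its value at the single point `x = 0` is immaterial. -/
def errorTerm {n : ℕ} (A : ℝ → ℂ → Matrix (Fin n) (Fin n) ℂ)
    (Aminus Aplus : ℂ → Matrix (Fin n) (Fin n) ℂ) (x : ℝ) (lam : ℂ) :
    Matrix (Fin n) (Fin n) ℂ :=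
  if x < 0 then A x lam - Aminus lam else A x lam - Aplus lam

/-- Assumption (D): `∫ |E(x; λ)| dx` is finite for `λ ∈ Ω` and converges uniformly on compact
subsets of `Ω`. -/
structure AssumptionD {n : ℕ} (Ω : Set ℂ) (A : ℝ → ℂ → Matrix (Fin n) (Fin n) ℂ)
    (Aminus Aplus : ℂ → Matrix (Fin n) (Fin n) ℂ) : Prop where
  integrable : ∀ lam ∈ Ω, Integrable (fun x : ℝ => ‖errorTerm A Aminus Aplus x lam‖)
  uniform : ∀ K ⊆ Ω, IsCompact K →
    TendstoUniformlyOn (fun (R : ℝ) (lam : ℂ) => ∫ x in (-R)..R, ‖errorTerm A Aminus Aplus x lam‖)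
      (fun lam => ∫ x : ℝ, ‖errorTerm A Aminus Aplus x lam‖) atTop K

/-- `v(λ)` is an eigenvector (in particular nonzero) of `L(λ)` for the eigenvalue `μ(λ)`, for
every `λ ∈ Ω`. -/
def IsEigenvectorOn {n : ℕ} (Ω : Set ℂ) (L : ℂ → Matrix (Fin n) (Fin n) ℂ) (μ : ℂ → ℂ)
    (v : ℂ → Fin n → ℂ) : Prop :=
  ∀ lam ∈ Ω, Module.End.HasEigenvector (Matrix.toLin' (L lam)) (μ lam) (v lam)

/-- `y` solves `y' = A(x; λ) y` on `ℝ` and `e^{-μ(λ) x} y(x) → v(λ)` as `x → -∞`. -/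
def IsEtaMinus {n : ℕ} (A : ℝ → ℂ → Matrix (Fin n) (Fin n) ℂ) (μ : ℂ → ℂ)
    (v : ℂ → Fin n → ℂ) (lam : ℂ) (y : ℝ → Fin n → ℂ) : Prop :=
  (∀ x : ℝ, HasDerivAt y (A x lam *ᵥ y x) x) ∧
    Tendsto (fun x : ℝ => Complex.exp (-μ lam * (x : ℂ)) • y x) atBot (𝓝 (v lam))

/-- `Y` solves `Y' = Ã(x; λ) Y` on `ℝ` and `e^{μ(λ) x} Y(x) → V(λ)` as `x → +∞`. -/
def IsYPlus {n : ℕ} (A : ℝ → ℂ → Matrix (Fin n) (Fin n) ℂ) (μ : ℂ → ℂ)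
    (V : ℂ → Fin n → ℂ) (lam : ℂ) (Y : ℝ → Fin n → ℂ) : Prop :=
  (∀ x : ℝ, HasDerivAt Y (tilde (A x lam) *ᵥ Y x) x) ∧
    Tendsto (fun x : ℝ => Complex.exp (μ lam * (x : ℂ)) • Y x) atTop (𝓝 (V lam))

/-- The solution `η⁻(x; λ)` of `y' = A(x; λ) y` with `e^{-μ(λ) x} η⁻ → v(λ)` at `-∞`. -/
def etaMinus {n : ℕ} (A : ℝ → ℂ → Matrix (Fin n) (Fin n) ℂ) (μ : ℂ → ℂ)
    (v : ℂ → Fin n → ℂ) (x : ℝ) (lam : ℂ) : Fin n → ℂ :=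
  Classical.epsilon (IsEtaMinus A μ v lam) x

/-- The solution `Ỹ⁺(x; λ)` of `Y' = Ã(x; λ) Y` with `e^{μ(λ) x} Ỹ⁺ → V(λ)` at `+∞`. -/
def yPlus {n : ℕ} (A : ℝ → ℂ → Matrix (Fin n) (Fin n) ℂ) (μ : ℂ → ℂ)
    (V : ℂ → Fin n → ℂ) (x : ℝ) (lam : ℂ) : Fin n → ℂ :=
  Classical.epsilon (IsYPlus A μ V lam) x

/-- The Evans function `D(λ) = η⁻(x; λ) ∧ Ỹ⁺(x; λ)`, evaluated at `x = 0`. -/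
def evansFunction {n : ℕ} (A : ℝ → ℂ → Matrix (Fin n) (Fin n) ℂ) (μminus μplus : ℂ → ℂ)
    (vminus Vplus : ℂ → Fin n → ℂ) (lam : ℂ) : ℂ :=
  wedge (etaMinus A μminus vminus 0 lam) (yPlus A μplus Vplus 0 lam)

/-- The integrand `((A_λ(x; λ) - μ'(λ) I) η⁻(x; λ)) ∧ Ỹ⁺(x; λ)`, where `μ` is `μ₋` or `μ₊`. -/
def evansIntegrand {n : ℕ} (A : ℝ → ℂ → Matrix (Fin n) (Fin n) ℂ) (μminus μplus : ℂ → ℂ)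
    (vminus Vplus : ℂ → Fin n → ℂ) (μ : ℂ → ℂ) (lam : ℂ) (x : ℝ) : ℂ :=
  wedge ((deriv (A x) lam - deriv μ lam • (1 : Matrix (Fin n) (Fin n) ℂ)) *ᵥ
    etaMinus A μminus vminus x lam) (yPlus A μplus Vplus x lam)

end

end EvansWedge

/-!
The derivative of the Evans function splits by the product rule, at `x = 0`, into
`∂η⁻ ∧ Ỹ⁺ + η⁻ ∧ ∂Ỹ⁺`, where `∂ = d/dλ`. The first term is an affair of the end `-∞` alone, the
second one of the end `+∞`. Since `v ∧ Ã V = -(A v) ∧ V`, the form `Ỹ⁺`, read as the row vector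
`u ↦ u ∧ Ỹ⁺`, solves the transposed equation `p' = -p A`, and the reflection `x ↦ -x` turns the
second term into one of the same kind as the first, for the operators `-Ã(-x; λ)`. It is thus
enough to study a family `y' = A(x; l) y` near `-∞`; this is the structure `LeftEnd`.

After division by `e^{μ x}` the equation is `w' = (B(l) + E(x; l)) w`, where `B(l) = L(l) - μ(l)`
and `E(·; l)` is integrable on `(-∞, 0]`. The semigroup of `B(l)` is bounded: with `P(l)` the
spectral projection for the simple eigenvalue `0`, the eigenvalues of `B(l) - P(l)` have negative
real parts, so that its semigroup decays exponentially, uniformly for `l` near a given `l₀`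
(`exists_norm_exp_smul_le`, `LeftEnd.exists_splitting`). Solutions with a given limit in `ker B(l)`
at `-∞` come from a contraction argument for a Volterra equation in a weighted space of bounded
functions (`exists_solution_tendsto_atBot`), and they are unique by Gronwall's inequality.

For the dependence on the parameter, let `q` be a row solution at `l₀`, bounded near `-∞` with
limit `m = m P(l₀)`. Then `x ↦ q(x) w(x; l)` has the derivative
`q ((B + E)(l) - (B + E)(l₀)) w(l)`, which gives
`q(0) w(0; l) = m v(l) + ∫_{-∞}^0 q ((B + E)(l) - (B + E)(l₀)) w(l) dx` (`LeftFamily.pairing_eq`).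
No regularity of `w` in `l` is presupposed here. The increment of `B` does not decay in `x`, but the
integrand does: both `q (1 - P(l₀))` and `(1 - P(l)) w(·; l)` are integrable, and
`P(l₀) (B(l) - B(l₀)) = (P(l₀) - P(l)) B(l) (1 - P(l))` as `P(l) B(l) = B(l) P(l) = 0`
(`LeftFamily.exists_bound_increment`). The increments of `E` are dominated through Cauchy's formula
and Fubini's theorem, from bounds for `∫ ‖E(x; l)‖ dx` on compact sets of parameters
(`exists_integrable_dominating`). Dominated convergence then gives first continuity and next
differentiability in `l`, with derivative `m v' + ∫ q (B' + E') w dx`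
(`LeftFamily.hasDerivAt_pairing`). As `m` is a multiple of the left eigenvector and
`q w = m v` at `l₀`, the boundary term `m v'` is the stated multiple of the Evans function
(`LeftEnd.hasDerivAt_pairing`).
-/

namespace EvansWedge

/-! ### Linear equations with integrable perturbations -/

section LinearODE

open Set NormedSpace

variable {F G : Type*} [NormedAddCommGroup F] [NormedSpace ℂ F]
  [NormedAddCommGroup G] [NormedSpace ℂ G]

theorem hasDerivAt_clm_apply {c : ℝ → F →L[ℂ] G} {c' : F →L[ℂ] G} {u : ℝ → F} {u' : F} {x : ℝ}
    (hc : HasDerivAt c c' x) (hu : HasDerivAt u u' x) :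
    HasDerivAt (fun t => c t (u t)) (c' (u x) + c x u') x := by
  have h := ((ContinuousLinearMap.restrictScalarsL ℂ F G ℝ ℝ).hasFDerivAt.comp_hasDerivAt x hc)
  exact h.clm_apply hu

theorem hasDerivAt_clm_const_apply (c : F →L[ℂ] G) {u : ℝ → F} {u' : F} {x : ℝ}
    (hu : HasDerivAt u u' x) : HasDerivAt (fun t => c (u t)) (c u') x := by
  simpa using hasDerivAt_clm_apply (hasDerivAt_const x c) hu

variable [CompleteSpace F]

theorem exp_add_smul (B : F →L[ℂ] F) (s t : ℝ) :
    exp ((s + t) • B) = exp (s • B) * exp (t • B) := by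
  let _ : NormedAlgebra ℚ (F →L[ℂ] F) := NormedAlgebra.restrictScalars ℚ ℝ _
  rw [add_smul]
  exact exp_add_of_commute (((Commute.refl B).smul_left s).smul_right t)

theorem hasDerivAt_exp_smul_apply (B : F →L[ℂ] F) (v : F) (t : ℝ) :
    HasDerivAt (fun s : ℝ => exp (s • B) v) (B (exp (t • B) v)) t := by
  have h := hasDerivAt_clm_apply (hasDerivAt_exp_smul_const' (𝕂 := ℝ) B t) (hasDerivAt_const t v)
  simpa using h

theorem continuous_exp_smul (B : F →L[ℂ] F) : Continuous (fun s : ℝ => exp (s • B)) :=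
  continuous_iff_continuousAt.2 fun t => (hasDerivAt_exp_smul_const (𝕂 := ℝ) B t).continuousAt

theorem exp_smul_apply_of_apply_eq_zero {B : F →L[ℂ] F} {v : F} (hv : B v = 0) (s : ℝ) :
    exp (s • B) v = v := by
  have hd : ∀ t : ℝ, HasDerivAt (fun s : ℝ => exp (s • B) v) 0 t := fun t => by
    have h := hasDerivAt_clm_apply (hasDerivAt_exp_smul_const (𝕂 := ℝ) B t) (hasDerivAt_const t v)
    simpa [hv] using h
  have h := is_const_of_deriv_eq_zero (fun t => (hd t).differentiableAt) (fun t => (hd t).deriv) s 0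
  simpa using h

/-- Variation of constants for `y' = B y + f` on a compact interval. -/
theorem duhamel {B : F →L[ℂ] F} {f y : ℝ → F} {a b : ℝ} (hab : a ≤ b)
    (hy : ContinuousOn y (Icc a b)) (hf : ContinuousOn f (Icc a b))
    (h : ∀ t ∈ Ioo a b, HasDerivAt y (B (y t) + f t) t) :
    y b = exp ((b - a) • B) (y a) + ∫ t in a..b, exp ((b - t) • B) (f t) := by
  have hce : Continuous fun t : ℝ => exp ((b - t) • B) :=
    (continuous_exp_smul B).comp (continuous_const.sub continuous_id)
  have hc : ContinuousOn (fun t => exp ((b - t) • B) (y t)) (Icc a b) :=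
    hce.continuousOn.clm_apply hy
  have hd : ∀ t ∈ Ioo a b, HasDerivAt (fun t => exp ((b - t) • B) (y t))
      (exp ((b - t) • B) (f t)) t := by
    intro t ht
    have h1 : HasDerivAt (fun t : ℝ => exp ((b - t) • B)) (-(exp ((b - t) • B) * B)) t := by
      have := (hasDerivAt_exp_smul_const (𝕂 := ℝ) B (b - t)).scomp t
        ((hasDerivAt_id t).const_sub b)
      simpa [Function.comp_def] using this
    have h2 := hasDerivAt_clm_apply h1 (h t ht)
    refine h2.congr_deriv ?_
    simp
  have hi : IntervalIntegrable (fun t => exp ((b - t) • B) (f t)) volume a b := by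
    apply ContinuousOn.intervalIntegrable
    rw [uIcc_of_le hab]
    exact hce.continuousOn.clm_apply hf
  rw [intervalIntegral.integral_eq_sub_of_hasDerivAt_of_le hab hc hd hi]
  simp

theorem norm_le_of_exp_decay {B : F →L[ℂ] F} {f y : ℝ → F} {a b K α : ℝ} (hab : a ≤ b)
    (hK : ∀ s : ℝ, 0 ≤ s → ‖exp (s • B)‖ ≤ K * Real.exp (-α * s))
    (hy : ContinuousOn y (Icc a b)) (hf : ContinuousOn f (Icc a b))
    (h : ∀ t ∈ Ioo a b, HasDerivAt y (B (y t) + f t) t) :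
    ‖y b‖ ≤ K * Real.exp (-α * (b - a)) * ‖y a‖ +
      ∫ t in a..b, K * Real.exp (-α * (b - t)) * ‖f t‖ := by
  rw [duhamel hab hy hf h]
  refine (norm_add_le _ _).trans (add_le_add ?_ ?_)
  · exact (ContinuousLinearMap.le_opNorm _ _).trans
      (mul_le_mul_of_nonneg_right (hK _ (sub_nonneg.2 hab)) (norm_nonneg _))
  · refine intervalIntegral.norm_integral_le_of_norm_le hab (ae_of_all _ fun t ht => ?_) ?_
    · exact (ContinuousLinearMap.le_opNorm _ _).trans
        (mul_le_mul_of_nonneg_right (hK _ (sub_nonneg.2 ht.2)) (norm_nonneg _))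
    · apply ContinuousOn.intervalIntegrable
      rw [uIcc_of_le hab]
      exact (by fun_prop : Continuous fun t : ℝ => K * Real.exp (-α * (b - t))).continuousOn.mul
        hf.norm

/-- Gronwall's inequality in integral form with a variable coefficient. -/
theorem le_mul_exp_integral_of_le_add_integral {φ g : ℝ → ℝ} {a b c : ℝ} (hab : a ≤ b)
    (hφ : ContinuousOn φ (Icc a b)) (hg : ContinuousOn g (Icc a b))
    (hg0 : ∀ t ∈ Icc a b, 0 ≤ g t)
    (h : ∀ x ∈ Icc a b, φ x ≤ c + ∫ t in a..x, g t * φ t) :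
    φ b ≤ c * Real.exp (∫ t in a..b, g t) := by
  have hgi : ∀ {f : ℝ → ℝ}, ContinuousOn f (Icc a b) → ∀ x ∈ Ioo a b,
      HasDerivAt (fun u => ∫ t in a..u, f t) (f x) x := by
    intro f hf x hx
    refine intervalIntegral.integral_hasDerivAt_right ?_ ?_ ?_
    · apply ContinuousOn.intervalIntegrable
      rw [uIcc_of_le hx.1.le]
      exact hf.mono (Icc_subset_Icc_right hx.2.le)
    · exact (hf.mono Ioo_subset_Icc_self).stronglyMeasurableAtFilter isOpen_Ioo x hx
    · exact hf.continuousAt (Icc_mem_nhds hx.1 hx.2)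
  have hgc : ∀ {f : ℝ → ℝ}, ContinuousOn f (Icc a b) →
      ContinuousOn (fun u => ∫ t in a..u, f t) (Icc a b) := by
    intro f hf
    have := intervalIntegral.continuousOn_primitive_interval (f := f) (μ := volume)
      (a := a) (b := b) (by rw [uIcc_of_le hab]; exact hf.integrableOn_Icc)
    rwa [uIcc_of_le hab] at this
  have hgφ : ContinuousOn (fun t => g t * φ t) (Icc a b) := hg.mul hφ
  set H : ℝ → ℝ := fun x => (c + ∫ t in a..x, g t * φ t) * Real.exp (-∫ t in a..x, g t) with hH
  have hd : ∀ x ∈ Ioo a b, HasDerivAt H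
      (g x * φ x * Real.exp (-∫ t in a..x, g t) +
        (c + ∫ t in a..x, g t * φ t) * (Real.exp (-∫ t in a..x, g t) * -g x)) x := by
    intro x hx
    exact ((hgi hgφ x hx).const_add c).mul ((hgi hg x hx).neg.exp)
  have hanti : AntitoneOn H (Icc a b) := by
    refine antitoneOn_of_deriv_nonpos (convex_Icc a b) ?_ ?_ ?_
    · exact ((continuousOn_const).add (hgc hgφ)).mul ((hgc hg).neg.rexp)
    · intro x hx
      rw [interior_Icc] at hx
      exact (hd x hx).differentiableAt.differentiableWithinAt
    · intro x hx
      rw [interior_Icc] at hx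
      rw [(hd x hx).deriv]
      have h1 := h x (Ioo_subset_Icc_self hx)
      have h2 := hg0 x (Ioo_subset_Icc_self hx)
      have h3 : 0 ≤ g x * Real.exp (-∫ t in a..x, g t) := mul_nonneg h2 (Real.exp_pos _).le
      nlinarith [mul_nonneg h3 (sub_nonneg.2 h1)]
  have h1 := hanti (left_mem_Icc.2 hab) (right_mem_Icc.2 hab) hab
  simp only [hH, intervalIntegral.integral_same, add_zero, neg_zero, Real.exp_zero, mul_one] at h1
  refine (h b (right_mem_Icc.2 hab)).trans ?_
  have h2 := mul_le_mul_of_nonneg_right h1 (Real.exp_pos (∫ t in a..b, g t)).le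
  rwa [mul_assoc, ← Real.exp_add, neg_add_cancel, Real.exp_zero, mul_one] at h2

/-- A perturbation `E` of a generator of a bounded semigroup changes solutions by at most the
exponential of its integral. -/
theorem norm_le_mul_exp_integral {B : F →L[ℂ] F} {E : ℝ → F →L[ℂ] F} {y : ℝ → F} {a b K : ℝ}
    (hab : a ≤ b) (hK : ∀ s : ℝ, 0 ≤ s → ‖exp (s • B)‖ ≤ K)
    (hy : ContinuousOn y (Icc a b)) (hE : ContinuousOn E (Icc a b))
    (h : ∀ t ∈ Ioo a b, HasDerivAt y ((B + E t) (y t)) t) :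
    ‖y b‖ ≤ K * ‖y a‖ * Real.exp (∫ t in a..b, K * ‖E t‖) := by
  have hK0 : 0 ≤ K := (norm_nonneg _).trans (hK 0 le_rfl)
  refine le_mul_exp_integral_of_le_add_integral (φ := fun x => ‖y x‖) hab hy.norm
    (continuousOn_const.mul hE.norm) (fun t _ => mul_nonneg hK0 (norm_nonneg _)) ?_
  intro x hx
  have hsub : Icc a x ⊆ Icc a b := Icc_subset_Icc_right hx.2
  have h1 := norm_le_of_exp_decay (α := 0) (K := K) (f := fun t => E t (y t)) hx.1
    (by simpa using hK) (hy.mono hsub) ((hE.clm_apply hy).mono hsub)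
    (fun t ht => h t ⟨ht.1, ht.2.trans_le hx.2⟩)
  simp only [neg_zero, zero_mul, Real.exp_zero, mul_one] at h1
  refine h1.trans (add_le_add_right ?_ _)
  refine intervalIntegral.integral_mono_on hx.1 ?_ ?_ ?_
  · apply ContinuousOn.intervalIntegrable
    rw [uIcc_of_le hx.1]
    exact continuousOn_const.mul ((hE.clm_apply hy).mono hsub).norm
  · apply ContinuousOn.intervalIntegrable
    rw [uIcc_of_le hx.1]
    exact ((continuousOn_const.mul hE.norm).mul hy.norm).mono hsub
  · intro t _
    rw [mul_assoc]
    exact mul_le_mul_of_nonneg_left (ContinuousLinearMap.le_opNorm _ _) hK0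

end LinearODE

section Volterra

open Set NormedSpace

theorem integrableOn_Iic_of_continuous {X : Type*} [NormedAddCommGroup X] {f : ℝ → X} {a : ℝ}
    (hf : Continuous f) (hi : IntegrableOn f (Iic a)) (x : ℝ) : IntegrableOn f (Iic x) := by
  have h : IntegrableOn f (Icc a x) := hf.integrableOn_Icc
  refine (hi.union h).mono_set fun t ht => ?_
  rcases le_total t a with h | h
  · exact Or.inl h
  · exact Or.inr ⟨h, ht⟩

theorem hasDerivAt_integral_Iic {X : Type*} [NormedAddCommGroup X] [NormedSpace ℝ X]
    [CompleteSpace X] {f : ℝ → X} {a : ℝ}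
    (hf : Continuous f) (hi : IntegrableOn f (Iic a)) (x : ℝ) :
    HasDerivAt (fun u => ∫ t in Iic u, f t) (f x) x := by
  have h : (fun u => ∫ t in Iic u, f t) = fun u => (∫ t in Iic a, f t) + ∫ t in a..u, f t := by
    funext u
    rw [← intervalIntegral.integral_Iic_sub_Iic hi (integrableOn_Iic_of_continuous hf hi u)]
    abel
  rw [h]
  exact (intervalIntegral.integral_hasDerivAt_right (hf.intervalIntegrable _ _)
    (hf.stronglyMeasurableAtFilter _ _) hf.continuousAt).const_add _

variable {F : Type*} [NormedAddCommGroup F] [NormedSpace ℂ F]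

/-- The Volterra operator `φ ↦ ∫_{-∞}^x e^{(x-t)B} E(t) φ(t) dt`. -/
noncomputable def volterra (B : F →L[ℂ] F) (E : ℝ → F →L[ℂ] F) (φ : ℝ → F) (x : ℝ) : F :=
  exp (x • B) (∫ t in Iic x, exp ((-t) • B) (E t (φ t)))

variable {B : F →L[ℂ] F} {E : ℝ → F →L[ℂ] F} {K : ℝ}

/-- The primitive `∫_{-∞}^x K ‖E(t)‖ dt`, whose exponential weighs the contraction argument. -/
noncomputable def weight (K : ℝ) (E : ℝ → F →L[ℂ] F) (x : ℝ) : ℝ :=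
  ∫ t in Iic x, K * ‖E t‖

theorem hasDerivAt_weight (hEc : Continuous E) (hEi : IntegrableOn E (Iic 0)) (x : ℝ) :
    HasDerivAt (weight K E) (K * ‖E x‖) x :=
  hasDerivAt_integral_Iic (continuous_const.mul hEc.norm) (hEi.norm.const_mul K) x

theorem continuous_weight (hEc : Continuous E) (hEi : IntegrableOn E (Iic 0)) :
    Continuous (weight K E) :=
  continuous_iff_continuousAt.2 fun x => (hasDerivAt_weight hEc hEi x).continuousAt

theorem tendsto_weight : Tendsto (weight K E) atBot (𝓝 0) :=
  tendsto_integral_Iic_zero tendsto_id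

theorem weight_nonneg (hK : 0 ≤ K) (x : ℝ) : 0 ≤ weight K E x :=
  integral_nonneg fun _ => mul_nonneg hK (norm_nonneg _)

theorem weight_mono (hK : 0 ≤ K) (hEc : Continuous E) (hEi : IntegrableOn E (Iic 0)) :
    Monotone (weight K E) :=
  monotone_of_hasDerivAt_nonneg (fun x => hasDerivAt_weight hEc hEi x)
    fun _ => mul_nonneg hK (norm_nonneg _)

theorem integral_weight (hK : 0 ≤ K) (hEc : Continuous E) (hEi : IntegrableOn E (Iic 0)) (x : ℝ) :
    IntegrableOn (fun t => K * ‖E t‖ * Real.exp (2 * weight K E t)) (Iic x) ∧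
    ∫ t in Iic x, K * ‖E t‖ * Real.exp (2 * weight K E t) =
      (Real.exp (2 * weight K E x) - 1) / 2 := by
  have hw := continuous_weight (K := K) hEc hEi
  have hint : IntegrableOn (fun t => K * ‖E t‖ * Real.exp (2 * weight K E t)) (Iic x) := by
    have h1 : IntegrableOn (fun t => K * ‖E t‖ * Real.exp (2 * weight K E x)) (Iic x) :=
      ((integrableOn_Iic_of_continuous hEc hEi x).norm.const_mul K).mul_const _
    refine Integrable.mono' h1 (Continuous.aestronglyMeasurable (by fun_prop)) ?_
    refine (ae_restrict_iff' measurableSet_Iic).2 (ae_of_all _ fun t ht => ?_)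
    have h0 : 0 ≤ K * ‖E t‖ := mul_nonneg hK (norm_nonneg _)
    rw [Real.norm_of_nonneg (mul_nonneg h0 (Real.exp_pos _).le)]
    exact mul_le_mul_of_nonneg_left (Real.exp_le_exp.2
      (mul_le_mul_of_nonneg_left (weight_mono hK hEc hEi ht) zero_le_two)) h0
  refine ⟨hint, ?_⟩
  have hd : ∀ t, HasDerivAt (fun t => Real.exp (2 * weight K E t) / 2)
      (K * ‖E t‖ * Real.exp (2 * weight K E t)) t := fun t => by
    refine ((((hasDerivAt_weight hEc hEi t).const_mul 2).exp).div_const 2).congr_deriv ?_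
    ring
  have hlim : Tendsto (fun t => Real.exp (2 * weight K E t) / 2) atBot (𝓝 (1 / 2)) := by
    have := ((tendsto_weight (K := K) (E := E)).const_mul 2).rexp.div_const 2
    simpa using this
  rw [integral_Iic_of_hasDerivAt_of_tendsto (hd x).continuousAt.continuousWithinAt
    (fun t _ => hd t) hint hlim]
  ring

variable [CompleteSpace F]

theorem integrableOn_volterra (hK : ∀ s : ℝ, 0 ≤ s → ‖exp (s • B)‖ ≤ K) (hEc : Continuous E)
    (hEi : IntegrableOn E (Iic 0)) {φ : ℝ → F} (hφ : Continuous φ) {c : ℝ}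
    (hc : ∀ t, ‖φ t‖ ≤ c * Real.exp (2 * weight K E t)) (x : ℝ) :
    IntegrableOn (fun t => exp ((-t) • B) (E t (φ t))) (Iic x) := by
  have hK0 : 0 ≤ K := (norm_nonneg _).trans (hK 0 le_rfl)
  have hcont : Continuous fun t => exp ((-t) • B) (E t (φ t)) :=
    ((continuous_exp_smul B).comp continuous_neg).clm_apply (hEc.clm_apply hφ)
  refine integrableOn_Iic_of_continuous hcont (a := 0) ?_ x
  refine Integrable.mono' (((integral_weight hK0 hEc hEi 0).1).const_mul c)
    hcont.aestronglyMeasurable ?_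
  refine (ae_restrict_iff' measurableSet_Iic).2 (ae_of_all _ fun t ht => ?_)
  calc ‖exp ((-t) • B) (E t (φ t))‖ ≤ K * (‖E t‖ * (c * Real.exp (2 * weight K E t))) := by
        refine (ContinuousLinearMap.le_opNorm _ _).trans ?_
        refine mul_le_mul (hK _ (neg_nonneg.2 ht)) ?_ (norm_nonneg _) hK0
        exact (ContinuousLinearMap.le_opNorm _ _).trans
          (mul_le_mul_of_nonneg_left (hc t) (norm_nonneg _))
    _ = _ := by ring

theorem norm_volterra_le (hK : ∀ s : ℝ, 0 ≤ s → ‖exp (s • B)‖ ≤ K) (hEc : Continuous E)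
    (hEi : IntegrableOn E (Iic 0)) {φ : ℝ → F} (hφ : Continuous φ) {c : ℝ}
    (hc : ∀ t, ‖φ t‖ ≤ c * Real.exp (2 * weight K E t)) (x : ℝ) :
    ‖volterra B E φ x‖ ≤ c * ((Real.exp (2 * weight K E x) - 1) / 2) := by
  have hK0 : 0 ≤ K := (norm_nonneg _).trans (hK 0 le_rfl)
  obtain ⟨hi, he⟩ := integral_weight hK0 hEc hEi x
  rw [volterra, ← ContinuousLinearMap.integral_comp_comm _
    (integrableOn_volterra hK hEc hEi hφ hc x), ← he, ← integral_const_mul]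
  refine norm_integral_le_of_norm_le (hi.const_mul c) ?_
  refine (ae_restrict_iff' measurableSet_Iic).2 (ae_of_all _ fun t ht => ?_)
  have hexp : exp (x • B) (exp ((-t) • B) (E t (φ t))) = exp ((x - t) • B) (E t (φ t)) := by
    rw [sub_eq_add_neg, exp_add_smul]; rfl
  rw [hexp]
  calc ‖exp ((x - t) • B) (E t (φ t))‖ ≤ K * (‖E t‖ * (c * Real.exp (2 * weight K E t))) := by
        refine (ContinuousLinearMap.le_opNorm _ _).trans ?_
        refine mul_le_mul (hK _ (sub_nonneg.2 ht)) ?_ (norm_nonneg _) hK0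
        exact (ContinuousLinearMap.le_opNorm _ _).trans
          (mul_le_mul_of_nonneg_left (hc t) (norm_nonneg _))
    _ = _ := by ring

theorem hasDerivAt_volterra (hK : ∀ s : ℝ, 0 ≤ s → ‖exp (s • B)‖ ≤ K) (hEc : Continuous E)
    (hEi : IntegrableOn E (Iic 0)) {φ : ℝ → F} (hφ : Continuous φ) {c : ℝ}
    (hc : ∀ t, ‖φ t‖ ≤ c * Real.exp (2 * weight K E t)) (x : ℝ) :
    HasDerivAt (volterra B E φ) (B (volterra B E φ x) + E x (φ x)) x := by
  have hcont : Continuous fun t => exp ((-t) • B) (E t (φ t)) :=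
    ((continuous_exp_smul B).comp continuous_neg).clm_apply (hEc.clm_apply hφ)
  have h := hasDerivAt_clm_apply (hasDerivAt_exp_smul_const' (𝕂 := ℝ) B x)
    (hasDerivAt_integral_Iic hcont (integrableOn_volterra hK hEc hEi hφ hc 0) x)
  refine h.congr_deriv ?_
  have hexp : exp (x • B) (exp ((-x) • B) (E x (φ x))) = E x (φ x) := by
    change (exp (x • B) * exp ((-x) • B)) (E x (φ x)) = _
    rw [← exp_add_smul]; simp
  rw [hexp]; rfl

/-- If `B` generates a bounded semigroup and `E` is integrable near `-∞`, then every `v` in the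
kernel of `B` is the limit at `-∞` of a solution of `w' = (B + E) w`. The integral equation is a
contraction of factor `1/2` for the supremum norm weighted by `e^{-2G}`, where
`G(x) = ∫_{-∞}^x K ‖E‖`; this works on the whole line at once. -/
theorem exists_solution_tendsto_atBot (hK : ∀ s : ℝ, 0 ≤ s → ‖exp (s • B)‖ ≤ K)
    (hEc : Continuous E) (hEi : IntegrableOn E (Iic 0)) {v : F} (hv : B v = 0) :
    ∃ w : ℝ → F, (∀ x, HasDerivAt w ((B + E x) (w x)) x) ∧ Tendsto w atBot (𝓝 v) ∧
      ∀ x, (∀ t ≤ x, E t = 0) → w x = v := by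
  have hK0 : 0 ≤ K := (norm_nonneg _).trans (hK 0 le_rfl)
  have hwc := continuous_weight (K := K) hEc hEi
  have hlift : ∀ u : BoundedContinuousFunction ℝ F,
      Continuous (fun t => Real.exp (2 * weight K E t) • u t) := fun u => by fun_prop
  have hliftc : ∀ u : BoundedContinuousFunction ℝ F, ∀ t,
      ‖Real.exp (2 * weight K E t) • u t‖ ≤ ‖u‖ * Real.exp (2 * weight K E t) := fun u t => by
    rw [norm_smul, Real.norm_of_nonneg (Real.exp_pos _).le, mul_comm]
    exact mul_le_mul_of_nonneg_right (u.norm_coe_le_norm t) (Real.exp_pos _).le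
  have hVd := fun u : BoundedContinuousFunction ℝ F =>
    hasDerivAt_volterra hK hEc hEi (hlift u) (hliftc u)
  have hVc : ∀ u : BoundedContinuousFunction ℝ F, Continuous (fun x =>
      Real.exp (-(2 * weight K E x)) •
        (v + volterra B E (fun t => Real.exp (2 * weight K E t) • u t) x)) := fun u => by
    have : Continuous (volterra B E (fun t => Real.exp (2 * weight K E t) • u t)) :=
      continuous_iff_continuousAt.2 fun x => (hVd u x).continuousAt
    fun_prop
  have hcancel : ∀ x, Real.exp (-(2 * weight K E x)) * Real.exp (2 * weight K E x) = 1 :=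
    fun x => by rw [← Real.exp_add]; simp
  have hle1 : ∀ x, Real.exp (-(2 * weight K E x)) ≤ 1 := fun x => by
    rw [Real.exp_le_one_iff]
    linarith [weight_nonneg (E := E) hK0 x]
  have hhalf : ∀ {z : F} {c : ℝ} (x : ℝ), 0 ≤ c →
      ‖z‖ ≤ c * ((Real.exp (2 * weight K E x) - 1) / 2) →
      Real.exp (-(2 * weight K E x)) * ‖z‖ ≤ c / 2 := by
    intro z c x hc hz
    have h1 := mul_le_mul_of_nonneg_left hz (Real.exp_pos (-(2 * weight K E x))).le
    have h2 := Real.exp_pos (-(2 * weight K E x))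
    have h3 : Real.exp (-(2 * weight K E x)) * (c * ((Real.exp (2 * weight K E x) - 1) / 2)) =
        c / 2 * (1 - Real.exp (-(2 * weight K E x))) := by
      linear_combination (c / 2) * hcancel x
    nlinarith
  let T : BoundedContinuousFunction ℝ F → BoundedContinuousFunction ℝ F := fun u =>
    BoundedContinuousFunction.ofNormedAddCommGroup _ (hVc u) (‖v‖ + ‖u‖ / 2) (by
      intro x
      rw [norm_smul, Real.norm_of_nonneg (Real.exp_pos _).le]
      refine (mul_le_mul_of_nonneg_left (norm_add_le _ _) (Real.exp_pos _).le).trans ?_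
      rw [mul_add]
      refine add_le_add ?_ ?_
      · exact mul_le_of_le_one_left (norm_nonneg _) (hle1 x)
      · exact hhalf x (norm_nonneg _) (norm_volterra_le hK hEc hEi (hlift u) (hliftc u) x))
  have hT : ContractingWith (1 / 2) T := by
    refine ⟨by rw [← NNReal.coe_lt_coe]; norm_num, LipschitzWith.of_dist_le_mul fun u u' => ?_⟩
    rw [dist_eq_norm, dist_eq_norm]
    refine (BoundedContinuousFunction.norm_le (by positivity)).2 fun x => ?_
    have hsub : volterra B E (fun t => Real.exp (2 * weight K E t) • u t) x -
        volterra B E (fun t => Real.exp (2 * weight K E t) • u' t) x =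
        volterra B E (fun t => Real.exp (2 * weight K E t) • (u - u') t) x := by
      unfold volterra
      rw [← map_sub, ← integral_sub (integrableOn_volterra hK hEc hEi (hlift u) (hliftc u) x)
        (integrableOn_volterra hK hEc hEi (hlift u') (hliftc u') x)]
      simp [smul_sub, map_sub]
    have h1 : (T u - T u') x = Real.exp (-(2 * weight K E x)) •
        volterra B E (fun t => Real.exp (2 * weight K E t) • (u - u') t) x := by
      rw [← hsub]
      rw [← add_sub_add_left_eq_sub _ _ v, smul_sub]
      rfl
    rw [h1, norm_smul, Real.norm_of_nonneg (Real.exp_pos _).le]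
    refine (hhalf x (norm_nonneg _)
      (norm_volterra_le hK hEc hEi (hlift (u - u')) (hliftc (u - u')) x)).trans (le_of_eq ?_)
    simp; ring
  have hfix := hT.fixedPoint_isFixedPt
  set u := ContractingWith.fixedPoint T hT with hu
  have hw : ∀ x, Real.exp (2 * weight K E x) • u x =
      v + volterra B E (fun t => Real.exp (2 * weight K E t) • u t) x := by
    intro x
    have h1 : u x = Real.exp (-(2 * weight K E x)) •
        (v + volterra B E (fun t => Real.exp (2 * weight K E t) • u t) x) :=
      (DFunLike.congr_fun hfix x).symm
    conv_lhs => rw [h1]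
    rw [smul_smul, mul_comm, hcancel, one_smul]
  refine ⟨fun x => Real.exp (2 * weight K E x) • u x, ?_, ?_, ?_⟩
  · intro x
    have h1 := (hVd u x).const_add v
    rw [show (fun x => Real.exp (2 * weight K E x) • u x) = fun x =>
      v + volterra B E (fun t => Real.exp (2 * weight K E t) • u t) x from funext hw]
    refine h1.congr_deriv ?_
    rw [_root_.add_apply, map_add, hv, zero_add, hw x]
  · rw [show (fun x => Real.exp (2 * weight K E x) • u x) = fun x =>
      v + volterra B E (fun t => Real.exp (2 * weight K E t) • u t) x from funext hw]
    have h0 : Tendsto (fun x => ‖u‖ * ((Real.exp (2 * weight K E x) - 1) / 2)) atBot (𝓝 0) := by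
      have := (((tendsto_weight (K := K) (E := E)).const_mul 2).rexp.sub_const 1).div_const 2
      simpa using this.const_mul ‖u‖
    have h1 := squeeze_zero_norm
      (fun x => norm_volterra_le hK hEc hEi (hlift u) (hliftc u) x) h0
    simpa using h1.const_add v
  · intro x hx
    change Real.exp (2 * weight K E x) • u x = v
    rw [hw x, volterra, setIntegral_eq_zero_of_forall_eq_zero, map_zero, add_zero]
    intro t ht
    rw [hx t ht]; simp

end Volterra

section BackwardIVP

open Set NormedSpace

/-- Linear initial value problems are solvable backward on a half-line: the substitution
`x = b - t²` turns the equation into one whose coefficient is continuous and vanishes for `t ≤ 0`,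
so that the prescribed value is a limit at `-∞`. -/
theorem exists_solution_Iic {F : Type*} [NormedAddCommGroup F] [NormedSpace ℂ F] [CompleteSpace F]
    {A : ℝ → F →L[ℂ] F} (hA : Continuous A) (b : ℝ) (p₀ : F) :
    ∃ p : ℝ → F, Continuous p ∧ p b = p₀ ∧ ∀ x < b, HasDerivAt p (-(A x (p x))) x := by
  have hE0 : ∀ t ≤ (0 : ℝ), (2 * max t 0) • A (b - t ^ 2) = 0 := fun t ht => by
    rw [max_eq_right ht]; simp
  obtain ⟨w, hw, -, hw0⟩ := exists_solution_tendsto_atBot (B := (0 : F →L[ℂ] F)) (K := 1)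
    (E := fun t => (2 * max t 0) • A (b - t ^ 2)) (v := p₀)
    (fun s _ => by
      rw [smul_zero, exp_zero]; exact ContinuousLinearMap.norm_id_le)
    (by fun_prop)
    ((integrableOn_congr_fun (s := Iic 0) (g := fun _ => 0) (fun t ht => hE0 t ht)
      measurableSet_Iic).2
      (integrable_zero ℝ (F →L[ℂ] F) _)) (by simp)
  have hwc : Continuous w := continuous_iff_continuousAt.2 fun x => (hw x).continuousAt
  refine ⟨fun x => w (Real.sqrt (b - x)), by fun_prop, ?_, fun x hx => ?_⟩
  · simpa using hw0 0 hE0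
  · have hpos : 0 < b - x := sub_pos.2 hx
    have hs := Real.sqrt_pos.2 hpos
    have h1 : HasDerivAt (fun x => Real.sqrt (b - x)) (-1 / (2 * Real.sqrt (b - x))) x :=
      ((hasDerivAt_id x).const_sub b).sqrt hpos.ne'
    refine ((hw _).scomp x h1).congr_deriv ?_
    simp only [zero_add, _root_.smul_apply, max_eq_left hs.le, Real.sq_sqrt hpos.le, smul_smul]
    rw [show b - (b - x) = x by ring,
      show -1 / (2 * Real.sqrt (b - x)) * (2 * Real.sqrt (b - x)) = -1 by field_simp]
    simp

end BackwardIVP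

/-! ### Exponential decay of stable matrices -/

section Stability

open Set NormedSpace

theorem exists_eigenvector_of_mem_spectrum {F : Type*} [NormedAddCommGroup F] [NormedSpace ℂ F]
    [FiniteDimensional ℂ F] {T : F →L[ℂ] F} {ν : ℂ} (hν : ν ∈ spectrum ℂ T) :
    ∃ u, u ≠ 0 ∧ T u = ν • u := by
  have h : ν ∈ spectrum ℂ ((Module.End.toContinuousLinearMap F).symm T) := by
    rwa [AlgEquiv.spectrum_eq]
  obtain ⟨u, hu⟩ := (Module.End.hasEigenvalue_iff_mem_spectrum.2 h).exists_hasEigenvector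
  exact ⟨u, hu.2, hu.apply_eq_smul⟩

variable {F : Type*} [NormedAddCommGroup F] [NormedSpace ℂ F] [CompleteSpace F]

theorem exp_smul_apply_of_apply_eq_smul {M : F →L[ℂ] F} {u : F} {m : ℂ} (hu : M u = m • u)
    (s : ℝ) : exp (s • M) u = Complex.exp (m * s) • u := by
  have hd : ∀ t : ℝ, HasDerivAt (fun s : ℝ => Complex.exp (-m * s) • exp (s • M) u) 0 t := by
    intro t
    have h1 := (hasDerivAt_clm_apply (hasDerivAt_exp_smul_const (𝕂 := ℝ) M t)
      (hasDerivAt_const t u))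
    have h2 : HasDerivAt (fun s : ℝ => Complex.exp (-m * s)) (Complex.exp (-m * t) * (-m * 1)) t :=
      (((Complex.ofRealCLM.hasDerivAt (x := t)).const_mul (-m)).cexp)
    refine (h2.fun_smul h1).congr_deriv ?_
    simp [hu, smul_smul]
  have h := is_const_of_deriv_eq_zero (fun t => (hd t).differentiableAt) (fun t => (hd t).deriv) s 0
  have h' := congrArg (fun z => Complex.exp (m * s) • z) h
  simpa [smul_smul, ← Complex.exp_add] using h'

theorem exp_smul_add_smul_one (M : F →L[ℂ] F) (α s : ℝ) :
    exp (s • (M + α • (1 : F →L[ℂ] F))) = Real.exp (α * s) • exp (s • M) := by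
  let _ : NormedAlgebra ℚ (F →L[ℂ] F) := NormedAlgebra.restrictScalars ℚ ℝ _
  have hcomm : Commute (s • M) ((α * s) • (1 : F →L[ℂ] F)) :=
    (Commute.one_right _).smul_right _
  have h1 : exp ((α * s) • (1 : F →L[ℂ] F)) = Real.exp (α * s) • (1 : F →L[ℂ] F) := by
    rw [← Algebra.algebraMap_eq_smul_one, ← Algebra.algebraMap_eq_smul_one, Real.exp_eq_exp_ℝ]
    exact (algebraMap_exp_comm (α * s)).symm
  rw [smul_add, smul_smul, mul_comm s α, exp_add_of_commute hcomm, h1, mul_smul_comm, mul_one]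

/-- Exponential decay persists, with half the rate, under small perturbations. -/
theorem norm_exp_smul_le_of_norm_sub_le {M M' : F →L[ℂ] F} {K α : ℝ}
    (hM : ∀ s : ℝ, 0 ≤ s → ‖exp (s • M)‖ ≤ K * Real.exp (-α * s))
    (hMM' : K * ‖M' - M‖ ≤ α / 2) {s : ℝ} (hs : 0 ≤ s) :
    ‖exp (s • M')‖ ≤ K * Real.exp (-(α / 2) * s) := by
  have hK0 : 0 ≤ K := by simpa using (norm_nonneg _).trans (hM 0 le_rfl)
  refine ContinuousLinearMap.opNorm_le_bound _ (mul_nonneg hK0 (Real.exp_pos _).le) fun u => ?_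
  have h := norm_le_mul_exp_integral (B := M + α • (1 : F →L[ℂ] F)) (E := fun _ => M' - M) (K := K)
    (y := fun t => exp (t • (M' + α • (1 : F →L[ℂ] F))) u) hs
    (fun t ht => by
      rw [exp_smul_add_smul_one, norm_smul, Real.norm_of_nonneg (Real.exp_pos _).le]
      refine (mul_le_mul_of_nonneg_left (hM t ht) (Real.exp_pos _).le).trans (le_of_eq ?_)
      rw [mul_left_comm, ← Real.exp_add]; simp)
    (((continuous_exp_smul _).clm_apply continuous_const).continuousOn) continuousOn_const
    (fun t _ => by
      refine (hasDerivAt_exp_smul_apply (M' + α • (1 : F →L[ℂ] F)) u t).congr_deriv ?_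
      congr 1; abel)
  simp only [zero_smul, exp_zero, exp_smul_add_smul_one, _root_.smul_apply, norm_smul,
    intervalIntegral.integral_const, sub_zero, smul_eq_mul,
    Real.norm_of_nonneg (Real.exp_pos _).le] at h
  have h2 : ‖exp (s • M') u‖ ≤ Real.exp (-α * s) * (K * ‖u‖ * Real.exp (α / 2 * s)) := by
    have h3 := mul_le_mul_of_nonneg_left h (Real.exp_pos (-α * s)).le
    rw [← mul_assoc, ← Real.exp_add, neg_mul, neg_add_cancel, Real.exp_zero, one_mul] at h3
    rw [neg_mul]
    refine h3.trans (mul_le_mul_of_nonneg_left (mul_le_mul_of_nonneg_left (Real.exp_le_exp.2 ?_)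
      (by positivity)) (Real.exp_pos _).le)
    rw [mul_comm]
    exact mul_le_mul_of_nonneg_right hMM' hs
  refine h2.trans (le_of_eq ?_)
  rw [show -(α / 2) * s = -α * s + α / 2 * s by ring, Real.exp_add]; ring

variable [FiniteDimensional ℂ F]

/-- The eigenvalues of `e^M` are exponentials of eigenvalues of `M`: an eigenspace of `e^M` is
invariant under `M`, hence contains an eigenvector of `M`. -/
theorem norm_lt_one_of_mem_spectrum_exp {M : F →L[ℂ] F}
    (hM : ∀ (ν : ℂ) (u : F), u ≠ 0 → M u = ν • u → ν.re < 0) {ν : ℂ}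
    (hν : ν ∈ spectrum ℂ (exp M)) : ‖ν‖ < 1 := by
  obtain ⟨u, hu0, hu⟩ := exists_eigenvector_of_mem_spectrum hν
  let W : Submodule ℂ F := LinearMap.ker ((exp M - ν • 1 : F →L[ℂ] F) : F →ₗ[ℂ] F)
  have hmem : ∀ z, z ∈ W ↔ exp M z = ν • z := fun z => by
    simp [W, sub_eq_zero]
  have hinv : ∀ z ∈ W, (M : F →ₗ[ℂ] F) z ∈ W := by
    intro z hz
    rw [hmem] at hz ⊢
    have hc : exp M * M = M * exp M := ((Commute.refl M).exp_left).eq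
    have := DFunLike.congr_fun hc z
    simpa [hz] using this
  have : Nontrivial W := ⟨⟨u, (hmem u).2 hu⟩, 0, fun h => hu0 (congrArg Subtype.val h)⟩
  obtain ⟨m, hm⟩ := Module.End.exists_eigenvalue ((M : F →ₗ[ℂ] F).restrict hinv)
  obtain ⟨z, hz⟩ := hm.exists_hasEigenvector
  have hz0 : (z : F) ≠ 0 := fun h => hz.2 (Subtype.ext h)
  have hMz : M z = m • (z : F) := congrArg Subtype.val hz.apply_eq_smul
  have h1 := exp_smul_apply_of_apply_eq_smul hMz 1
  rw [one_smul, (hmem z).1 z.2] at h1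
  have h2 : ν = Complex.exp m := by simpa using smul_left_injective ℂ hz0 h1
  rw [h2, Complex.norm_exp]
  rw [← Real.exp_zero]
  exact Real.exp_lt_exp.2 (hM m z hz0 hMz)

/-- If every eigenvalue of `M` has negative real part, then `e^{sM}` decays exponentially: the
spectral radius of `e^M` is less than one, so some power of `e^M` is a strict contraction. -/
theorem exists_norm_exp_smul_le {M : F →L[ℂ] F}
    (hM : ∀ (ν : ℂ) (u : F), u ≠ 0 → M u = ν • u → ν.re < 0) :
    ∃ K α : ℝ, 0 < α ∧ ∀ s : ℝ, 0 ≤ s → ‖exp (s • M)‖ ≤ K * Real.exp (-α * s) := by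
  have hrad : spectralRadius ℂ (exp M) < 1 := by
    rcases subsingleton_or_nontrivial F with hF | hF
    · have : Subsingleton (F →L[ℂ] F) := ⟨fun a b => ContinuousLinearMap.ext fun x =>
        Subsingleton.elim _ _⟩
      rw [Subsingleton.elim (exp M) 0]; simp
    · exact spectrum.spectralRadius_lt_of_forall_lt (exp M)
        (r := 1) fun ν hν => by
          rw [← NNReal.coe_lt_coe]; simpa using norm_lt_one_of_mem_spectrum_exp hM hν
  have hN : ∃ N : ℕ, 1 ≤ N ∧ ‖exp ((N : ℝ) • M)‖ < 1 := by
    have h1 := (spectrum.pow_nnnorm_pow_one_div_tendsto_nhds_spectralRadius (exp M)).eventually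
      (gt_mem_nhds hrad)
    obtain ⟨N, hN, hN1⟩ := (h1.and (eventually_ge_atTop 1)).exists
    refine ⟨N, hN1, ?_⟩
    let _ : NormedAlgebra ℚ (F →L[ℂ] F) := NormedAlgebra.restrictScalars ℚ ℝ _
    have h2 : exp ((N : ℝ) • M) = exp M ^ N := by
      rw [← NormedSpace.exp_nsmul, Nat.cast_smul_eq_nsmul]
    rw [h2]
    by_contra! hge
    have h3 : (1 : ENNReal) ≤ (‖exp M ^ N‖₊ : ENNReal) := by
      exact_mod_cast hge
    exact absurd hN (not_lt.2 (ENNReal.one_le_rpow h3 (by positivity)))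
  obtain ⟨N, hN1, hNlt⟩ := hN
  have hNpos : (0 : ℝ) < N := by exact_mod_cast hN1
  set q : ℝ := max ‖exp ((N : ℝ) • M)‖ (1 / 2) with hq
  have hq0 : 0 < q := lt_of_lt_of_le (by norm_num) (le_max_right _ _)
  have hq1 : q < 1 := max_lt hNlt (by norm_num)
  obtain ⟨C, hC⟩ := (isCompact_Icc (a := (0 : ℝ)) (b := N)).exists_bound_of_continuousOn
    (continuous_exp_smul M).continuousOn
  have hC0 : 0 ≤ C := (norm_nonneg _).trans (hC 0 ⟨le_rfl, hNpos.le⟩)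
  have hpow : ∀ k : ℕ, ∀ θ ∈ Icc (0 : ℝ) N, ‖exp ((k * N + θ) • M)‖ ≤ C * q ^ k := by
    intro k θ hθ
    induction k with
    | zero => simpa using hC θ hθ
    | succ k ih =>
      have : ((k + 1 : ℕ) * N + θ : ℝ) = N + (k * N + θ) := by push_cast; ring
      rw [this, exp_add_smul, pow_succ']
      calc _ ≤ ‖exp ((N : ℝ) • M)‖ * ‖exp ((k * N + θ) • M)‖ := norm_mul_le _ _
        _ ≤ q * (C * q ^ k) := mul_le_mul (le_max_left _ _) ih (norm_nonneg _) hq0.le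
        _ = _ := by ring
  have hlog : Real.log q < 0 := Real.log_neg hq0 hq1
  refine ⟨C * Real.exp (-Real.log q), -Real.log q / N, div_pos (neg_pos.2 hlog) hNpos,
    fun s hs => ?_⟩
  set k := ⌊s / N⌋₊ with hk
  have hk1 : (k : ℝ) * N ≤ s := by
    rw [← le_div_iff₀ hNpos]; exact Nat.floor_le (by positivity)
  have hk2 : s ≤ (k + 1) * N := by
    rw [← div_le_iff₀ hNpos]; exact (Nat.lt_floor_add_one _).le
  have h1 := hpow k (s - k * N) ⟨by linarith, by linarith⟩
  rw [add_sub_cancel] at h1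
  refine h1.trans ?_
  rw [mul_assoc]
  refine mul_le_mul_of_nonneg_left ?_ hC0
  rw [← Real.exp_add, ← Real.exp_log (pow_pos hq0 k), Real.log_pow]
  refine Real.exp_le_exp.2 ?_
  have h2 : s / N ≤ k + 1 := by rw [div_le_iff₀ hNpos]; exact hk2
  have h3 : -(-Real.log q / N) * s = Real.log q * (s / N) := by ring
  rw [h3]
  nlinarith

end Stability

/-! ### Solutions on half-lines -/

section HalfLine

open Set NormedSpace

/-- The convolution of `g` with a decaying exponential. -/
noncomputable def expConv (α : ℝ) (g : ℝ → ℝ) (x : ℝ) : ℝ :=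
  ∫ t in Iic x, Real.exp (-α * (x - t)) * g t

theorem integrable_expConv {α : ℝ} (hα : 0 < α) {g : ℝ → ℝ} (hg : Integrable g) :
    Integrable (expConv α g) := by
  have hk : Integrable ((Ici (0 : ℝ)).indicator fun s => Real.exp (-α * s)) :=
    (integrable_indicator_iff measurableSet_Ici).2
      (Iff.mpr integrableOn_Ici_iff_integrableOn_Ioi (exp_neg_integrableOn_Ioi 0 hα))
  have h := Integrable.integrable_convolution (ContinuousLinearMap.mul ℝ ℝ) hg hk
  refine h.congr (ae_of_all _ fun x => ?_)
  rw [convolution_def, expConv, ← integral_indicator measurableSet_Iic]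
  refine integral_congr_ae (ae_of_all _ fun t => ?_)
  by_cases ht : t ≤ x
  · simp [ht, mul_comm]
  · simp [ht]

theorem integrableOn_expConv {α b : ℝ} (hα : 0 < α) {g : ℝ → ℝ} (hg : IntegrableOn g (Iic b)) :
    IntegrableOn (expConv α g) (Iic b) := by
  refine (integrable_expConv hα ((integrable_indicator_iff measurableSet_Iic).2 hg)).integrableOn
    |>.congr_fun (fun x hx => ?_) measurableSet_Iic
  refine setIntegral_congr_fun measurableSet_Iic fun t ht => ?_
  simp only [indicator_of_mem (mem_Iic.2 ((mem_Iic.1 ht).trans hx))]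

theorem integrableOn_exp_mul {α x : ℝ} (hα : 0 < α) {g : ℝ → ℝ} (hg : IntegrableOn g (Iic x)) :
    IntegrableOn (fun t => Real.exp (-α * (x - t)) * g t) (Iic x) := by
  refine Integrable.mono' hg.norm (AEStronglyMeasurable.mul
    (Continuous.aestronglyMeasurable (by fun_prop)) hg.aestronglyMeasurable) ?_
  refine (ae_restrict_iff' measurableSet_Iic).2 (ae_of_all _ fun t ht => ?_)
  rw [norm_mul, Real.norm_of_nonneg (Real.exp_pos _).le]
  refine mul_le_of_le_one_left (norm_nonneg _) (Real.exp_le_one_iff.2 ?_)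
  have : 0 ≤ x - t := sub_nonneg.2 ht
  nlinarith

theorem intervalIntegral_exp_mul_le {α a x : ℝ} (hα : 0 < α) (hax : a ≤ x) {g : ℝ → ℝ}
    (hg : IntegrableOn g (Iic x)) (hg0 : ∀ t ≤ x, 0 ≤ g t) :
    ∫ t in a..x, Real.exp (-α * (x - t)) * g t ≤ expConv α g x := by
  rw [intervalIntegral.integral_of_le hax, expConv]
  refine setIntegral_mono_set (integrableOn_exp_mul hα hg) ?_
    (Ioc_subset_Iic_self.eventuallyLE)
  refine (ae_restrict_iff' measurableSet_Iic).2 (ae_of_all _ fun t ht => ?_)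
  exact mul_nonneg (Real.exp_pos _).le (hg0 t ht)

variable {F : Type*} [NormedAddCommGroup F] [NormedSpace ℂ F]

/-- `P` is a projection onto the kernel of `B`, commuting with `B`, and `B - P` generates an
exponentially stable semigroup, with explicit constants. Subtracting `P` moves the eigenvalue `0`
of `B` to `-1` and leaves the rest of the spectrum unchanged. -/
structure SpectralSplitting (B P : F →L[ℂ] F) (K α : ℝ) : Prop where
  pos : 0 < α
  idem : P * P = P
  mul_proj : B * P = 0
  proj_mul : P * B = 0
  norm_proj_le : ‖P‖ ≤ K
  decay : ∀ s : ℝ, 0 ≤ s → ‖exp (s • (B - P))‖ ≤ K * Real.exp (-α * s)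

namespace SpectralSplitting

variable {B P : F →L[ℂ] F} {K α : ℝ}

theorem nonneg (h : SpectralSplitting B P K α) : 0 ≤ K := (norm_nonneg _).trans h.norm_proj_le

theorem norm_one_sub_le (h : SpectralSplitting B P K α) : ‖1 - P‖ ≤ 1 + K :=
  (norm_sub_le _ _).trans (add_le_add ContinuousLinearMap.norm_id_le h.norm_proj_le)

theorem mul_one_sub (h : SpectralSplitting B P K α) : B * (1 - P) = B := by
  rw [mul_sub, mul_one, h.mul_proj, sub_zero]

theorem one_sub_mul (h : SpectralSplitting B P K α) : (1 - P) * B = B := by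
  rw [sub_mul, one_mul, h.proj_mul, sub_zero]

theorem sub_mul_one_sub (h : SpectralSplitting B P K α) : (B - P) * (1 - P) = B := by
  rw [sub_mul, h.mul_one_sub, mul_sub, mul_one, h.idem, sub_self, sub_zero]

theorem hasDerivAt_one_sub_apply (h : SpectralSplitting B P K α) {E : F →L[ℂ] F} {y : ℝ → F}
    {t : ℝ} (hy : HasDerivAt y ((B + E) (y t)) t) :
    HasDerivAt (fun x => (1 - P) (y x)) ((B - P) ((1 - P) (y t)) + (1 - P) (E (y t))) t := by
  refine (hasDerivAt_clm_const_apply (1 - P) hy).congr_deriv ?_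
  have h1 : (1 - P) (B (y t)) = B (y t) := DFunLike.congr_fun h.one_sub_mul (y t)
  have h2 : (B - P) ((1 - P) (y t)) = B (y t) := DFunLike.congr_fun h.sub_mul_one_sub (y t)
  rw [_root_.add_apply, map_add, h1, h2]

variable [CompleteSpace F]

theorem norm_exp_smul_le (h : SpectralSplitting B P K α) {s : ℝ} (hs : 0 ≤ s) :
    ‖exp (s • B)‖ ≤ K + K * (1 + K) := by
  refine ContinuousLinearMap.opNorm_le_bound _
    (add_nonneg h.nonneg (mul_nonneg h.nonneg (add_nonneg zero_le_one h.nonneg))) fun u => ?_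
  have h1 : exp (s • B) (P u) = P u :=
    exp_smul_apply_of_apply_eq_zero (B := B) (v := P u) (DFunLike.congr_fun h.mul_proj u) s
  have h2 : exp (s • P) ((1 - P) u) = (1 - P) u := by
    refine exp_smul_apply_of_apply_eq_zero ?_ s
    change (P * (1 - P)) u = 0
    rw [mul_sub, mul_one, h.idem, sub_self]; rfl
  have h3 : exp (s • B) = exp (s • (B - P)) * exp (s • P) := by
    let _ : NormedAlgebra ℚ (F →L[ℂ] F) := NormedAlgebra.restrictScalars ℚ ℝ _
    have hc : Commute (B - P) P := by
      change (B - P) * P = P * (B - P)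
      rw [sub_mul, mul_sub, h.mul_proj, h.proj_mul]
    rw [← NormedSpace.exp_add_of_commute ((hc.smul_left s).smul_right s), ← smul_add,
      sub_add_cancel]
  have h4 : exp (s • B) u = P u + exp (s • (B - P)) ((1 - P) u) := by
    have : u = P u + (1 - P) u := by simp
    conv_lhs => rw [this, map_add, h1, h3]
    change _ + exp (s • (B - P)) (exp (s • P) ((1 - P) u)) = _
    rw [h2]
  have h5 : ‖exp (s • (B - P))‖ ≤ K := by
    refine (h.decay s hs).trans (mul_le_of_le_one_right h.nonneg (Real.exp_le_one_iff.2 ?_))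
    have := mul_nonneg h.pos.le hs
    linarith
  rw [h4, add_mul, mul_assoc]
  refine (norm_add_le _ _).trans (add_le_add ?_ ?_)
  · exact (P.le_opNorm u).trans (mul_le_mul_of_nonneg_right h.norm_proj_le (norm_nonneg _))
  · refine (ContinuousLinearMap.le_opNorm _ _).trans (mul_le_mul h5 ?_ (norm_nonneg _) h.nonneg)
    exact ((1 - P).le_opNorm u).trans
      (mul_le_mul_of_nonneg_right h.norm_one_sub_le (norm_nonneg _))

/-- Solutions of `y' = (B + E) y` with `E` integrable near `+∞` converge to an element of the range
of `P`, and their component complementary to `P` is integrable. -/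
theorem forward (h : SpectralSplitting B P K α) {E : ℝ → F →L[ℂ] F} {y : ℝ → F} {a : ℝ}
    (hEc : ContinuousOn E (Ici a)) (hEi : IntegrableOn E (Ici a)) (hy : ContinuousOn y (Ici a))
    (hd : ∀ t > a, HasDerivAt y ((B + E t) (y t)) t) :
    (∃ C, ∀ x ≥ a, ‖y x‖ ≤ C) ∧ IntegrableOn (fun x => (1 - P) (y x)) (Ici a) ∧
      ∃ m, Tendsto y atTop (𝓝 m) ∧ P m = m := by
  set K' := K + K * (1 + K) with hK'
  have hK'0 : 0 ≤ K' := (norm_nonneg _).trans (h.norm_exp_smul_le le_rfl)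
  have hK1 : 0 ≤ 1 + K := add_nonneg zero_le_one h.nonneg
  have hbd : ∀ x ≥ a, ‖y x‖ ≤ K' * ‖y a‖ * Real.exp (∫ t in Ici a, K' * ‖E t‖) := by
    intro x hx
    refine (norm_le_mul_exp_integral hx (fun s hs => h.norm_exp_smul_le hs)
      (hy.mono Icc_subset_Ici_self) (hEc.mono Icc_subset_Ici_self) fun t ht => hd t ht.1).trans ?_
    refine mul_le_mul_of_nonneg_left (Real.exp_le_exp.2 ?_) (mul_nonneg hK'0 (norm_nonneg _))
    rw [intervalIntegral.integral_of_le hx]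
    refine setIntegral_mono_set (hEi.norm.const_mul _)
      (ae_of_all _ fun t => mul_nonneg hK'0 (norm_nonneg _)) ?_
    exact (show Ioc a x ⊆ Ici a from fun t ht => ht.1.le).eventuallyLE
  set C := K' * ‖y a‖ * Real.exp (∫ t in Ici a, K' * ‖E t‖) with hC
  have hC0 : 0 ≤ C := (norm_nonneg _).trans (hbd a le_rfl)
  have hz : ContinuousOn (fun x => (1 - P) (y x)) (Ici a) := (1 - P).continuous.comp_continuousOn hy
  have hf : ContinuousOn (fun x => (1 - P) (E x (y x))) (Ici a) :=
    (1 - P).continuous.comp_continuousOn (hEc.clm_apply hy)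
  set g : ℝ → ℝ := (Ici a).indicator fun t => ‖E t‖ with hg
  have hgi : Integrable g := (integrable_indicator_iff measurableSet_Ici).2 hEi.norm
  have hg0 : ∀ t, 0 ≤ g t := fun t => indicator_nonneg (fun _ _ => norm_nonneg _) t
  have hzle : ∀ x ≥ a, ‖(1 - P) (y x)‖ ≤ K * Real.exp (-α * (x - a)) * ‖(1 - P) (y a)‖ +
      K * ((1 + K) * C) * expConv α g x := by
    intro x hx
    refine (norm_le_of_exp_decay hx h.decay (hz.mono Icc_subset_Ici_self)
      (hf.mono Icc_subset_Ici_self)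
      fun t ht => h.hasDerivAt_one_sub_apply (hd t ht.1)).trans (add_le_add_right ?_ _)
    calc ∫ t in a..x, K * Real.exp (-α * (x - t)) * ‖(1 - P) (E t (y t))‖
        ≤ ∫ t in a..x, K * ((1 + K) * C) * (Real.exp (-α * (x - t)) * g t) := by
          refine intervalIntegral.integral_mono_on hx ?_ ?_ ?_
          · apply ContinuousOn.intervalIntegrable
            rw [uIcc_of_le hx]
            exact (by fun_prop :
              Continuous fun t : ℝ => K * Real.exp (-α * (x - t))).continuousOn.mul
                (hf.mono Icc_subset_Ici_self).norm
          · refine ((intervalIntegrable_iff_integrableOn_Ioc_of_le hx).2 ?_).const_mul _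
            exact (integrableOn_exp_mul h.pos hgi.integrableOn).mono_set Ioc_subset_Iic_self
          · intro t ht
            have hgt : g t = ‖E t‖ := indicator_of_mem (show t ∈ Ici a from ht.1) _
            have h1 : ‖(1 - P) (E t (y t))‖ ≤ (1 + K) * (g t * C) := by
              rw [hgt]
              refine ((1 - P).le_opNorm _).trans
                (mul_le_mul h.norm_one_sub_le ?_ (norm_nonneg _) hK1)
              exact ((E t).le_opNorm _).trans
                (mul_le_mul_of_nonneg_left (hbd t ht.1) (norm_nonneg _))
            refine (mul_le_mul_of_nonneg_left h1
              (mul_nonneg h.nonneg (Real.exp_pos _).le)).trans (le_of_eq ?_)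
            ring
      _ = K * ((1 + K) * C) * ∫ t in a..x, Real.exp (-α * (x - t)) * g t :=
          intervalIntegral.integral_const_mul _ _
      _ ≤ _ := mul_le_mul_of_nonneg_left
          (intervalIntegral_exp_mul_le h.pos hx hgi.integrableOn fun t _ => hg0 t)
          (mul_nonneg h.nonneg (mul_nonneg hK1 hC0))
  have hzi : IntegrableOn (fun x => (1 - P) (y x)) (Ici a) := by
    have h1 : IntegrableOn (fun x => Real.exp (-α * (x - a))) (Ici a) := by
      have h2 := Iff.mpr integrableOn_Ici_iff_integrableOn_Ioi (exp_neg_integrableOn_Ioi a h.pos)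
      refine IntegrableOn.congr_fun (h2.const_mul (Real.exp (α * a))) (fun x _ => ?_)
        measurableSet_Ici
      simp only [← Real.exp_add]
      congr 1; ring
    refine Integrable.mono' (((h1.const_mul K).mul_const ‖(1 - P) (y a)‖).add
      ((integrable_expConv h.pos hgi).integrableOn.const_mul (K * ((1 + K) * C))))
      (hz.aestronglyMeasurable measurableSet_Ici) ?_
    exact (ae_restrict_iff' measurableSet_Ici).2 (ae_of_all _ fun x hx => hzle x hx)
  have hEy : IntegrableOn (fun x => E x (y x)) (Ici a) := by
    refine Integrable.mono' (hEi.norm.mul_const C)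
      ((hEc.clm_apply hy).aestronglyMeasurable measurableSet_Ici) ?_
    refine (ae_restrict_iff' measurableSet_Ici).2 (ae_of_all _ fun x hx => ?_)
    exact ((E x).le_opNorm _).trans (mul_le_mul_of_nonneg_left (hbd x hx) (norm_nonneg _))
  have hyi : IntegrableOn (fun x => (B + E x) (y x)) (Ioi a) := by
    have h0 : IntegrableOn (fun x => B ((1 - P) (y x)) + E x (y x)) (Ici a) :=
      (B.integrable_comp hzi).add hEy
    refine (h0.mono_set Ioi_subset_Ici_self).congr_fun (fun x _ => ?_) measurableSet_Ioi
    have h1 : B ((1 - P) (y x)) = B (y x) := DFunLike.congr_fun h.mul_one_sub (y x)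
    simp only [h1, _root_.add_apply]
  have hzd : IntegrableOn (fun x => (1 - P) ((B + E x) (y x))) (Ioi a) :=
    (1 - P).integrable_comp hyi
  have hlim := tendsto_limUnder_of_hasDerivAt_of_integrableOn_Ioi (fun x hx => hd x hx) hyi
  have hz0 := tendsto_zero_of_hasDerivAt_of_integrableOn_Ioi
    (fun x hx => hasDerivAt_clm_const_apply (1 - P) (hd x hx)) hzd
    (hzi.mono_set Ioi_subset_Ici_self)
  refine ⟨⟨C, hbd⟩, hzi, _, hlim, ?_⟩
  have h1 := tendsto_nhds_unique hz0 (((1 - P).continuous.tendsto _).comp hlim)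
  rw [_root_.sub_apply, eq_comm, sub_eq_zero] at h1
  exact h1.symm

/-- The solutions of `y' = (B + E) y` with limit `v` at `-∞` are bounded by `‖v‖`, with constants
that depend only on a majorant `g` of `‖E‖` and on the constants of the splitting. -/
theorem norm_le_of_tendsto_atBot (h : SpectralSplitting B P K α) {E : ℝ → F →L[ℂ] F} {y : ℝ → F}
    {b : ℝ} {v : F} {g : ℝ → ℝ} (hEc : ContinuousOn E (Iic b)) (hg : IntegrableOn g (Iic b))
    (hEg : ∀ t ≤ b, ‖E t‖ ≤ g t) (hd : ∀ t ≤ b, HasDerivAt y ((B + E t) (y t)) t)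
    (hv : Tendsto y atBot (𝓝 v)) {x : ℝ} (hx : x ≤ b) :
    ‖y x‖ ≤ (K + K * (1 + K)) * ‖v‖ * Real.exp ((K + K * (1 + K)) * ∫ t in Iic b, g t) := by
  set K' := K + K * (1 + K) with hK'
  have hK'0 : 0 ≤ K' := (norm_nonneg _).trans (h.norm_exp_smul_le le_rfl)
  refine ge_of_tendsto ((hv.norm.const_mul K').mul_const _) ?_
  filter_upwards [eventually_le_atBot x] with a ha
  have hsub : Icc a x ⊆ Iic b := fun t ht => ht.2.trans hx
  refine (norm_le_mul_exp_integral ha (fun s hs => h.norm_exp_smul_le hs)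
    (fun t ht => (hd t (hsub ht)).continuousAt.continuousWithinAt) (hEc.mono hsub)
    fun t ht => hd t (hsub (Ioo_subset_Icc_self ht))).trans ?_
  refine mul_le_mul_of_nonneg_left (Real.exp_le_exp.2 ?_) (mul_nonneg hK'0 (norm_nonneg _))
  rw [intervalIntegral.integral_const_mul]
  refine mul_le_mul_of_nonneg_left ?_ hK'0
  have hsub' : Ioc a x ⊆ Iic b := fun t ht => ht.2.trans hx
  rw [intervalIntegral.integral_of_le ha]
  refine (setIntegral_mono_on ?_ (hg.mono_set hsub') measurableSet_Ioc
    fun t ht => hEg t (hsub' ht)).trans (setIntegral_mono_set hg ?_ hsub'.eventuallyLE)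
  · exact ((hEc.mono hsub).norm.integrableOn_Icc).mono_set Ioc_subset_Icc_self
  · exact (ae_restrict_iff' measurableSet_Iic).2
      (ae_of_all _ fun t ht => (norm_nonneg _).trans (hEg t ht))

/-- The component complementary to `P` of a solution bounded near `-∞` is dominated by an
integrable function depending only on a majorant `g` of `‖E‖`. -/
theorem norm_one_sub_le_expConv (h : SpectralSplitting B P K α) {E : ℝ → F →L[ℂ] F} {y : ℝ → F}
    {b C : ℝ} {g : ℝ → ℝ} (hEc : ContinuousOn E (Iic b)) (hg : IntegrableOn g (Iic b))
    (hEg : ∀ t ≤ b, ‖E t‖ ≤ g t) (hd : ∀ t ≤ b, HasDerivAt y ((B + E t) (y t)) t)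
    (hC : ∀ t ≤ b, ‖y t‖ ≤ C) {x : ℝ} (hx : x ≤ b) :
    ‖(1 - P) (y x)‖ ≤ K * ((1 + K) * C) * expConv α g x := by
  have hK1 : 0 ≤ 1 + K := add_nonneg zero_le_one h.nonneg
  have hC0 : 0 ≤ C := (norm_nonneg _).trans (hC x hx)
  have hy : ContinuousOn y (Iic b) := fun t ht => (hd t ht).continuousAt.continuousWithinAt
  have hz : ContinuousOn (fun x => (1 - P) (y x)) (Iic b) := (1 - P).continuous.comp_continuousOn hy
  have hf : ContinuousOn (fun x => (1 - P) (E x (y x))) (Iic b) :=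
    (1 - P).continuous.comp_continuousOn (hEc.clm_apply hy)
  have hgx : IntegrableOn g (Iic x) := hg.mono_set (Iic_subset_Iic.2 hx)
  have hexp : Tendsto (fun a => K * Real.exp (-α * (x - a)) * ((1 + K) * C)) atBot (𝓝 0) := by
    have h1 : Tendsto (fun a : ℝ => α * (a - x)) atBot atBot :=
      (tendsto_atBot_add_const_right _ (-x) tendsto_id).const_mul_atBot h.pos
    have h2 := ((Real.tendsto_exp_atBot.comp h1).const_mul K).mul_const ((1 + K) * C)
    rw [mul_zero, zero_mul] at h2
    refine h2.congr fun a => ?_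
    simp only [Function.comp_def]
    congr 3; ring
  have hlim := hexp.add_const (K * ((1 + K) * C) * expConv α g x)
  rw [zero_add] at hlim
  refine ge_of_tendsto hlim ?_
  filter_upwards [eventually_le_atBot x] with a ha
  have hsub : Icc a x ⊆ Iic b := fun t ht => ht.2.trans hx
  refine (norm_le_of_exp_decay ha h.decay (hz.mono hsub) (hf.mono hsub)
    fun t ht => h.hasDerivAt_one_sub_apply (hd t (hsub (Ioo_subset_Icc_self ht)))).trans
    (add_le_add ?_ ?_)
  · refine mul_le_mul_of_nonneg_left ?_ (mul_nonneg h.nonneg (Real.exp_pos _).le)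
    exact ((1 - P).le_opNorm _).trans
      (mul_le_mul h.norm_one_sub_le (hC a (ha.trans hx)) (norm_nonneg _) hK1)
  calc ∫ t in a..x, K * Real.exp (-α * (x - t)) * ‖(1 - P) (E t (y t))‖
      ≤ ∫ t in a..x, K * ((1 + K) * C) * (Real.exp (-α * (x - t)) * g t) := by
        refine intervalIntegral.integral_mono_on ha ?_ ?_ ?_
        · apply ContinuousOn.intervalIntegrable
          rw [uIcc_of_le ha]
          exact (by fun_prop : Continuous fun t : ℝ => K * Real.exp (-α * (x - t))).continuousOn.mul
            (hf.mono hsub).norm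
        · refine ((intervalIntegrable_iff_integrableOn_Ioc_of_le ha).2 ?_).const_mul _
          exact (integrableOn_exp_mul h.pos hgx).mono_set Ioc_subset_Iic_self
        · intro t ht
          have htb := hsub ht
          have h1 : ‖(1 - P) (E t (y t))‖ ≤ (1 + K) * (g t * C) := by
            refine ((1 - P).le_opNorm _).trans
              (mul_le_mul h.norm_one_sub_le ?_ (norm_nonneg _) hK1)
            exact ((E t).le_opNorm _).trans
              (mul_le_mul (hEg t htb) (hC t htb) (norm_nonneg _)
                ((norm_nonneg _).trans (hEg t htb)))
          refine (mul_le_mul_of_nonneg_left h1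
            (mul_nonneg h.nonneg (Real.exp_pos _).le)).trans (le_of_eq ?_)
          ring
    _ = K * ((1 + K) * C) * ∫ t in a..x, Real.exp (-α * (x - t)) * g t :=
        intervalIntegral.integral_const_mul _ _
    _ ≤ _ := mul_le_mul_of_nonneg_left
        (intervalIntegral_exp_mul_le h.pos ha hgx
          fun t ht => (norm_nonneg _).trans (hEg t (ht.trans hx)))
        (mul_nonneg h.nonneg (mul_nonneg hK1 hC0))

end SpectralSplitting

theorem norm_exp_smul_le_of_solutions [CompleteSpace F] {T : F →L[ℂ] F} {s c : ℝ} (hs : 0 ≤ s)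
    (hc : 0 ≤ c) (h : ∀ p, ∃ y : ℝ → F, y 0 = p ∧ (∀ t, HasDerivAt y (T (y t)) t) ∧
      ‖y s‖ ≤ c * ‖p‖) : ‖exp (s • T)‖ ≤ c := by
  refine ContinuousLinearMap.opNorm_le_bound _ hc fun p => ?_
  obtain ⟨y, hy0, hy, hle⟩ := h p
  have h1 := duhamel (f := fun _ => 0) hs (fun t _ => (hy t).continuousAt.continuousWithinAt)
    continuousOn_const (fun t _ => (hy t).congr_deriv (add_zero _).symm)
  simp only [sub_zero, map_zero, intervalIntegral.integral_zero, add_zero, hy0] at h1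
  rwa [← h1]

/-- The transposed operator `p ↦ p ∘ B` on the dual space. -/
noncomputable def transposeOp (B : F →L[ℂ] F) : (F →L[ℂ] ℂ) →L[ℂ] (F →L[ℂ] ℂ) :=
  ContinuousLinearMap.precomp ℂ B

theorem transposeOp_apply (B : F →L[ℂ] F) (p : F →L[ℂ] ℂ) : transposeOp B p = p.comp B := rfl

theorem norm_transposeOp_le (B : F →L[ℂ] F) : ‖transposeOp B‖ ≤ ‖B‖ :=
  ContinuousLinearMap.opNorm_le_bound _ (norm_nonneg _) fun p => by
    rw [mul_comm]; exact p.opNorm_comp_le B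

theorem continuous_transposeOp : Continuous (transposeOp : (F →L[ℂ] F) → _) :=
  (ContinuousLinearMap.compL ℂ F F ℂ).flip.continuous

/-- The transposed operators on the dual space split in the same way. -/
theorem SpectralSplitting.transpose [CompleteSpace F] {B P : F →L[ℂ] F} {K α : ℝ}
    (h : SpectralSplitting B P K α) :
    SpectralSplitting (transposeOp B) (transposeOp P) K α := by
  have hmul : ∀ S T : F →L[ℂ] F, transposeOp S * transposeOp T = transposeOp (T * S) :=
    fun S T => rfl
  have hzero : transposeOp (0 : F →L[ℂ] F) = 0 := by ext; simp [transposeOp]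
  refine ⟨h.pos, by rw [hmul, h.idem], by rw [hmul, h.proj_mul, hzero],
    by rw [hmul, h.mul_proj, hzero], (norm_transposeOp_le P).trans h.norm_proj_le, fun s hs => ?_⟩
  refine norm_exp_smul_le_of_solutions hs (mul_nonneg h.nonneg (Real.exp_pos _).le) fun p =>
    ⟨fun t => p.comp (exp (t • (B - P))), ?_, fun t => ?_, ?_⟩
  · simp only [zero_smul, exp_zero]; rfl
  · exact (hasDerivAt_clm_const_apply (ContinuousLinearMap.compL ℂ F F ℂ p)
      (hasDerivAt_exp_smul_const (𝕂 := ℝ) (B - P) t)).congr_deriv (by ext u; simp [transposeOp])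
  · rw [mul_comm]
    exact (p.opNorm_comp_le _).trans
      (mul_le_mul_of_nonneg_left (h.decay s hs) (norm_nonneg _))

end HalfLine

/-! ### Dependence on the parameter near one end of the line -/

section Parameter

open Set

variable {F : Type*} [NormedAddCommGroup F] [NormedSpace ℂ F]

/-- A solution `q` of the transposed equation on `(-∞, b]` is bounded, its part complementary to `P`
is integrable, and `q` converges at `-∞` to a row vector fixed by `P`. -/
theorem SpectralSplitting.row {B P : F →L[ℂ] F} {K α : ℝ}
    (h : SpectralSplitting B P K α) [CompleteSpace F] {E : ℝ → F →L[ℂ] F} {q : ℝ → F →L[ℂ] ℂ}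
    {b : ℝ} (hEc : ContinuousOn E (Iic b)) (hEi : IntegrableOn E (Iic b))
    (hq : ContinuousOn q (Iic b)) (hd : ∀ t < b, HasDerivAt q (-(q t).comp (B + E t)) t) :
    (∃ C, ∀ x ≤ b, ‖q x‖ ≤ C) ∧ IntegrableOn (fun x => (q x).comp (1 - P)) (Iic b) ∧
      ∃ m, Tendsto q atBot (𝓝 m) ∧ m.comp P = m := by
  have hmaps : MapsTo (fun t : ℝ => -t) (Ici (-b)) (Iic b) := fun t ht => by
    simp only [mem_Ici, mem_Iic] at ht ⊢; linarith
  have hneg : (fun t : ℝ => -t) ⁻¹' (Iic b) = Ici (-b) := by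
    ext t; simp only [mem_preimage, mem_Iic, mem_Ici]; constructor <;> intro h <;> linarith
  have hEi' : IntegrableOn (fun t => E (-t)) (Ici (-b)) := by
    have := ((Measure.measurePreserving_neg (volume : Measure ℝ)).integrableOn_comp_preimage
      (Homeomorph.neg ℝ).measurableEmbedding (f := E) (s := Iic b)).2 hEi
    rwa [hneg] at this
  obtain ⟨⟨C, hC⟩, hi, m, hm, hPm⟩ := h.transpose.forward (E := fun t => transposeOp (E (-t)))
    (y := fun t => q (-t)) (a := -b)
    (continuous_transposeOp.comp_continuousOn (hEc.comp continuous_neg.continuousOn hmaps))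
    (Integrable.mono hEi' (continuous_transposeOp.comp_aestronglyMeasurable hEi'.1)
      (ae_of_all _ fun t => norm_transposeOp_le _)) (hq.comp continuous_neg.continuousOn hmaps)
    (fun t ht => by
      have h1 := (hd (-t) (by linarith)).scomp t (hasDerivAt_neg t)
      refine h1.congr_deriv ?_
      ext u
      simp [transposeOp_apply, add_comm])
  refine ⟨⟨C, fun x hx => by simpa using hC (-x) (neg_le_neg hx)⟩, ?_, m, ?_, hPm⟩
  · have h1 := ((Measure.measurePreserving_neg (volume : Measure ℝ)).integrableOn_comp_preimage
      (Homeomorph.neg ℝ).measurableEmbedding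
      (f := fun x => (q x).comp (1 - P)) (s := Iic b)).1 ?_
    · exact h1
    · rw [hneg]
      refine IntegrableOn.congr_fun hi (fun t _ => ?_) measurableSet_Ici
      ext u
      simp [transposeOp_apply]
  · have := hm.comp tendsto_neg_atBot_atTop
    refine this.congr fun x => ?_
    simp

theorem tendsto_of_forall_dual [FiniteDimensional ℂ F] {X : Type*} {l : Filter X} {f : X → F}
    {a : F} (h : ∀ p : F →L[ℂ] ℂ, Tendsto (fun x => p (f x)) l (𝓝 (p a))) : Tendsto f l (𝓝 a) := by
  let e := (Module.finBasis ℂ F).equivFunL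
  have h1 : Tendsto (fun x => e (f x)) l (𝓝 (e a)) :=
    tendsto_pi_nhds.2 fun i => h ((ContinuousLinearMap.proj i).comp e.toContinuousLinearMap)
  simpa [Function.comp_def] using (e.symm.continuous.tendsto _).comp h1

theorem differentiableAt_of_forall_dual [FiniteDimensional ℂ F] {f : ℂ → F} {a : ℂ}
    (h : ∀ p : F →L[ℂ] ℂ, DifferentiableAt ℂ (fun x => p (f x)) a) : DifferentiableAt ℂ f a := by
  let e := (Module.finBasis ℂ F).equivFunL
  have h1 : DifferentiableAt ℂ (fun x => e (f x)) a :=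
    differentiableAt_pi.2 fun i => h ((ContinuousLinearMap.proj i).comp e.toContinuousLinearMap)
  simpa [Function.comp_def] using e.symm.differentiableAt.comp a h1

/-- A family, parametrized by `l` near `l₀`, of solutions `w(·, l)` of `w' = (B(l) + E(x, l)) w`
with limits `v(l)` at `-∞`. The spectral splitting is uniform, and `E` and its increments in `l` are
dominated by an integrable function `g` on `(-∞, 0]`. -/
structure LeftFamily (B P : ℂ → F →L[ℂ] F) (E : ℝ → ℂ → F →L[ℂ] F) (v : ℂ → F) (w : ℝ → ℂ → F)
    (l₀ : ℂ) (K α : ℝ) (g : ℝ → ℝ) : Prop where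
  split : ∀ᶠ l in 𝓝 l₀, SpectralSplitting (B l) (P l) K α
  diff_generator : DifferentiableAt ℂ B l₀
  diff_proj : DifferentiableAt ℂ P l₀
  diff_limit : DifferentiableAt ℂ v l₀
  continuous : ∀ᶠ l in 𝓝 l₀, Continuous fun x => E x l
  diff_error : ∀ x ≤ 0, DifferentiableAt ℂ (E x) l₀
  integrable : IntegrableOn g (Iic 0)
  dominated : ∀ᶠ l in 𝓝 l₀, ∀ x ≤ 0, ‖E x l‖ ≤ g x ∧ ‖E x l - E x l₀‖ ≤ ‖l - l₀‖ * g x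
  solution : ∀ᶠ l in 𝓝 l₀, (∀ x, HasDerivAt (fun x => w x l) ((B l + E x l) (w x l)) x) ∧
    Tendsto (fun x => w x l) atBot (𝓝 (v l))

/-- A solution on `(-∞, b]` of the transposed equation at the parameter `l₀`. -/
structure IsRow (B : F →L[ℂ] F) (E : ℝ → F →L[ℂ] F) (b : ℝ) (q : ℝ → F →L[ℂ] ℂ) : Prop where
  continuousOn : ContinuousOn q (Iic b)
  hasDerivAt : ∀ t < b, HasDerivAt q (-(q t).comp (B + E t)) t

namespace LeftFamily

variable {B P : ℂ → F →L[ℂ] F} {E : ℝ → ℂ → F →L[ℂ] F} {v : ℂ → F} {w : ℝ → ℂ → F} {l₀ : ℂ}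
  {K α : ℝ} {g : ℝ → ℝ}

theorem integrableOn_error (h : LeftFamily B P E v w l₀ K α g) {b : ℝ} (hb : b ≤ 0) :
    IntegrableOn (fun x => E x l₀) (Iic b) := by
  refine IntegrableOn.mono_set ?_ (Iic_subset_Iic.2 hb)
  refine Integrable.mono' h.integrable h.continuous.self_of_nhds.aestronglyMeasurable ?_
  exact (ae_restrict_iff' measurableSet_Iic).2
    (ae_of_all _ fun x hx => (h.dominated.self_of_nhds x hx).1)

theorem aestronglyMeasurable_increment (h : LeftFamily B P E v w l₀ K α g) {b : ℝ}
    {q : ℝ → F →L[ℂ] ℂ} (hq : IsRow (B l₀) (fun x => E x l₀) b q) : ∀ᶠ l in 𝓝 l₀,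
      AEStronglyMeasurable (fun x => q x (((B l + E x l) - (B l₀ + E x l₀)) (w x l)))
        (volume.restrict (Iic b)) := by
  filter_upwards [h.continuous, h.solution] with l hc hw
  refine ContinuousOn.aestronglyMeasurable ?_ measurableSet_Iic
  have hwc : Continuous fun x => w x l :=
    continuous_iff_continuousAt.2 fun x => (hw.1 x).continuousAt
  refine hq.continuousOn.clm_apply (ContinuousOn.clm_apply ?_ hwc.continuousOn)
  exact ((continuous_const.add hc).sub
    (continuous_const.add h.continuous.self_of_nhds)).continuousOn

theorem exists_row (h : LeftFamily B P E v w l₀ K α g) (b : ℝ) (p₀ : F →L[ℂ] ℂ) :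
    ∃ q, IsRow (B l₀) (fun x => E x l₀) b q ∧ q b = p₀ := by
  obtain ⟨q, hq, hqb, hd⟩ := exists_solution_Iic (A := fun x => transposeOp (B l₀ + E x l₀))
    (continuous_transposeOp.comp (continuous_const.add h.continuous.self_of_nhds)) b p₀
  exact ⟨q, ⟨hq.continuousOn, fun t ht => hd t ht⟩, hqb⟩

variable [CompleteSpace F]

theorem exists_bound (h : LeftFamily B P E v w l₀ K α g) :
    ∃ C, ∀ᶠ l in 𝓝 l₀, ∀ x ≤ 0, ‖w x l‖ ≤ C := by
  have hv : ∀ᶠ l in 𝓝 l₀, ‖v l‖ < ‖v l₀‖ + 1 :=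
    h.diff_limit.continuousAt.norm.eventually (gt_mem_nhds (lt_add_one _))
  have hK := h.split.self_of_nhds.nonneg
  refine ⟨(K + K * (1 + K)) * (‖v l₀‖ + 1) *
    Real.exp ((K + K * (1 + K)) * ∫ t in Iic 0, g t), ?_⟩
  filter_upwards [hv, h.split, h.continuous, h.dominated, h.solution] with l hv hs hc hd hw x hx
  refine (hs.norm_le_of_tendsto_atBot hc.continuousOn h.integrable (fun t ht => (hd t ht).1)
    (fun t _ => hw.1 t) hw.2 hx).trans ?_
  exact mul_le_mul_of_nonneg_right (mul_le_mul_of_nonneg_left hv.le (by positivity))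
    (Real.exp_pos _).le

theorem exists_bound_one_sub (h : LeftFamily B P E v w l₀ K α g) :
    ∃ u : ℝ → ℝ, IntegrableOn u (Iic 0) ∧ ∀ᶠ l in 𝓝 l₀, ∀ x ≤ 0, ‖(1 - P l) (w x l)‖ ≤ u x := by
  obtain ⟨C, hC⟩ := h.exists_bound
  refine ⟨_, (integrableOn_expConv h.split.self_of_nhds.pos h.integrable).const_mul
    (K * ((1 + K) * C)), ?_⟩
  filter_upwards [hC, h.split, h.continuous, h.dominated, h.solution] with l hC hs hc hd hw x hx
  exact hs.norm_one_sub_le_expConv hc.continuousOn h.integrable (fun t ht => (hd t ht).1)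
      (fun t _ => hw.1 t) hC hx

/-- The pairing of a row solution at `l₀` with the increment of the coefficient matrix is dominated
by `|l - l₀|` times an integrable function, although the increment of `B` alone does not decay at
`-∞`: its component in the range of `P(l₀)` is `(P(l₀) - P(l)) B(l) (1 - P(l))`, where
`(1 - P(l)) w` is integrable, and its complementary component is paired with the integrable
function `q (1 - P(l₀))`. -/
theorem exists_bound_increment (h : LeftFamily B P E v w l₀ K α g) {b : ℝ} (hb : b ≤ 0)
    {q : ℝ → F →L[ℂ] ℂ} (hq : IsRow (B l₀) (fun x => E x l₀) b q) :
    ∃ H : ℝ → ℝ, IntegrableOn H (Iic b) ∧ ∀ᶠ l in 𝓝 l₀, ∀ x ≤ b,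
      ‖q x (((B l + E x l) - (B l₀ + E x l₀)) (w x l))‖ ≤ ‖l - l₀‖ * H x := by
  obtain ⟨⟨Cq, hCq⟩, hN, -⟩ := h.split.self_of_nhds.row (h.continuous.self_of_nhds.continuousOn)
    (h.integrableOn_error hb) hq.continuousOn hq.hasDerivAt
  obtain ⟨C, hC⟩ := h.exists_bound
  obtain ⟨u, hu, hwu⟩ := h.exists_bound_one_sub
  obtain ⟨LB, hLB⟩ := h.diff_generator.hasFDerivAt.isBigO_sub.bound
  obtain ⟨LP, hLP⟩ := h.diff_proj.hasFDerivAt.isBigO_sub.bound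
  have hBb : ∀ᶠ l in 𝓝 l₀, ‖B l‖ < ‖B l₀‖ + 1 :=
    h.diff_generator.continuousAt.norm.eventually (gt_mem_nhds (lt_add_one _))
  have hsub := Iic_subset_Iic.2 hb
  have hCq0 : 0 ≤ Cq := (norm_nonneg _).trans (hCq b le_rfl)
  refine ⟨fun x => ‖(q x).comp (1 - P l₀)‖ * (LB * C) + Cq * (LP * ((‖B l₀‖ + 1) * u x)) +
    Cq * (g x * C), ?_, ?_⟩
  · exact ((hN.norm.mul_const _).add
      ((((hu.mono_set hsub).const_mul _).const_mul _).const_mul _)).add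
      (((h.integrable.mono_set hsub).mul_const _).const_mul _)
  filter_upwards [hC, hwu, hLB, hLP, hBb, h.split, h.dominated] with l hC hwu hLB hLP hBb hs hd x hx
  have hx0 : x ≤ 0 := hx.trans hb
  have hs0 := h.split.self_of_nhds
  have hC0 : 0 ≤ C := (norm_nonneg _).trans (hC x hx0)
  have e1 : P l₀ (B l₀ (w x l)) = 0 := DFunLike.congr_fun hs0.proj_mul (w x l)
  have e2 : P l (B l (w x l)) = 0 := DFunLike.congr_fun hs.proj_mul (w x l)
  have e3 : B l ((1 - P l) (w x l)) = B l (w x l) := DFunLike.congr_fun hs.mul_one_sub (w x l)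
  have hdecomp : q x (((B l + E x l) - (B l₀ + E x l₀)) (w x l)) =
      (q x).comp (1 - P l₀) ((B l - B l₀) (w x l)) +
      q x ((P l₀ - P l) (B l ((1 - P l) (w x l)))) + q x ((E x l - E x l₀) (w x l)) := by
    rw [e3]
    simp only [ContinuousLinearMap.comp_apply, _root_.sub_apply, _root_.add_apply,
      map_sub, map_add, e1, e2, one_apply_eq_self, map_zero]
    ring
  rw [hdecomp]
  have b1 : ‖(q x).comp (1 - P l₀) ((B l - B l₀) (w x l))‖ ≤
      ‖l - l₀‖ * (‖(q x).comp (1 - P l₀)‖ * (LB * C)) := by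
    refine (ContinuousLinearMap.le_opNorm _ _).trans ?_
    have : ‖(B l - B l₀) (w x l)‖ ≤ (LB * ‖l - l₀‖) * C :=
      ((B l - B l₀).le_opNorm _).trans (mul_le_mul hLB (hC x hx0) (norm_nonneg _)
        ((norm_nonneg _).trans hLB))
    refine (mul_le_mul_of_nonneg_left this (norm_nonneg _)).trans (le_of_eq ?_)
    ring
  have b2 : ‖q x ((P l₀ - P l) (B l ((1 - P l) (w x l))))‖ ≤
      ‖l - l₀‖ * (Cq * (LP * ((‖B l₀‖ + 1) * u x))) := by
    have c1 : ‖B l ((1 - P l) (w x l))‖ ≤ (‖B l₀‖ + 1) * u x :=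
      ((B l).le_opNorm _).trans (mul_le_mul hBb.le (hwu x hx0) (norm_nonneg _) (by positivity))
    have c2 : ‖(P l₀ - P l) (B l ((1 - P l) (w x l)))‖ ≤
        (LP * ‖l - l₀‖) * ((‖B l₀‖ + 1) * u x) :=
      (ContinuousLinearMap.le_opNorm _ _).trans (mul_le_mul (by rwa [norm_sub_rev]) c1
        (norm_nonneg _) ((norm_nonneg _).trans hLP))
    refine ((q x).le_opNorm _).trans ((mul_le_mul (hCq x hx) c2 (norm_nonneg _) hCq0).trans
      (le_of_eq ?_))
    ring
  have b3 : ‖q x ((E x l - E x l₀) (w x l))‖ ≤ ‖l - l₀‖ * (Cq * (g x * C)) := by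
    have c1 : ‖(E x l - E x l₀) (w x l)‖ ≤ (‖l - l₀‖ * g x) * C :=
      (ContinuousLinearMap.le_opNorm _ _).trans (mul_le_mul (hd x hx0).2 (hC x hx0) (norm_nonneg _)
        ((norm_nonneg _).trans (hd x hx0).2))
    refine ((q x).le_opNorm _).trans ((mul_le_mul (hCq x hx) c1 (norm_nonneg _) hCq0).trans
      (le_of_eq ?_))
    ring
  refine (norm_add_le _ _).trans ((add_le_add ((norm_add_le _ _).trans (add_le_add b1 b2)) b3).trans
    (le_of_eq ?_))
  ring

/-- The pairing `x ↦ q(x) w(x, l)` of a row solution at `l₀` with a solution at `l` has the limit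
`q(-∞) v(l)` and the derivative `q ((B + E)(l) - (B + E)(l₀)) w(l)`. -/
theorem pairing_eq (h : LeftFamily B P E v w l₀ K α g) {b : ℝ} (hb : b ≤ 0)
    {q : ℝ → F →L[ℂ] ℂ} (hq : IsRow (B l₀) (fun x => E x l₀) b q) {m : F →L[ℂ] ℂ}
    (hm : Tendsto q atBot (𝓝 m)) : ∀ᶠ l in 𝓝 l₀, q b (w b l) =
      m (v l) + ∫ x in Iic b, q x (((B l + E x l) - (B l₀ + E x l₀)) (w x l)) := by
  obtain ⟨H, hH, hle⟩ := h.exists_bound_increment hb hq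
  filter_upwards [h.continuous, h.solution, hle, h.aestronglyMeasurable_increment hq]
    with l hc hw hle hmeas
  have hint : IntegrableOn (fun x => q x (((B l + E x l) - (B l₀ + E x l₀)) (w x l))) (Iic b) :=
    Integrable.mono' (hH.const_mul ‖l - l₀‖) hmeas
      ((ae_restrict_iff' measurableSet_Iic).2 (ae_of_all _ fun x hx => hle x hx))
  have hwc : Continuous fun x => w x l :=
    continuous_iff_continuousAt.2 fun x => (hw.1 x).continuousAt
  have hlim : Tendsto (fun x => q x (w x l)) atBot (𝓝 (m (v l))) :=
    (isBoundedBilinearMap_apply.continuous.tendsto (m, v l)).comp (hm.prodMk_nhds hw.2)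
  rw [integral_Iic_of_hasDerivAt_of_tendsto (f := fun x => q x (w x l))
    ((hq.continuousOn.clm_apply hwc.continuousOn) b (mem_Iic.2 le_rfl)) (fun x hx => ?_) hint hlim]
  · ring
  · refine (hasDerivAt_clm_apply (hq.hasDerivAt x hx) (hw.1 x)).congr_deriv ?_
    simp only [_root_.neg_apply, ContinuousLinearMap.comp_apply, _root_.sub_apply, map_sub]
    ring

theorem tendsto_pairing (h : LeftFamily B P E v w l₀ K α g) {b : ℝ} (hb : b ≤ 0)
    {q : ℝ → F →L[ℂ] ℂ} (hq : IsRow (B l₀) (fun x => E x l₀) b q) :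
    Tendsto (fun l => q b (w b l)) (𝓝 l₀) (𝓝 (q b (w b l₀))) := by
  obtain ⟨-, -, m, hm, -⟩ := h.split.self_of_nhds.row (h.continuous.self_of_nhds.continuousOn)
    (h.integrableOn_error hb) hq.continuousOn hq.hasDerivAt
  obtain ⟨H, hH, hle⟩ := h.exists_bound_increment hb hq
  have heq := h.pairing_eq hb hq hm
  have heq0 : q b (w b l₀) = m (v l₀) := by simpa using heq.self_of_nhds
  have hint : Tendsto (fun l => ∫ x in Iic b, q x (((B l + E x l) - (B l₀ + E x l₀)) (w x l)))
      (𝓝 l₀) (𝓝 0) := by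
    refine squeeze_zero_norm' (a := fun l => ‖l - l₀‖ * ∫ x in Iic b, H x) ?_ ?_
    · filter_upwards [hle] with l hle
      rw [← integral_const_mul]
      exact norm_integral_le_of_norm_le (hH.const_mul _)
        ((ae_restrict_iff' measurableSet_Iic).2 (ae_of_all _ fun x hx => hle x hx))
    · have : Tendsto (fun l : ℂ => ‖l - l₀‖ * ∫ x in Iic b, H x) (𝓝 l₀)
          (𝓝 (‖l₀ - l₀‖ * ∫ x in Iic b, H x)) := by
        apply Continuous.tendsto; fun_prop
      simpa using this
  have h1 := ((m.continuous.tendsto _).comp h.diff_limit.continuousAt.tendsto).add hint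
  rw [add_zero, ← heq0] at h1
  refine h1.congr' ?_
  filter_upwards [heq] with l hl
  rw [hl]; rfl

variable [FiniteDimensional ℂ F]

theorem tendsto_solution (h : LeftFamily B P E v w l₀ K α g) {b : ℝ} (hb : b ≤ 0) :
    Tendsto (w b) (𝓝 l₀) (𝓝 (w b l₀)) := by
  refine tendsto_of_forall_dual fun p => ?_
  obtain ⟨q, hq, rfl⟩ := h.exists_row b p
  exact h.tendsto_pairing hb hq

/-- Differentiation of the pairing with respect to the parameter. -/
theorem hasDerivAt_pairing (h : LeftFamily B P E v w l₀ K α g)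
    {q : ℝ → F →L[ℂ] ℂ} (hq : IsRow (B l₀) (fun x => E x l₀) 0 q) {m : F →L[ℂ] ℂ}
    (hm : Tendsto q atBot (𝓝 m)) :
    IntegrableOn (fun x => q x ((deriv B l₀ + deriv (E x) l₀) (w x l₀))) (Iic 0) ∧
      HasDerivAt (fun l => q 0 (w 0 l)) (m (deriv v l₀) +
        ∫ x in Iic 0, q x ((deriv B l₀ + deriv (E x) l₀) (w x l₀))) l₀ := by
  obtain ⟨H, hH, hle⟩ := h.exists_bound_increment le_rfl hq
  set f : ℂ → ℝ → ℂ := fun l x => (l - l₀)⁻¹ * q x (((B l + E x l) - (B l₀ + E x l₀)) (w x l))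
    with hf
  set f' : ℝ → ℂ := fun x => q x ((deriv B l₀ + deriv (E x) l₀) (w x l₀)) with hf'
  have hbound : ∀ᶠ l in 𝓝[≠] l₀, ∀ x ≤ 0, ‖f l x‖ ≤ H x := by
    filter_upwards [hle.filter_mono nhdsWithin_le_nhds, self_mem_nhdsWithin] with l hl hne x hx
    have hpos : 0 < ‖l - l₀‖ := norm_pos_iff.2 (sub_ne_zero.2 hne)
    rw [hf, norm_mul, norm_inv, inv_mul_le_iff₀ hpos]
    exact hl x hx
  have hmeas : ∀ᶠ l in 𝓝[≠] l₀, AEStronglyMeasurable (f l) (volume.restrict (Iic 0)) := by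
    filter_upwards [(h.aestronglyMeasurable_increment hq).filter_mono nhdsWithin_le_nhds] with l hl
    exact hl.const_mul _
  have hlim : ∀ x ≤ 0, Tendsto (fun l => f l x) (𝓝[≠] l₀) (𝓝 (f' x)) := by
    intro x hx
    have h1 : Tendsto (slope (fun l => B l + E x l) l₀) (𝓝[≠] l₀)
        (𝓝 (deriv B l₀ + deriv (E x) l₀)) :=
      hasDerivAt_iff_tendsto_slope.1
        (h.diff_generator.hasDerivAt.add (h.diff_error x hx).hasDerivAt)
    have h2 : Tendsto (w x) (𝓝[≠] l₀) (𝓝 (w x l₀)) :=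
      (h.tendsto_solution hx).mono_left nhdsWithin_le_nhds
    have h3 := ((q x).continuous.tendsto _).comp
      ((isBoundedBilinearMap_apply.continuous.tendsto (_, _)).comp (h1.prodMk_nhds h2))
    refine h3.congr fun l => ?_
    simp [hf, slope_def_module]
  have hf'm : AEStronglyMeasurable f' (volume.restrict (Iic 0)) := by
    obtain ⟨s, hs⟩ := exists_seq_tendsto (𝓝[≠] l₀)
    obtain ⟨N, hN⟩ := eventually_atTop.1 (hs.eventually hmeas)
    refine aestronglyMeasurable_of_tendsto_ae atTop (f := fun k => f (s (k + N)))
      (fun k => hN _ (Nat.le_add_left _ _)) ?_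
    refine (ae_restrict_iff' measurableSet_Iic).2 (ae_of_all _ fun x hx => ?_)
    exact (hlim x hx).comp (hs.comp (tendsto_add_atTop_nat N))
  have hf'i : IntegrableOn f' (Iic 0) := by
    refine Integrable.mono' hH hf'm ?_
    refine (ae_restrict_iff' measurableSet_Iic).2 (ae_of_all _ fun x hx => ?_)
    refine le_of_tendsto (hlim x hx).norm ?_
    filter_upwards [hbound] with l hl
    exact hl x hx
  refine ⟨hf'i, hasDerivAt_iff_tendsto_slope.2 ?_⟩
  have hint : Tendsto (fun l => ∫ x in Iic 0, f l x) (𝓝[≠] l₀) (𝓝 (∫ x in Iic 0, f' x)) := by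
    refine tendsto_integral_filter_of_dominated_convergence H hmeas ?_ hH ?_
    · filter_upwards [hbound] with l hl
      exact (ae_restrict_iff' measurableSet_Iic).2 (ae_of_all _ fun x hx => hl x hx)
    · exact (ae_restrict_iff' measurableSet_Iic).2 (ae_of_all _ fun x hx => hlim x hx)
  have hv := ((m.continuous.tendsto _).comp
    (hasDerivAt_iff_tendsto_slope.1 h.diff_limit.hasDerivAt)).add hint
  have heq := h.pairing_eq le_rfl hq hm
  have heq0 : q 0 (w 0 l₀) = m (v l₀) := by simpa using heq.self_of_nhds
  refine hv.congr' ?_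
  filter_upwards [heq.filter_mono nhdsWithin_le_nhds] with l hl
  simp only [hf, integral_const_mul, slope_def_module, Function.comp_def, hl, heq0, map_smul,
    map_sub, smul_eq_mul]
  ring

theorem differentiableAt_solution (h : LeftFamily B P E v w l₀ K α g) :
    DifferentiableAt ℂ (w 0) l₀ := by
  refine differentiableAt_of_forall_dual fun p => ?_
  obtain ⟨q, hq, rfl⟩ := h.exists_row 0 p
  obtain ⟨-, -, m, hm, -⟩ := h.split.self_of_nhds.row (h.continuous.self_of_nhds.continuousOn)
    (h.integrableOn_error le_rfl) hq.continuousOn hq.hasDerivAt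
  exact (h.hasDerivAt_pairing hq hm).2.differentiableAt

end LeftFamily

end Parameter

/-! ### Families of equations near `-∞` -/

section LeftEnd

open Set NormedSpace

variable {F : Type*} [NormedAddCommGroup F] [NormedSpace ℂ F]

theorem hasDerivAt_exp_mul_smul {T : F →L[ℂ] F} {y : ℝ → F} {x : ℝ} (c : ℂ)
    (h : HasDerivAt y (T (y x)) x) :
    HasDerivAt (fun t : ℝ => Complex.exp (c * t) • y t)
      ((T + c • 1) (Complex.exp (c * x) • y x)) x := by
  have h2 : HasDerivAt (fun s : ℝ => Complex.exp (c * s)) (Complex.exp (c * x) * (c * 1)) x :=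
    (((Complex.ofRealCLM.hasDerivAt (x := x)).const_mul c).cexp)
  refine (h2.fun_smul h).congr_deriv ?_
  simp only [mul_one, _root_.add_apply, map_smul, _root_.smul_apply, one_apply_eq_self,
    smul_add, smul_smul]

/-- The behaviour near `-∞` of a family `y' = A(x, l) y`, `l ∈ Ω`: the coefficient converges to
`L(l)`, whose dominant eigenvalue `μ(l)` is simple with right eigenvector `r(l)` and left
eigenvector `ℓ(l)`, and the deviation `A - L` and its increments in `l` are locally dominated by
integrable functions on `(-∞, 0]`. -/
structure LeftEnd (Ω : Set ℂ) (A : ℝ → ℂ → F →L[ℂ] F) (L : ℂ → F →L[ℂ] F) (μ : ℂ → ℂ)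
    (r : ℂ → F) (ℓ : ℂ → F →L[ℂ] ℂ) : Prop where
  isOpen : IsOpen Ω
  continuous : ∀ l ∈ Ω, Continuous fun x => A x l
  diff_coeff : ∀ x, DifferentiableOn ℂ (A x) Ω
  diff_lim : DifferentiableOn ℂ L Ω
  diff_eigenvalue : DifferentiableOn ℂ μ Ω
  diff_right : DifferentiableOn ℂ r Ω
  diff_left : DifferentiableOn ℂ ℓ Ω
  right : ∀ l ∈ Ω, L l (r l) = μ l • r l
  left : ∀ l ∈ Ω, (ℓ l).comp (L l) = μ l • ℓ l
  normalized : ∀ l ∈ Ω, ℓ l (r l) = 1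
  simple : ∀ l ∈ Ω, ∀ u, L l u = μ l • u → ∃ c : ℂ, u = c • r l
  dominant : ∀ l ∈ Ω, ∀ (ν : ℂ) (u : F), u ≠ 0 → L l u = ν • u → ν ≠ μ l → ν.re < (μ l).re
  dominated : ∀ l₀ ∈ Ω, ∃ g : ℝ → ℝ, IntegrableOn g (Iic 0) ∧ ∀ᶠ l in 𝓝 l₀, ∀ x ≤ 0,
    ‖A x l - L l‖ ≤ g x ∧ ‖(A x l - L l) - (A x l₀ - L l₀)‖ ≤ ‖l - l₀‖ * g x

/-- `y` solves `y' = A(x, l) y` on the line, and `e^{-μ(l) x} y(x) → v` as `x → -∞`. -/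
def IsLeftSolution (A : ℝ → ℂ → F →L[ℂ] F) (μ : ℂ → ℂ) (l : ℂ) (v : F) (y : ℝ → F) : Prop :=
  (∀ x, HasDerivAt y (A x l (y x)) x) ∧
    Tendsto (fun x : ℝ => Complex.exp (-μ l * x) • y x) atBot (𝓝 v)

theorem IsLeftSolution.normalize {A : ℝ → ℂ → F →L[ℂ] F} {μ : ℂ → ℂ} {l : ℂ} {v : F} {y : ℝ → F}
    (hy : IsLeftSolution A μ l v y) (L : ℂ → F →L[ℂ] F) (x : ℝ) :
    HasDerivAt (fun x : ℝ => Complex.exp (-μ l * x) • y x)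
      (((L l - μ l • 1) + (A x l - L l)) (Complex.exp (-μ l * x) • y x)) x := by
  refine (hasDerivAt_exp_mul_smul (-μ l) (hy.1 x)).congr_deriv ?_
  congr 1
  rw [neg_smul]; abel

namespace LeftEnd

variable {Ω : Set ℂ} {A : ℝ → ℂ → F →L[ℂ] F} {L : ℂ → F →L[ℂ] F} {μ : ℂ → ℂ} {r : ℂ → F}
  {ℓ : ℂ → F →L[ℂ] ℂ} {l₀ : ℂ}

theorem integrableOn_error (h : LeftEnd Ω A L μ r ℓ) (hl : l₀ ∈ Ω) :
    IntegrableOn (fun x => A x l₀ - L l₀) (Iic 0) := by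
  obtain ⟨g, hg, hd⟩ := h.dominated l₀ hl
  refine Integrable.mono' hg ((h.continuous l₀ hl).sub continuous_const).aestronglyMeasurable ?_
  exact (ae_restrict_iff' measurableSet_Iic).2
    (ae_of_all _ fun x hx => (hd.self_of_nhds x hx).1)

/-- Subtracting the rank-one projection `u ↦ ℓ(u) r` from `L - μ` moves the eigenvalue `0` to `-1`,
so that all eigenvalues have negative real part. -/
theorem re_neg_of_eigenvector (h : LeftEnd Ω A L μ r ℓ) (hl : l₀ ∈ Ω) (ν : ℂ) (u : F) (hu : u ≠ 0)
    (hMu : (L l₀ - μ l₀ • 1 - (ℓ l₀).smulRight (r l₀)) u = ν • u) : ν.re < 0 := by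
  have hMu' : L l₀ u - μ l₀ • u - ℓ l₀ u • r l₀ = ν • u := by simpa using hMu
  have hLl : ℓ l₀ (L l₀ u) = μ l₀ * ℓ l₀ u := DFunLike.congr_fun (h.left l₀ hl) u
  have h1 := congrArg (ℓ l₀) hMu'
  simp only [map_sub, map_smul, hLl, h.normalized l₀ hl, smul_eq_mul, mul_one] at h1
  have h2 : (ν + 1) * ℓ l₀ u = 0 := by linear_combination -h1
  rcases mul_eq_zero.1 h2 with h3 | h3
  · rw [eq_neg_of_add_eq_zero_left h3]; simp
  · rw [h3, zero_smul, sub_zero, sub_eq_iff_eq_add, ← add_smul] at hMu'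
    have hν : ν ≠ 0 := by
      rintro rfl
      rw [zero_add] at hMu'
      obtain ⟨c, rfl⟩ := h.simple l₀ hl u hMu'
      rw [map_smul, h.normalized l₀ hl, smul_eq_mul, mul_one] at h3
      exact hu (by rw [h3, zero_smul])
    have := h.dominant l₀ hl _ u hu hMu' (by simpa using hν)
    simpa using this

/-- The left eigenspace for `μ` is spanned by `ℓ`. -/
theorem eq_smul_left [FiniteDimensional ℂ F] (h : LeftEnd Ω A L μ r ℓ) (hl : l₀ ∈ Ω)
    {ω : F →L[ℂ] ℂ} (hω : ω.comp (L l₀) = μ l₀ • ω) : ω = ω (r l₀) • ℓ l₀ := by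
  set M : F →L[ℂ] F := L l₀ - μ l₀ • 1 - (ℓ l₀).smulRight (r l₀) with hM
  have hinj : Function.Injective (M : F →ₗ[ℂ] F) := by
    rw [injective_iff_map_eq_zero]
    intro u hu
    by_contra hu0
    have := h.re_neg_of_eigenvector hl 0 u hu0 (by rw [zero_smul]; exact hu)
    exact lt_irrefl _ this
  ext u
  obtain ⟨z, rfl⟩ := LinearMap.injective_iff_surjective.1 hinj u
  have hLl : ℓ l₀ (L l₀ z) = μ l₀ * ℓ l₀ z := DFunLike.congr_fun (h.left l₀ hl) z
  have hLω : ω (L l₀ z) = μ l₀ * ω z := DFunLike.congr_fun hω z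
  simp [hM, hLl, hLω, h.normalized l₀ hl]
  ring

theorem left_eigenvector_pairing [FiniteDimensional ℂ F] (h : LeftEnd Ω A L μ r ℓ) (hl : l₀ ∈ Ω)
    {ω : F →L[ℂ] ℂ} (hω : ω.comp (L l₀) = μ l₀ • ω) (hω0 : ω ≠ 0) {v : F} (hv0 : v ≠ 0)
    (hv : L l₀ v = μ l₀ • v) :
    ω v ≠ 0 ∧ ℓ l₀ v ≠ 0 ∧ ∀ u, ℓ l₀ u / ℓ l₀ v = ω u / ω v := by
  have hωl := h.eq_smul_left hl hω
  have happ : ∀ u, ω u = ω (r l₀) * ℓ l₀ u := fun u => DFunLike.congr_fun hωl u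
  have hc0 : ω (r l₀) ≠ 0 := fun h0 =>
    hω0 (ContinuousLinearMap.ext fun u => by rw [happ, h0, zero_mul]; rfl)
  obtain ⟨c, hc⟩ := h.simple l₀ hl v hv
  have hlv : ℓ l₀ v ≠ 0 := by
    rw [hc, map_smul, h.normalized l₀ hl, smul_eq_mul, mul_one]
    rintro rfl
    exact hv0 (by rw [hc, zero_smul])
  refine ⟨by rw [happ]; exact mul_ne_zero hc0 hlv, hlv, fun u => ?_⟩
  rw [happ u, happ v, mul_div_mul_left _ _ hc0]

variable [FiniteDimensional ℂ F] [CompleteSpace F]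

/-- The spectral splitting of `L(l) - μ(l)` by the rank-one projection `u ↦ ℓ(u) r`, uniformly for
`l` near `l₀`. -/
theorem exists_splitting (h : LeftEnd Ω A L μ r ℓ) (hl : l₀ ∈ Ω) :
    ∃ K α : ℝ, ∀ᶠ l in 𝓝 l₀,
      SpectralSplitting (L l - μ l • 1) ((ℓ l).smulRight (r l)) K α := by
  have hnhds := h.isOpen.mem_nhds hl
  obtain ⟨K₀, α, hα, hK₀⟩ := exists_norm_exp_smul_le
    (M := L l₀ - μ l₀ • 1 - (ℓ l₀).smulRight (r l₀)) (h.re_neg_of_eigenvector hl)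
  have hcP : ContinuousAt (fun l => (ℓ l).smulRight (r l)) l₀ :=
    ((ContinuousLinearMap.smulRightL ℂ F F).isBoundedBilinearMap.continuous.tendsto
      (ℓ l₀, r l₀)).comp (((h.diff_left.differentiableAt hnhds).continuousAt).prodMk_nhds
        (h.diff_right.differentiableAt hnhds).continuousAt)
  have hcM : ContinuousAt (fun l => L l - μ l • (1 : F →L[ℂ] F) - (ℓ l).smulRight (r l)) l₀ :=
    ((h.diff_lim.differentiableAt hnhds).continuousAt.sub
      ((h.diff_eigenvalue.differentiableAt hnhds).continuousAt.smul continuousAt_const)).sub hcP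
  set K := max K₀ (‖(ℓ l₀).smulRight (r l₀)‖ + 1) with hK
  have hK1 : 0 < K := lt_of_lt_of_le (by positivity) (le_max_right _ _)
  refine ⟨K, α / 2, ?_⟩
  have e1 : ∀ᶠ l in 𝓝 l₀, ‖(ℓ l).smulRight (r l)‖ < ‖(ℓ l₀).smulRight (r l₀)‖ + 1 :=
    hcP.norm.eventually (gt_mem_nhds (lt_add_one _))
  have e2 : ∀ᶠ l in 𝓝 l₀, ‖(L l - μ l • (1 : F →L[ℂ] F) - (ℓ l).smulRight (r l)) -
      (L l₀ - μ l₀ • (1 : F →L[ℂ] F) - (ℓ l₀).smulRight (r l₀))‖ < α / 2 / K := by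
    exact (tendsto_iff_norm_sub_tendsto_zero.1 hcM).eventually_lt_const
      (div_pos (half_pos hα) hK1)
  filter_upwards [hnhds, e1, e2] with l hlΩ e1 e2
  refine ⟨half_pos hα, ?_, ?_, ?_, e1.le.trans (le_max_right _ _), fun s hs => ?_⟩
  · ext u
    simp [h.normalized l hlΩ]
  · ext u
    simp [h.right l hlΩ]
  · ext u
    have hLl : ℓ l (L l u) = μ l * ℓ l u := DFunLike.congr_fun (h.left l hlΩ) u
    simp [hLl]
  · refine norm_exp_smul_le_of_norm_sub_le (fun s hs => (hK₀ s hs).trans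
      (mul_le_mul_of_nonneg_right (le_max_left _ _) (Real.exp_pos _).le)) ?_ hs
    rw [lt_div_iff₀ hK1] at e2
    rw [mul_comm]
    exact e2.le

/-- Existence and uniqueness of the solution asymptotic to `e^{μ x} v` at `-∞`. -/
theorem existsUnique (h : LeftEnd Ω A L μ r ℓ) (hl : l₀ ∈ Ω) {v : F}
    (hv : L l₀ v = μ l₀ • v) : ∃! y : ℝ → F, IsLeftSolution A μ l₀ v y := by
  obtain ⟨K, α, hs⟩ := h.exists_splitting hl
  have hs := hs.self_of_nhds
  have hEc : Continuous fun x => A x l₀ - L l₀ := (h.continuous l₀ hl).sub continuous_const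
  have hEi := h.integrableOn_error hl
  obtain ⟨w, hw, hwv, -⟩ := exists_solution_tendsto_atBot (B := L l₀ - μ l₀ • 1)
    (E := fun x => A x l₀ - L l₀) (v := v) (fun s hs' => hs.norm_exp_smul_le hs') hEc hEi
    (by simp [hv])
  have hcancel : ∀ x : ℝ, Complex.exp (-μ l₀ * x) * Complex.exp (μ l₀ * x) = 1 := fun x => by
    rw [← Complex.exp_add]; simp
  refine ⟨fun x : ℝ => Complex.exp (μ l₀ * x) • w x, ⟨fun x => ?_, ?_⟩, fun y hy => ?_⟩
  · refine (hasDerivAt_exp_mul_smul (μ l₀) (hw x)).congr_deriv ?_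
    congr 1; abel
  · simpa only [smul_smul, hcancel, one_smul] using hwv
  · funext b
    have hz : ∀ x, HasDerivAt (fun x : ℝ => Complex.exp (-μ l₀ * x) • y x - w x)
        (((L l₀ - μ l₀ • 1) + (A x l₀ - L l₀)) (Complex.exp (-μ l₀ * x) • y x - w x)) x :=
      fun x => ((hy.normalize L x).sub (hw x)).congr_deriv (map_sub _ _ _).symm
    have hz0 : Tendsto (fun x : ℝ => Complex.exp (-μ l₀ * x) • y x - w x) atBot (𝓝 0) := by
      simpa using hy.2.sub hwv
    have h1 := hs.norm_le_of_tendsto_atBot (E := fun x => A x l₀ - L l₀) hEc.continuousOn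
      (integrableOn_Iic_of_continuous hEc hEi b).norm (fun t _ => le_rfl) (fun t _ => hz t) hz0
      le_rfl
    rw [norm_zero, mul_zero, zero_mul] at h1
    have h2 := sub_eq_zero.1 (norm_le_zero_iff.1 h1)
    rw [← h2, smul_smul, mul_comm, hcancel, one_smul]

theorem exists_leftFamily (h : LeftEnd Ω A L μ r ℓ) (hl : l₀ ∈ Ω) {v : ℂ → F}
    (hv : DifferentiableAt ℂ v l₀) {y : ℝ → ℂ → F}
    (hy : ∀ l ∈ Ω, IsLeftSolution A μ l (v l) fun x => y x l) :
    ∃ K α g, LeftFamily (fun l => L l - μ l • 1) (fun l => (ℓ l).smulRight (r l))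
      (fun x l => A x l - L l) v (fun x l => Complex.exp (-μ l * x) • y x l) l₀ K α g := by
  have hnhds := h.isOpen.mem_nhds hl
  obtain ⟨K, α, hs⟩ := h.exists_splitting hl
  obtain ⟨g, hg, hd⟩ := h.dominated l₀ hl
  refine ⟨K, α, g, hs, ?_, ?_, hv, ?_, fun x _ => ?_, hg, hd, ?_⟩
  · exact (h.diff_lim.differentiableAt hnhds).sub
      ((h.diff_eigenvalue.differentiableAt hnhds).smul_const _)
  · exact (ContinuousLinearMap.smulRightL ℂ F F).isBoundedBilinearMap.differentiableAt
      (ℓ l₀, r l₀) |>.comp l₀ ((h.diff_left.differentiableAt hnhds).prodMk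
        (h.diff_right.differentiableAt hnhds))
  · filter_upwards [hnhds] with l hl
    exact (h.continuous l hl).sub continuous_const
  · exact ((h.diff_coeff x).differentiableAt hnhds).sub (h.diff_lim.differentiableAt hnhds)
  · filter_upwards [hnhds] with l hl
    exact ⟨fun x => (hy l hl).normalize L x, (hy l hl).2⟩

theorem differentiableAt (h : LeftEnd Ω A L μ r ℓ) (hl : l₀ ∈ Ω) {v : ℂ → F}
    (hv : DifferentiableAt ℂ v l₀) {y : ℝ → ℂ → F}
    (hy : ∀ l ∈ Ω, IsLeftSolution A μ l (v l) fun x => y x l) : DifferentiableAt ℂ (y 0) l₀ := by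
  obtain ⟨K, α, g, hf⟩ := h.exists_leftFamily hl hv hy
  simpa using hf.differentiableAt_solution

/-- Derivative with respect to the parameter of the pairing at `0` of the solution asymptotic to
`e^{μ x} v` at `-∞` with a row solution `p` of the transposed equation. The row solution is
asymptotic to `e^{-μ x} c ℓ`, so that `p y = c ℓ(v)`; this turns the boundary term at `-∞` into a
multiple of `p y`. -/
theorem hasDerivAt_pairing (h : LeftEnd Ω A L μ r ℓ) (hl : l₀ ∈ Ω) {v : ℂ → F}
    (hv : DifferentiableAt ℂ v l₀) (hv0 : ℓ l₀ (v l₀) ≠ 0) {y : ℝ → ℂ → F}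
    (hy : ∀ l ∈ Ω, IsLeftSolution A μ l (v l) fun x => y x l) {p : ℝ → F →L[ℂ] ℂ}
    (hp : ∀ x, HasDerivAt p (-(p x).comp (A x l₀)) x) :
    IntegrableOn (fun x => p x ((deriv (A x) l₀ - deriv μ l₀ • 1) (y x l₀))) (Iic 0) ∧
      p 0 (deriv (y 0) l₀) = ℓ l₀ (deriv v l₀) / ℓ l₀ (v l₀) * p 0 (y 0 l₀) +
        ∫ x in Iic 0, p x ((deriv (A x) l₀ - deriv μ l₀ • 1) (y x l₀)) := by
  have hnhds := h.isOpen.mem_nhds hl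
  obtain ⟨K, α, g, hf⟩ := h.exists_leftFamily hl hv hy
  have hp' : ∀ x : ℝ, HasDerivAt (fun x : ℝ => Complex.exp (μ l₀ * x) • p x)
      (-(Complex.exp (μ l₀ * x) • p x).comp ((L l₀ - μ l₀ • 1) + (A x l₀ - L l₀))) x := fun x => by
    refine (hasDerivAt_exp_mul_smul (T := -transposeOp (A x l₀)) (μ l₀) (hp x)).congr_deriv ?_
    ext u
    simp [transposeOp_apply]
    ring
  have hrow : IsRow (L l₀ - μ l₀ • 1) (fun x => A x l₀ - L l₀) 0
      (fun x : ℝ => Complex.exp (μ l₀ * x) • p x) :=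
    ⟨fun x _ => (hp' x).continuousAt.continuousWithinAt, fun x _ => hp' x⟩
  obtain ⟨-, -, m, hm, hmP⟩ := hf.split.self_of_nhds.row (hf.continuous.self_of_nhds.continuousOn)
    (hf.integrableOn_error le_rfl) hrow.continuousOn hrow.hasDerivAt
  obtain ⟨hi, hd⟩ := hf.hasDerivAt_pairing hrow hm
  have heq : p 0 (y 0 l₀) = m (v l₀) := by
    have := (hf.pairing_eq le_rfl hrow hm).self_of_nhds
    simpa using this
  have hm' : ∀ u, m u = ℓ l₀ u * m (r l₀) := fun u => by
    conv_lhs => rw [← hmP]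
    simp
  have hcancel : ∀ x : ℝ, Complex.exp (μ l₀ * x) * Complex.exp (-μ l₀ * x) = 1 := fun x => by
    rw [← Complex.exp_add]; simp
  have hfun : (fun x : ℝ => (Complex.exp (μ l₀ * x) • p x)
      ((deriv (fun l => L l - μ l • (1 : F →L[ℂ] F)) l₀ + deriv (fun l => A x l - L l) l₀)
        (Complex.exp (-μ l₀ * x) • y x l₀))) =
      fun x => p x ((deriv (A x) l₀ - deriv μ l₀ • 1) (y x l₀)) := by
    funext x
    have hL := (h.diff_lim.differentiableAt hnhds)
    have hμ := (h.diff_eigenvalue.differentiableAt hnhds)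
    have hA := ((h.diff_coeff x).differentiableAt hnhds)
    rw [(hL.hasDerivAt.fun_sub (hμ.hasDerivAt.smul_const (1 : F →L[ℂ] F))).deriv,
      (hA.hasDerivAt.fun_sub hL.hasDerivAt).deriv, _root_.smul_apply, map_smul, map_smul, smul_smul,
      hcancel, one_smul]
    congr 2
    abel
  have hfun0 : (fun l => (Complex.exp (μ l₀ * (0 : ℝ)) • p 0)
      (Complex.exp (-μ l * (0 : ℝ)) • y 0 l)) = fun l => p 0 (y 0 l) := by simp
  rw [hfun] at hi hd
  rw [hfun0] at hd
  refine ⟨hi, ?_⟩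
  have hd' : HasDerivAt (fun l => p 0 (y 0 l)) (p 0 (deriv (y 0) l₀)) l₀ :=
    (p 0).hasFDerivAt.comp_hasDerivAt l₀ (h.differentiableAt hl hv hy).hasDerivAt
  have h1 := hd'.unique hd
  rw [h1, heq, hm' (deriv v l₀), hm' (v l₀)]
  field_simp

end LeftEnd

end LeftEnd

/-! ### Domination of holomorphic families by integrable functions -/

section Domination

open Set

theorem norm_circleIntegral_smul_le {X : Type*} [NormedAddCommGroup X] [NormedSpace ℂ X]
    {c : ℂ} {R C : ℝ} (hR : 0 < R) {k : ℂ → ℂ} {f : ℂ → X}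
    (hf : ContinuousOn f (Metric.sphere c R)) (hk : ∀ z ∈ Metric.sphere c R, ‖k z‖ ≤ C) :
    ‖∮ z in C(c, R), k z • f z‖ ≤ C * R * ∫ θ in (0 : ℝ)..2 * Real.pi, ‖f (circleMap c R θ)‖ := by
  have hmem : ∀ θ, circleMap c R θ ∈ Metric.sphere c R := circleMap_mem_sphere c hR.le
  have hcont : Continuous fun θ => f (circleMap c R θ) :=
    hf.comp_continuous (continuous_circleMap c R) hmem
  rw [circleIntegral, ← intervalIntegral.integral_const_mul]
  refine intervalIntegral.norm_integral_le_of_norm_le Real.two_pi_pos.le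
    (ae_of_all _ fun θ _ => ?_) ((hcont.norm.const_mul (C * R)).intervalIntegrable _ _)
  rw [norm_smul, norm_smul, deriv_circleMap]
  have h1 : ‖circleMap 0 R θ * Complex.I‖ = R := by simp [abs_of_pos hR]
  rw [h1, ← mul_assoc, mul_comm R]
  exact mul_le_mul_of_nonneg_right (mul_le_mul_of_nonneg_right (hk _ (hmem θ)) hR.le)
    (norm_nonneg _)

theorem integrableOn_circle_average {X : Type*} [NormedAddCommGroup X] {c : ℂ} {R C : ℝ}
    (hR : 0 < R) {f : ℝ → ℂ → X} {S : Set ℝ}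
    (hc : ContinuousOn (fun p : ℝ × ℂ => f p.1 p.2) (univ ×ˢ Metric.sphere c R))
    (hint : ∀ l ∈ Metric.sphere c R,
      IntegrableOn (fun x => f x l) S ∧ ∫ x in S, ‖f x l‖ ≤ C) :
    IntegrableOn (fun x => ∫ θ in (0 : ℝ)..2 * Real.pi, ‖f x (circleMap c R θ)‖) S := by
  have hmem : ∀ θ, circleMap c R θ ∈ Metric.sphere c R := circleMap_mem_sphere c hR.le
  have hcont : Continuous fun p : ℝ × ℝ => ‖f p.1 (circleMap c R p.2)‖ := by
    have h1 : Continuous fun p : ℝ × ℝ => (p.1, circleMap c R p.2) :=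
      continuous_fst.prodMk ((continuous_circleMap c R).comp continuous_snd)
    exact (hc.comp_continuous h1 fun p => ⟨mem_univ _, hmem p.2⟩).norm
  have hprod : Integrable (fun p : ℝ × ℝ => ‖f p.1 (circleMap c R p.2)‖)
      ((volume.restrict S).prod (volume.restrict (Ioc 0 (2 * Real.pi)))) := by
    refine (integrable_prod_iff' hcont.aestronglyMeasurable).2
      ⟨ae_of_all _ fun θ => (hint _ (hmem θ)).1.norm, ?_⟩
    refine Integrable.mono' (integrable_const C) ?_ (ae_of_all _ fun θ => ?_)
    · have h2 : Continuous fun p : ℝ × ℝ => ‖‖f p.2 (circleMap c R p.1)‖‖ :=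
        (hcont.comp continuous_swap).norm
      exact AEStronglyMeasurable.integral_prod_right' h2.aestronglyMeasurable
    · simp only [norm_norm]
      rw [Real.norm_of_nonneg (integral_nonneg fun _ => norm_nonneg _)]
      exact (hint _ (hmem θ)).2
  refine hprod.integral_prod_left.congr (ae_of_all _ fun x => ?_)
  simp only [intervalIntegral.integral_of_le Real.two_pi_pos.le]

/-- If `f(·, l)` is integrable on `S`, with integrals bounded for `l` in compact sets, and `f(x, ·)`
is holomorphic, then `f` and its increments in `l` are locally dominated by one integrable function:
Cauchy's formula bounds them by a multiple of the average of `‖f(x, ·)‖` over a circle, which is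
integrable in `x` by Fubini's theorem. -/
theorem exists_integrable_dominating {X : Type*} [NormedAddCommGroup X] [NormedSpace ℂ X]
    [CompleteSpace X] {Ω : Set ℂ} (hΩ : IsOpen Ω)
    {f : ℝ → ℂ → X} (hc : ContinuousOn (fun p : ℝ × ℂ => f p.1 p.2) (univ ×ˢ Ω))
    (hd : ∀ x, DifferentiableOn ℂ (f x) Ω) {S : Set ℝ}
    (hint : ∀ K ⊆ Ω, IsCompact K → ∃ C, ∀ l ∈ K,
      IntegrableOn (fun x => f x l) S ∧ ∫ x in S, ‖f x l‖ ≤ C) {l₀ : ℂ} (hl : l₀ ∈ Ω) :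
    ∃ g : ℝ → ℝ, IntegrableOn g S ∧ ∀ᶠ l in 𝓝 l₀, ∀ x,
      ‖f x l‖ ≤ g x ∧ ‖f x l - f x l₀‖ ≤ ‖l - l₀‖ * g x := by
  obtain ⟨R, hR, hball⟩ := Metric.nhds_basis_closedBall.mem_iff.1 (hΩ.mem_nhds hl)
  have hsph : Metric.sphere l₀ R ⊆ Ω := Metric.sphere_subset_closedBall.trans hball
  obtain ⟨C, hC⟩ := hint _ hsph (isCompact_sphere l₀ R)
  have hG := integrableOn_circle_average hR (hc.mono (prod_mono Subset.rfl hsph)) hC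
  set G : ℝ → ℝ := fun x => ∫ θ in (0 : ℝ)..2 * Real.pi, ‖f x (circleMap l₀ R θ)‖ with hGdef
  have hG0 : ∀ x, 0 ≤ G x := fun x =>
    intervalIntegral.integral_nonneg Real.two_pi_pos.le fun _ _ => norm_nonneg _
  refine ⟨fun x => (1 + 1 / R) * G x, hG.const_mul _, ?_⟩
  filter_upwards [Metric.ball_mem_nhds l₀ (half_pos hR)] with l hl' x
  have hlR : l ∈ Metric.ball l₀ R := Metric.ball_subset_ball (half_le_self hR.le) hl'
  have hcl : DiffContOnCl ℂ (f x) (Metric.ball l₀ R) := (hd x).diffContOnCl_ball hball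
  have hfs : ContinuousOn (f x) (Metric.sphere l₀ R) := (hd x).continuousOn.mono hsph
  have hpi : (1 : ℝ) ≤ Real.pi := by linarith [Real.pi_gt_three]
  have hconst : ‖(2 * (Real.pi : ℂ) * Complex.I)⁻¹‖ = 1 / (2 * Real.pi) := by
    simp [abs_of_pos Real.pi_pos]
  have hdist : ∀ z ∈ Metric.sphere l₀ R, R / 2 ≤ ‖z - l‖ := by
    intro z hz
    have h1 : ‖z - l₀‖ = R := by simpa [dist_eq_norm] using hz
    have h2 : ‖l - l₀‖ < R / 2 := by simpa [dist_eq_norm] using hl'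
    have h3 := norm_sub_le_norm_sub_add_norm_sub z l l₀
    linarith
  have e1 := hcl.two_pi_i_inv_smul_circleIntegral_sub_inv_smul hlR
  have e0 := hcl.two_pi_i_inv_smul_circleIntegral_sub_inv_smul (Metric.mem_ball_self hR)
  have hci : ∀ w ∈ Metric.ball l₀ R, CircleIntegrable (fun z => (z - w)⁻¹ • f x z) l₀ R := by
    intro w hw
    refine ContinuousOn.circleIntegrable hR.le (ContinuousOn.smul (ContinuousOn.inv₀
      (by fun_prop) fun z hz h0 => ?_) hfs)
    rw [sub_eq_zero] at h0
    rw [h0] at hz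
    exact absurd (Metric.mem_ball.1 hw) (by rw [Metric.mem_sphere.1 hz]; exact lt_irrefl R)
  constructor
  · rw [← e1, norm_smul, hconst]
    have h1 := norm_circleIntegral_smul_le (k := fun z => (z - l)⁻¹) (C := 2 / R) hR hfs
      (fun z hz => by
        rw [norm_inv, ← inv_div]
        exact inv_anti₀ (half_pos hR) (hdist z hz))
    have h2 : 2 / R * R = 2 := by field_simp
    rw [h2] at h1
    calc _ ≤ 1 / (2 * Real.pi) * (2 * G x) := mul_le_mul_of_nonneg_left h1 (by positivity)
      _ = 1 / Real.pi * G x := by field_simp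
      _ ≤ (1 + 1 / R) * G x := by
        refine mul_le_mul_of_nonneg_right ?_ (hG0 x)
        have : 1 / Real.pi ≤ 1 := (div_le_one Real.pi_pos).2 hpi
        have : 0 < 1 / R := by positivity
        linarith
  · have hsub : f x l - f x l₀ = (2 * (Real.pi : ℂ) * Complex.I)⁻¹ •
        ∮ z in C(l₀, R), ((z - l)⁻¹ - (z - l₀)⁻¹) • f x z := by
      rw [← e1, ← e0, ← smul_sub, ← circleIntegral.integral_sub (hci l hlR)
        (hci l₀ (Metric.mem_ball_self hR))]
      simp only [sub_smul]
    rw [hsub, norm_smul, hconst]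
    have h1 := norm_circleIntegral_smul_le (k := fun z => (z - l)⁻¹ - (z - l₀)⁻¹)
      (C := ‖l - l₀‖ * (2 / R * (1 / R))) hR hfs (fun z hz => by
        have hz0 : ‖z - l₀‖ = R := by simpa [dist_eq_norm] using hz
        have hz1 := hdist z hz
        have n0 : z - l₀ ≠ 0 := norm_pos_iff.1 (by rw [hz0]; exact hR)
        have n1 : z - l ≠ 0 := norm_pos_iff.1 (lt_of_lt_of_le (half_pos hR) hz1)
        rw [inv_sub_inv n1 n0, sub_sub_sub_cancel_left, norm_div, norm_mul, hz0, div_eq_mul_inv,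
          mul_inv, one_div, ← inv_div]
        exact mul_le_mul_of_nonneg_left (mul_le_mul_of_nonneg_right
          (inv_anti₀ (half_pos hR) hz1) (by positivity)) (norm_nonneg _))
    calc _ ≤ 1 / (2 * Real.pi) * (‖l - l₀‖ * (2 / R * (1 / R)) * R * G x) :=
          mul_le_mul_of_nonneg_left h1 (by positivity)
      _ = ‖l - l₀‖ * (1 / R * (1 / Real.pi) * G x) := by field_simp
      _ ≤ ‖l - l₀‖ * ((1 + 1 / R) * G x) := by
        refine mul_le_mul_of_nonneg_left (mul_le_mul_of_nonneg_right ?_ (hG0 x)) (norm_nonneg _)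
        have h3 : 1 / Real.pi ≤ 1 := (div_le_one Real.pi_pos).2 hpi
        have h4 : 0 < 1 / R := by positivity
        have h5 : 1 / R * (1 / Real.pi) ≤ 1 / R := mul_le_of_le_one_right h4.le h3
        linarith

end Domination

/-! ### The wedge pairing and eigenvectors -/

section Wedge

variable {n : ℕ}

/-- The row vector that represents the `(n-1)`-form `V`: `wedge v V = rowOf V ⬝ᵥ v`. -/
def rowOf (V : Fin n → ℂ) : Fin n → ℂ := fun i => (-1) ^ (i : ℕ) * V i.rev

theorem wedge_eq_dotProduct (v V : Fin n → ℂ) : wedge v V = rowOf V ⬝ᵥ v := by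
  simp only [wedge, dotProduct, rowOf]
  exact Finset.sum_congr rfl fun i _ => by ring

theorem exists_rowOf_eq (w : Fin n → ℂ) : rowOf (fun j => (-1) ^ (j.rev : ℕ) * w j.rev) = w := by
  funext i
  simp only [rowOf, Fin.rev_rev]
  rw [← mul_assoc, ← mul_pow]; simp

theorem rowOf_smul (c : ℂ) (V : Fin n → ℂ) : rowOf (c • V) = c • rowOf V := by
  funext i
  simp only [rowOf, Pi.smul_apply, smul_eq_mul]
  ring

theorem rowOf_injective : Function.Injective (rowOf : (Fin n → ℂ) → Fin n → ℂ) := by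
  intro V W h
  funext j
  have := congrFun h j.rev
  simpa [rowOf] using this

theorem rowOf_ne_zero {V : Fin n → ℂ} (hV : V ≠ 0) : rowOf V ≠ 0 := fun h =>
  hV (rowOf_injective (h.trans (by funext i; simp [rowOf])))

/-- On the level of row vectors, `-Ã` acts by right multiplication with `A`. -/
theorem rowOf_tilde_mulVec (A : Matrix (Fin n) (Fin n) ℂ) (V : Fin n → ℂ) :
    rowOf (tilde A *ᵥ V) = -(rowOf V ᵥ* A) := by
  funext i
  simp only [rowOf, mulVec, vecMul, dotProduct, tilde, Matrix.of_apply, Fin.rev_rev, Pi.neg_apply]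
  rw [Finset.mul_sum, ← Finset.sum_neg_distrib]
  refine Fintype.sum_equiv Fin.revPerm _ _ fun j => ?_
  simp only [Fin.revPerm_apply, Fin.rev_rev]
  have hi : (i : ℕ) + (i.rev : ℕ) = (j : ℕ) + (j.rev : ℕ) := by
    rw [Fin.val_rev, Fin.val_rev]; omega
  have hs : (-1 : ℂ) ^ (i : ℕ) * (-1) ^ ((i.rev : ℕ) + (j : ℕ) + 1) = -(-1) ^ (j.rev : ℕ) := by
    rw [← pow_add, show (i : ℕ) + ((i.rev : ℕ) + (j : ℕ) + 1) = 2 * (j : ℕ) + (j.rev : ℕ) + 1 by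
      omega, pow_succ, pow_add, pow_mul]
    simp
  linear_combination (A j.rev i * V j) * hs

theorem wedge_tilde_mulVec (A : Matrix (Fin n) (Fin n) ℂ) (v V : Fin n → ℂ) :
    wedge v (tilde A *ᵥ V) = -wedge (A *ᵥ v) V := by
  rw [wedge_eq_dotProduct, wedge_eq_dotProduct, rowOf_tilde_mulVec, neg_dotProduct,
    dotProduct_mulVec]

theorem tilde_mulVec_eq_neg_smul_iff {A : Matrix (Fin n) (Fin n) ℂ} {V : Fin n → ℂ} {ν : ℂ} :
    tilde A *ᵥ V = -ν • V ↔ rowOf V ᵥ* A = ν • rowOf V := by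
  rw [← rowOf_injective.eq_iff, rowOf_tilde_mulVec, rowOf_smul, neg_smul, neg_inj]

theorem exists_eq_smul_of_rootMultiplicity_eq_one {L : Matrix (Fin n) (Fin n) ℂ} {ν : ℂ}
    (h : L.charpoly.rootMultiplicity ν = 1) {r u : Fin n → ℂ} (hr0 : r ≠ 0)
    (hr : L *ᵥ r = ν • r) (hu : L *ᵥ u = ν • u) : ∃ c : ℂ, u = c • r := by
  have hfin : Module.finrank ℂ (Module.End.eigenspace (Matrix.toLin' L) ν) ≤ 1 := by
    have := LinearMap.finrank_eigenspace_le (Matrix.toLin' L) ν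
    rwa [Matrix.charpoly_toLin', h] at this
  have hrm : r ∈ Module.End.eigenspace (Matrix.toLin' L) ν :=
    Module.End.mem_eigenspace_iff.2 (by simpa using hr)
  have hum : u ∈ Module.End.eigenspace (Matrix.toLin' L) ν :=
    Module.End.mem_eigenspace_iff.2 (by simpa using hu)
  have hne : (⟨r, hrm⟩ : Module.End.eigenspace (Matrix.toLin' L) ν) ≠ 0 :=
    fun h => hr0 (congrArg Subtype.val h)
  have : Nontrivial (Module.End.eigenspace (Matrix.toLin' L) ν) := ⟨_, _, hne⟩
  have hone := le_antisymm hfin Module.finrank_pos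
  obtain ⟨c, hc⟩ := (finrank_eq_one_iff_of_nonzero' _ hne).1 hone ⟨u, hum⟩
  exact ⟨c, (congrArg Subtype.val hc).symm⟩

theorem mem_spectrum_of_mulVec_eq {L : Matrix (Fin n) (Fin n) ℂ} {ν : ℂ} {u : Fin n → ℂ}
    (hu0 : u ≠ 0) (hu : L *ᵥ u = ν • u) : ν ∈ spectrum ℂ L := by
  rw [← Matrix.spectrum_toLin']
  exact (Module.End.hasEigenvalue_of_hasEigenvector (x := u)
    ⟨Module.End.mem_eigenspace_iff.2 (by simpa using hu), hu0⟩).mem_spectrum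

theorem mem_spectrum_of_vecMul_eq {L : Matrix (Fin n) (Fin n) ℂ} {ν : ℂ} {u : Fin n → ℂ}
    (hu0 : u ≠ 0) (hu : u ᵥ* L = ν • u) : ν ∈ spectrum ℂ L := by
  have h : ν ∈ spectrum ℂ Lᵀ := mem_spectrum_of_mulVec_eq hu0 (by rwa [mulVec_transpose])
  rw [Matrix.mem_spectrum_iff_isRoot_charpoly, Matrix.charpoly_transpose] at h
  rwa [Matrix.mem_spectrum_iff_isRoot_charpoly]

/-- The wedge product as a continuous bilinear map. -/
noncomputable def wedgeCLM (n : ℕ) : (Fin n → ℂ) →L[ℂ] (Fin n → ℂ) →L[ℂ] ℂ :=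
  LinearMap.toContinuousLinearMap
    ((LinearMap.toContinuousLinearMap (𝕜 := ℂ) (E := Fin n → ℂ) (F' := ℂ)).toLinearMap ∘ₗ
      LinearMap.mk₂ ℂ wedge
        (fun v v' V => by simp [wedge_eq_dotProduct, dotProduct_add])
        (fun c v V => by simp [wedge_eq_dotProduct])
        (fun v V V' => by
          simp only [wedge, ← Finset.sum_add_distrib, Pi.add_apply]
          exact Finset.sum_congr rfl fun i _ => by ring)
        (fun c v V => by simp [wedge_eq_dotProduct, rowOf_smul]))

@[simp]
theorem wedgeCLM_apply (v V : Fin n → ℂ) : wedgeCLM n v V = wedge v V := rfl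

/-- Matrices acting on column vectors, as a continuous linear map. -/
noncomputable def mulVecCLM (n : ℕ) :
    Matrix (Fin n) (Fin n) ℂ →L[ℂ] (Fin n → ℂ) →L[ℂ] (Fin n → ℂ) :=
  LinearMap.toContinuousLinearMap
    ((LinearMap.toContinuousLinearMap (𝕜 := ℂ) (E := Fin n → ℂ) (F' := Fin n → ℂ)).toLinearMap ∘ₗ
      (Matrix.toLin' : Matrix (Fin n) (Fin n) ℂ ≃ₗ[ℂ] _).toLinearMap)

@[simp]
theorem mulVecCLM_apply (M : Matrix (Fin n) (Fin n) ℂ) (v : Fin n → ℂ) :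
    mulVecCLM n M v = M *ᵥ v := rfl

/-- The action of `-Ã`, as a continuous linear map in `A`. -/
noncomputable def negTildeCLM (n : ℕ) :
    Matrix (Fin n) (Fin n) ℂ →L[ℂ] (Fin n → ℂ) →L[ℂ] (Fin n → ℂ) :=
  -(mulVecCLM n).comp (LinearMap.toContinuousLinearMap
    { toFun := tilde
      map_add' := fun A B => by ext i j; simp [tilde, mul_add]
      map_smul' := fun c A => by ext i j; simp [tilde]; ring })

@[simp]
theorem negTildeCLM_apply (M : Matrix (Fin n) (Fin n) ℂ) (V : Fin n → ℂ) :
    negTildeCLM n M V = -(tilde M *ᵥ V) := rfl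

end Wedge

/-! ### The two ends of the line -/

section Ends

open Set

variable {n : ℕ} {I : Set ℝ} {Ω : Set ℂ} {A : ℝ → ℂ → Matrix (Fin n) (Fin n) ℂ}
  {Aminus Aplus : ℂ → Matrix (Fin n) (Fin n) ℂ} {μminus μplus : ℂ → ℂ}

theorem differentiableOn_of_tendstoUniformlyOn_compact {ι : Type*} {φ : Filter ι} [φ.NeBot]
    {f : ι → ℂ → Matrix (Fin n) (Fin n) ℂ} {L : ℂ → Matrix (Fin n) (Fin n) ℂ} (hΩ : IsOpen Ω)
    (hf : ∀ i, DifferentiableOn ℂ (f i) Ω)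
    (hL : ∀ K ⊆ Ω, IsCompact K → TendstoUniformlyOn f L φ K) : DifferentiableOn ℂ L Ω := by
  have : CompleteSpace (Matrix (Fin n) (Fin n) ℂ) := FiniteDimensional.complete ℂ _
  exact ((tendstoLocallyUniformlyOn_iff_forall_isCompact hΩ).2 hL).differentiableOn
    (Eventually.of_forall hf) hΩ

theorem AssumptionA.differentiableOn (hA : AssumptionA I Ω A) (x : ℝ) :
    DifferentiableOn ℂ (A x) Ω :=
  (hA.analytic x).differentiableOn

theorem AssumptionA.continuousOn_sub (hA : AssumptionA I Ω A)
    {L : ℂ → Matrix (Fin n) (Fin n) ℂ} (hL : DifferentiableOn ℂ L Ω) :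
    ContinuousOn (fun p : ℝ × ℂ => A p.1 p.2 - L p.2) (univ ×ˢ Ω) :=
  hA.continuousOn.sub (hL.continuousOn.comp continuousOn_snd fun _ hp => hp.2)

theorem AssumptionA.continuous (hA : AssumptionA I Ω A) {l : ℂ} (hl : l ∈ Ω) :
    Continuous fun x => A x l :=
  hA.continuousOn.comp_continuous (f := fun x : ℝ => (x, l)) (by fun_prop)
    fun _ => ⟨mem_univ _, hl⟩

/-- The integrals of the error are bounded on compact sets of parameters: up to an error `1` only a
bounded interval of `x` matters, where the error is bounded by compactness. -/
theorem AssumptionD.exists_integral_le (hD : AssumptionD Ω A Aminus Aplus)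
    (hA : AssumptionA I Ω A) (hm : DifferentiableOn ℂ Aminus Ω)
    (hp : DifferentiableOn ℂ Aplus Ω) {K : Set ℂ} (hKΩ : K ⊆ Ω) (hK : IsCompact K) :
    ∃ C, ∀ l ∈ K, ∫ x : ℝ, ‖errorTerm A Aminus Aplus x l‖ ≤ C := by
  obtain ⟨R, hR, hR0⟩ := (((Metric.tendstoUniformlyOn_iff.1 (hD.uniform K hKΩ hK)) 1
    one_pos).and (eventually_ge_atTop 0)).exists
  have hcomp : IsCompact (Icc (-R) R ×ˢ K) := isCompact_Icc.prod hK
  have hsub : Icc (-R) R ×ˢ K ⊆ univ ×ˢ Ω := prod_mono (subset_univ _) hKΩ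
  obtain ⟨C₁, hC₁⟩ := hcomp.exists_bound_of_continuousOn ((hA.continuousOn_sub hm).mono hsub)
  obtain ⟨C₂, hC₂⟩ := hcomp.exists_bound_of_continuousOn ((hA.continuousOn_sub hp).mono hsub)
  refine ⟨max C₁ C₂ * |R - -R| + 1, fun l hl => ?_⟩
  have h1 := hR l hl
  have h2 : ‖∫ x in (-R)..R, ‖errorTerm A Aminus Aplus x l‖‖ ≤ max C₁ C₂ * |R - -R| := by
    refine intervalIntegral.norm_integral_le_of_norm_le_const fun x hx => ?_
    rw [uIoc_of_le (by linarith)] at hx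
    have hx' : ((x, l) : ℝ × ℂ) ∈ Icc (-R) R ×ˢ K := ⟨Ioc_subset_Icc_self hx, hl⟩
    rw [norm_norm, errorTerm]
    split_ifs
    · exact (hC₁ _ hx').trans (le_max_left _ _)
    · exact (hC₂ _ hx').trans (le_max_right _ _)
  rw [Real.dist_eq] at h1
  have h3 := (abs_lt.1 h1).2
  have h4 := (le_abs_self _).trans h2
  linarith

/-- Domination for the operators attached to a family of matrices, whose norm is only controlled
for `x < 0` by the integrable function `e`. -/
theorem exists_integrable_dominating_clm {G : Type*} [NormedAddCommGroup G] [NormedSpace ℂ G]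
    [CompleteSpace G] (hΩ : IsOpen Ω) (T : Matrix (Fin n) (Fin n) ℂ →L[ℂ] G)
    {B : ℝ → ℂ → Matrix (Fin n) (Fin n) ℂ}
    (hc : ContinuousOn (fun p : ℝ × ℂ => B p.1 p.2) (univ ×ˢ Ω))
    (hd : ∀ x, DifferentiableOn ℂ (B x) Ω) {e : ℝ → ℂ → ℝ} (he0 : ∀ x l, 0 ≤ e x l)
    (he : ∀ l ∈ Ω, Integrable fun x => e x l)
    (hC : ∀ K ⊆ Ω, IsCompact K → ∃ C, ∀ l ∈ K, ∫ x, e x l ≤ C)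
    (hle : ∀ l, ∀ x < 0, ‖B x l‖ ≤ e x l) {l₀ : ℂ} (hl : l₀ ∈ Ω) :
    ∃ g : ℝ → ℝ, IntegrableOn g (Iic 0) ∧ ∀ᶠ l in 𝓝 l₀, ∀ x ≤ 0,
      ‖T (B x l)‖ ≤ g x ∧ ‖T (B x l) - T (B x l₀)‖ ≤ ‖l - l₀‖ * g x := by
  obtain ⟨M, hM, hT⟩ := T.bound
  have hcT : ContinuousOn (fun p : ℝ × ℂ => T (B p.1 p.2)) (univ ×ˢ Ω) :=
    T.continuous.comp_continuousOn hc
  have hbd : ∀ K ⊆ Ω, IsCompact K → ∃ C, ∀ l ∈ K,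
      IntegrableOn (fun x => T (B x l)) (Iio 0) ∧ ∫ x in Iio 0, ‖T (B x l)‖ ≤ C := by
    intro K hKΩ hK
    obtain ⟨C, hC⟩ := hC K hKΩ hK
    refine ⟨M * C, fun l hlK => ?_⟩
    have hl' := hKΩ hlK
    have hcl : Continuous fun x => T (B x l) :=
      hcT.comp_continuous (f := fun x : ℝ => (x, l)) (by fun_prop) fun _ => ⟨mem_univ _, hl'⟩
    have hpt : ∀ x ∈ Iio (0 : ℝ), ‖T (B x l)‖ ≤ M * e x l := fun x hx =>
      (hT _).trans (mul_le_mul_of_nonneg_left (hle l x hx) hM.le)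
    have hint : Integrable fun x => M * e x l := (he l hl').const_mul M
    have hi : IntegrableOn (fun x => T (B x l)) (Iio 0) :=
      Integrable.mono' hint.integrableOn hcl.aestronglyMeasurable
        ((ae_restrict_iff' measurableSet_Iio).2 (ae_of_all _ hpt))
    refine ⟨hi, ?_⟩
    calc ∫ x in Iio 0, ‖T (B x l)‖ ≤ ∫ x in Iio 0, M * e x l :=
          setIntegral_mono_on hi.norm hint.integrableOn measurableSet_Iio hpt
      _ ≤ ∫ x, M * e x l :=
          setIntegral_le_integral hint (ae_of_all _ fun x => mul_nonneg hM.le (he0 x l))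
      _ = M * ∫ x, e x l := integral_const_mul _ _
      _ ≤ M * C := mul_le_mul_of_nonneg_left (hC l hlK) hM.le
  obtain ⟨g, hg, hb⟩ := exists_integrable_dominating (S := Iio 0) hΩ hcT
    (fun x => T.differentiable.comp_differentiableOn (hd x)) hbd hl
  exact ⟨g, (integrableOn_Iic_iff_integrableOn_Iio (by simp)).2 hg, hb.mono fun l h x _ => h x⟩

theorem vecMul_normalized_ne_zero {v w : Fin n → ℂ} (h : w ⬝ᵥ v = 1) : v ≠ 0 ∧ w ≠ 0 := by
  constructor <;> rintro rfl <;> simp at h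

theorem wedgeCLM_flip_apply (v V : Fin n → ℂ) :
    (wedgeCLM n).flip V v = wedge v V := rfl

/-- The end `-∞` of `y' = A(x; λ) y`. -/
theorem exists_leftEnd_minus (hA : AssumptionA I Ω A) (hB : AssumptionB Ω A Aminus Aplus)
    (hC : AssumptionC Ω Aminus μminus) (hD : AssumptionD Ω A Aminus Aplus) :
    ∃ (r : ℂ → Fin n → ℂ) (ℓ : ℂ → (Fin n → ℂ) →L[ℂ] ℂ),
      LeftEnd Ω (fun x l => mulVecCLM n (A x l)) (fun l => mulVecCLM n (Aminus l)) μminus r ℓ := by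
  have hm := differentiableOn_of_tendstoUniformlyOn_compact hA.isOpen hA.differentiableOn
    hB.tendsto_bot
  have hp := differentiableOn_of_tendstoUniformlyOn_compact hA.isOpen hA.differentiableOn
    hB.tendsto_top
  obtain ⟨v, w, hv, hw, hvw⟩ := hC.eigenvectors
  set V : ℂ → Fin n → ℂ := fun l j => (-1) ^ (j.rev : ℕ) * w l j.rev with hV
  have hVw : ∀ l, rowOf (V l) = w l := fun l => exists_rowOf_eq (w l)
  have hVd : DifferentiableOn ℂ V Ω := differentiableOn_pi.2 fun j =>
    (differentiableOn_pi.1 hw.differentiableOn j.rev).const_mul _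
  refine ⟨v, fun l => (wedgeCLM n).flip (V l), ⟨hA.isOpen, fun l hl => ?_, fun x => ?_, ?_,
    hC.analytic.differentiableOn, hv.differentiableOn, ?_, fun l hl => (hvw l hl).1,
    fun l hl => ?_, fun l hl => ?_, fun l hl u hu => ?_, fun l hl ν u hu0 hu hν => ?_,
    fun l hl => ?_⟩⟩
  · exact (mulVecCLM n).continuous.comp (hA.continuous hl)
  · exact (mulVecCLM n).differentiable.comp_differentiableOn (hA.differentiableOn x)
  · exact (mulVecCLM n).differentiable.comp_differentiableOn hm
  · exact (wedgeCLM n).flip.differentiable.comp_differentiableOn hVd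
  · ext1 u
    change wedge (Aminus l *ᵥ u) (V l) = μminus l * wedge u (V l)
    rw [wedge_eq_dotProduct, wedge_eq_dotProduct, hVw, dotProduct_mulVec, (hvw l hl).2.1,
      smul_dotProduct, smul_eq_mul]
  · change wedge (v l) (V l) = 1
    rw [wedge_eq_dotProduct, hVw, (hvw l hl).2.2]
  · exact exists_eq_smul_of_rootMultiplicity_eq_one (hC.simple l hl)
      (vecMul_normalized_ne_zero (hvw l hl).2.2).1 (hvw l hl).1 hu
  · exact hC.dominant l hl ν (mem_spectrum_of_mulVec_eq hu0 hu) hν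
  · obtain ⟨g, hg, hb⟩ := exists_integrable_dominating_clm hA.isOpen (mulVecCLM n)
      (B := fun x l => A x l - Aminus l) (hA.continuousOn_sub hm)
      (fun x => (hA.differentiableOn x).sub hm)
      (e := fun x l => ‖errorTerm A Aminus Aplus x l‖) (fun _ _ => norm_nonneg _) hD.integrable
      (fun K => hD.exists_integral_le hA hm hp)
      (fun l x hx => by rw [errorTerm, if_pos hx]) hl
    refine ⟨g, hg, hb.mono fun l h x hx => ?_⟩
    simpa only [map_sub] using h x hx

/-- The end `+∞` of `Y' = Ã(x; λ) Y`, reflected to `-∞`. -/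
theorem exists_leftEnd_plus (hA : AssumptionA I Ω A) (hB : AssumptionB Ω A Aminus Aplus)
    (hC : AssumptionC Ω Aplus μplus) (hD : AssumptionD Ω A Aminus Aplus) :
    ∃ (r : ℂ → Fin n → ℂ) (ℓ : ℂ → (Fin n → ℂ) →L[ℂ] ℂ),
      LeftEnd Ω (fun x l => negTildeCLM n (A (-x) l)) (fun l => negTildeCLM n (Aplus l)) μplus
        r ℓ := by
  have hm := differentiableOn_of_tendstoUniformlyOn_compact hA.isOpen hA.differentiableOn
    hB.tendsto_bot
  have hp := differentiableOn_of_tendstoUniformlyOn_compact hA.isOpen hA.differentiableOn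
    hB.tendsto_top
  obtain ⟨v, w, hv, hw, hvw⟩ := hC.eigenvectors
  set V : ℂ → Fin n → ℂ := fun l j => (-1) ^ (j.rev : ℕ) * w l j.rev with hV
  have hVw : ∀ l, rowOf (V l) = w l := fun l => exists_rowOf_eq (w l)
  have hVd : DifferentiableOn ℂ V Ω := differentiableOn_pi.2 fun j =>
    (differentiableOn_pi.1 hw.differentiableOn j.rev).const_mul _
  have heig : ∀ {l ν U}, negTildeCLM n (Aplus l) U = ν • U → (Aplus l)ᵀ *ᵥ rowOf U = ν • rowOf U :=
    fun {l ν U} h => by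
      rw [mulVec_transpose]
      exact tilde_mulVec_eq_neg_smul_iff.1 (by rw [neg_smul, ← h, negTildeCLM_apply, neg_neg])
  refine ⟨V, fun l => wedgeCLM n (v l), ⟨hA.isOpen, fun l hl => ?_, fun x => ?_, ?_,
    hC.analytic.differentiableOn, hVd, ?_, fun l hl => ?_,
    fun l hl => ?_, fun l hl => ?_, fun l hl u hu => ?_, fun l hl ν u hu0 hu hν => ?_,
    fun l hl => ?_⟩⟩
  · exact (negTildeCLM n).continuous.comp ((hA.continuous hl).comp continuous_neg)
  · exact (negTildeCLM n).differentiable.comp_differentiableOn (hA.differentiableOn (-x))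
  · exact (negTildeCLM n).differentiable.comp_differentiableOn hp
  · exact (wedgeCLM n).differentiable.comp_differentiableOn hv.differentiableOn
  · have : tilde (Aplus l) *ᵥ V l = -μplus l • V l :=
      tilde_mulVec_eq_neg_smul_iff.2 (by rw [hVw, (hvw l hl).2.1])
    rw [negTildeCLM_apply, this, neg_smul, neg_neg]
  · ext1 U
    change wedge (v l) (-(tilde (Aplus l) *ᵥ U)) = μplus l * wedge (v l) U
    rw [← wedgeCLM_apply, map_neg, wedgeCLM_apply, wedge_tilde_mulVec, neg_neg, (hvw l hl).1,
      wedge_eq_dotProduct, dotProduct_smul, ← wedge_eq_dotProduct, smul_eq_mul]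
  · change wedge (v l) (V l) = 1
    rw [wedge_eq_dotProduct, hVw, (hvw l hl).2.2]
  · obtain ⟨c, hc⟩ := exists_eq_smul_of_rootMultiplicity_eq_one (L := (Aplus l)ᵀ)
      (by rw [Matrix.charpoly_transpose]; exact hC.simple l hl)
      (vecMul_normalized_ne_zero (hvw l hl).2.2).2
      (by rw [mulVec_transpose]; exact (hvw l hl).2.1) (heig hu)
    exact ⟨c, rowOf_injective (by rw [hc, rowOf_smul, hVw])⟩
  · exact hC.dominant l hl ν (mem_spectrum_of_vecMul_eq (rowOf_ne_zero hu0)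
      (by rw [← mulVec_transpose]; exact heig hu)) hν
  · obtain ⟨g, hg, hb⟩ := exists_integrable_dominating_clm hA.isOpen (negTildeCLM n)
      (B := fun x l => A (-x) l - Aplus l)
      ((hA.continuousOn_sub hp).comp (f := fun p : ℝ × ℂ => (-p.1, p.2)) (by fun_prop)
        fun p h => ⟨mem_univ _, h.2⟩)
      (fun x => (hA.differentiableOn (-x)).sub hp)
      (e := fun x l => ‖errorTerm A Aminus Aplus (-x) l‖) (fun _ _ => norm_nonneg _)
      (fun l hl => (hD.integrable l hl).comp_neg) (fun K hKΩ hK => by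
        obtain ⟨C, h⟩ := hD.exists_integral_le hA hm hp hKΩ hK
        refine ⟨C, fun l hl => ?_⟩
        rw [integral_neg_eq_self fun x => ‖errorTerm A Aminus Aplus x l‖]
        exact h l hl)
      (fun l x hx => by rw [errorTerm, if_neg (by linarith)]) hl
    refine ⟨g, hg, hb.mono fun l h x hx => ?_⟩
    simpa only [map_sub] using h x hx

end Ends

/-! ### The Evans function -/

section Evans

open Set

variable {n : ℕ} {Ω : Set ℂ} {A : ℝ → ℂ → Matrix (Fin n) (Fin n) ℂ}
  {Aminus Aplus : ℂ → Matrix (Fin n) (Fin n) ℂ} {μminus μplus : ℂ → ℂ}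
  {vminus Vplus : ℂ → Fin n → ℂ} {l₀ : ℂ}

/-- Reflection `x ↦ -x` turns the normalization at `+∞` into one at `-∞`. -/
theorem isYPlus_iff {μ : ℂ → ℂ} {V : ℂ → Fin n → ℂ} {l : ℂ} {Y : ℝ → Fin n → ℂ} :
    IsYPlus A μ V l Y ↔
      IsLeftSolution (fun x l => negTildeCLM n (A (-x) l)) μ l (V l) fun x => Y (-x) := by
  refine and_congr ⟨fun h x => ?_, fun h x => ?_⟩ ⟨fun h => ?_, fun h => ?_⟩
  · exact ((h (-x)).scomp x (hasDerivAt_neg x)).congr_deriv (by simp)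
  · have h1 := (h (-x)).scomp x (hasDerivAt_neg x)
    have h2 : (fun x => Y (-x)) ∘ Neg.neg = Y := by funext t; simp
    rw [h2] at h1
    exact h1.congr_deriv (by simp)
  · have h1 := h.comp tendsto_neg_atBot_atTop
    refine h1.congr fun x => ?_
    simp
  · have h1 := h.comp tendsto_neg_atTop_atBot
    refine h1.congr fun x => ?_
    simp

theorem existsUnique_isYPlus {μ : ℂ → ℂ} {V : ℂ → Fin n → ℂ} {l : ℂ}
    (h : ∃! y : ℝ → Fin n → ℂ,
      IsLeftSolution (fun x l => negTildeCLM n (A (-x) l)) μ l (V l) y) :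
    ∃! Y : ℝ → Fin n → ℂ, IsYPlus A μ V l Y := by
  obtain ⟨y, hy, hu⟩ := h
  refine ⟨fun x => y (-x), isYPlus_iff.2 (by simpa only [neg_neg] using hy), fun Y hY => ?_⟩
  funext x
  simp [← hu _ (isYPlus_iff.1 hY)]

theorem isEtaMinus_etaMinus {μ : ℂ → ℂ} {v : ℂ → Fin n → ℂ} {l : ℂ}
    (h : ∃! y : ℝ → Fin n → ℂ, IsEtaMinus A μ v l y) :
    IsEtaMinus A μ v l fun x => etaMinus A μ v x l :=
  Classical.epsilon_spec h.exists

theorem isYPlus_yPlus {μ : ℂ → ℂ} {V : ℂ → Fin n → ℂ} {l : ℂ}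
    (h : ∃! Y : ℝ → Fin n → ℂ, IsYPlus A μ V l Y) :
    IsYPlus A μ V l fun x => yPlus A μ V x l :=
  Classical.epsilon_spec h.exists

theorem IsEigenvectorOn.mulVec_eq {L : ℂ → Matrix (Fin n) (Fin n) ℂ} {μ : ℂ → ℂ}
    {v : ℂ → Fin n → ℂ} (h : IsEigenvectorOn Ω L μ v) (hl : l₀ ∈ Ω) :
    L l₀ *ᵥ v l₀ = μ l₀ • v l₀ := by
  simpa using (h l₀ hl).apply_eq_smul

theorem IsEigenvectorOn.ne_zero {L : ℂ → Matrix (Fin n) (Fin n) ℂ} {μ : ℂ → ℂ}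
    {v : ℂ → Fin n → ℂ} (h : IsEigenvectorOn Ω L μ v) (hl : l₀ ∈ Ω) : v l₀ ≠ 0 :=
  (h l₀ hl).2

/-- Pairing with a solution of `Y' = Ã Y` is a row solution of the equation transposed to
`y' = A y`. -/
theorem hasDerivAt_wedge_right {M : ℝ → Matrix (Fin n) (Fin n) ℂ} {Y : ℝ → Fin n → ℂ} {x : ℝ}
    (hY : HasDerivAt Y (tilde (M x) *ᵥ Y x) x) :
    HasDerivAt (fun x => (wedgeCLM n).flip (Y x))
      (-((wedgeCLM n).flip (Y x)).comp (mulVecCLM n (M x))) x := by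
  refine (((wedgeCLM n).flip.restrictScalars ℝ).hasFDerivAt.comp_hasDerivAt x hY).congr_deriv ?_
  ext1 u
  exact wedge_tilde_mulVec _ _ _

theorem wedgeCLM_mulVec (M : Matrix (Fin n) (Fin n) ℂ) (u : Fin n → ℂ) :
    wedgeCLM n (M *ᵥ u) = (wedgeCLM n u).comp (negTildeCLM n M) := by
  ext1 V
  change wedge (M *ᵥ u) V = wedgeCLM n u (-(tilde M *ᵥ V))
  rw [map_neg, wedgeCLM_apply, wedge_tilde_mulVec, neg_neg]

/-- Pairing with a solution of `y' = A y`, reflected, is a row solution of the equation transposed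
to the reflection of `Y' = Ã Y`. -/
theorem hasDerivAt_wedge_left {M : ℝ → Matrix (Fin n) (Fin n) ℂ} {y : ℝ → Fin n → ℂ} {x : ℝ}
    (hy : HasDerivAt y (M (-x) *ᵥ y (-x)) (-x)) :
    HasDerivAt (fun x => wedgeCLM n (y (-x)))
      (-(wedgeCLM n (y (-x))).comp (negTildeCLM n (M (-x)))) x := by
  have h1 : HasDerivAt (fun x => y (-x)) (-(M (-x) *ᵥ y (-x))) x :=
    (hy.scomp x (hasDerivAt_neg x)).congr_deriv (by simp)
  refine (((wedgeCLM n).restrictScalars ℝ).hasFDerivAt.comp_hasDerivAt x h1).congr_deriv ?_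
  rw [← wedgeCLM_mulVec]
  exact map_neg (wedgeCLM n) _

/-- The wedge product of solutions of `y' = A y` and `Y' = Ã Y` is constant. -/
theorem wedge_eq_wedge_zero {M : ℝ → Matrix (Fin n) (Fin n) ℂ} {y Y : ℝ → Fin n → ℂ}
    (hy : ∀ x, HasDerivAt y (M x *ᵥ y x) x) (hY : ∀ x, HasDerivAt Y (tilde (M x) *ᵥ Y x) x)
    (x : ℝ) : wedge (y x) (Y x) = wedge (y 0) (Y 0) := by
  have hd : ∀ x, HasDerivAt (fun x => wedge (y x) (Y x)) 0 x := fun x => by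
    refine (hasDerivAt_clm_apply (hasDerivAt_wedge_right (M := M) (hY x)) (hy x)).congr_deriv ?_
    simp
  exact is_const_of_deriv_eq_zero (fun x => (hd x).differentiableAt) (fun x => (hd x).deriv) x 0

theorem deriv_clm_apply {G : Type*} [NormedAddCommGroup G] [NormedSpace ℂ G]
    (T : Matrix (Fin n) (Fin n) ℂ →L[ℂ] G) {f : ℂ → Matrix (Fin n) (Fin n) ℂ}
    (h : DifferentiableAt ℂ f l₀) : deriv (fun l => T (f l)) l₀ = T (deriv f l₀) :=
  (T.hasFDerivAt.comp_hasDerivAt l₀ h.hasDerivAt).deriv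

theorem wedgeCLM_ne_zero {v : Fin n → ℂ} (hv : v ≠ 0) : wedgeCLM n v ≠ 0 := by
  intro h
  refine hv (funext fun i => ?_)
  have h1 := DFunLike.congr_fun h (fun j => (-1) ^ (j.rev : ℕ) * (Pi.single i 1 : Fin n → ℂ) j.rev)
  rw [wedgeCLM_apply, wedge_eq_dotProduct, exists_rowOf_eq] at h1
  simpa using h1

theorem wedgeCLM_flip_ne_zero {V : Fin n → ℂ} (hV : V ≠ 0) : (wedgeCLM n).flip V ≠ 0 := by
  intro h
  refine rowOf_ne_zero hV (funext fun i => ?_)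
  have h1 := DFunLike.congr_fun h (Pi.single i 1)
  rw [wedgeCLM_flip_apply, wedge_eq_dotProduct] at h1
  simpa using h1

/-- The contribution of `-∞` to the derivative of the Evans function. -/
theorem wedge_deriv_left {r : ℂ → Fin n → ℂ} {ℓ : ℂ → (Fin n → ℂ) →L[ℂ] ℂ}
    (hA : ∀ x, DifferentiableOn ℂ (A x) Ω)
    (h : LeftEnd Ω (fun x l => mulVecCLM n (A x l)) (fun l => mulVecCLM n (Aminus l)) μminus r ℓ)
    (hl : l₀ ∈ Ω) (hv : DifferentiableAt ℂ vminus l₀) (hv0 : vminus l₀ ≠ 0)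
    (hve : Aminus l₀ *ᵥ vminus l₀ = μminus l₀ • vminus l₀) {V : Fin n → ℂ} (hV0 : V ≠ 0)
    (hVe : tilde (Aminus l₀) *ᵥ V = -μminus l₀ • V) {η : ℝ → ℂ → Fin n → ℂ}
    (hη : ∀ l ∈ Ω, IsEtaMinus A μminus vminus l fun x => η x l) {Y : ℝ → Fin n → ℂ}
    (hY : ∀ x, HasDerivAt Y (tilde (A x l₀) *ᵥ Y x) x) :
    wedge (vminus l₀) V ≠ 0 ∧
      IntegrableOn (fun x => wedge ((deriv (A x) l₀ -
        deriv μminus l₀ • (1 : Matrix (Fin n) (Fin n) ℂ)) *ᵥ η x l₀) (Y x)) (Iio 0) ∧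
      wedge (deriv (η 0) l₀) (Y 0) =
        wedge (deriv vminus l₀) V / wedge (vminus l₀) V * wedge (η 0 l₀) (Y 0) +
          ∫ x in Iio 0, wedge ((deriv (A x) l₀ -
            deriv μminus l₀ • (1 : Matrix (Fin n) (Fin n) ℂ)) *ᵥ η x l₀) (Y x) := by
  have hω : ((wedgeCLM n).flip V).comp (mulVecCLM n (Aminus l₀)) =
      μminus l₀ • (wedgeCLM n).flip V := by
    ext1 u
    have h1 := wedge_tilde_mulVec (Aminus l₀) u V
    rw [hVe, ← wedgeCLM_apply, map_smul, smul_eq_mul, wedgeCLM_apply] at h1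
    change wedge (Aminus l₀ *ᵥ u) V = μminus l₀ * wedge u V
    linear_combination h1
  obtain ⟨hωv, hlv, hdiv⟩ := h.left_eigenvector_pairing hl hω (wedgeCLM_flip_ne_zero hV0) hv0 hve
  obtain ⟨hi, hd⟩ := h.hasDerivAt_pairing hl hv hlv hη
    (p := fun x => (wedgeCLM n).flip (Y x))
    fun x => hasDerivAt_wedge_right (M := fun x => A x l₀) (hY x)
  have hfun : (fun x => (wedgeCLM n).flip (Y x)
      ((deriv (fun l => mulVecCLM n (A x l)) l₀ - deriv μminus l₀ • 1) (η x l₀))) =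
      fun x => wedge ((deriv (A x) l₀ -
        deriv μminus l₀ • (1 : Matrix (Fin n) (Fin n) ℂ)) *ᵥ η x l₀) (Y x) := by
    funext x
    rw [deriv_clm_apply (mulVecCLM n) ((hA x).differentiableAt (h.isOpen.mem_nhds hl)),
      wedgeCLM_flip_apply, sub_mulVec, smul_mulVec, one_mulVec]
    rfl
  rw [hfun] at hi hd
  rw [hdiv] at hd
  rw [integral_Iic_eq_integral_Iio] at hd
  exact ⟨hωv, hi.mono_set Iio_subset_Iic_self, hd⟩

/-- The contribution of `+∞` to the derivative of the Evans function. -/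
theorem wedge_deriv_right {r : ℂ → Fin n → ℂ} {ℓ : ℂ → (Fin n → ℂ) →L[ℂ] ℂ}
    (hA : ∀ x, DifferentiableOn ℂ (A x) Ω)
    (h : LeftEnd Ω (fun x l => negTildeCLM n (A (-x) l)) (fun l => negTildeCLM n (Aplus l)) μplus
      r ℓ)
    (hl : l₀ ∈ Ω) (hV : DifferentiableAt ℂ Vplus l₀) (hV0 : Vplus l₀ ≠ 0)
    (hVe : tilde (Aplus l₀) *ᵥ Vplus l₀ = -μplus l₀ • Vplus l₀) {v : Fin n → ℂ} (hv0 : v ≠ 0)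
    (hve : Aplus l₀ *ᵥ v = μplus l₀ • v) {Y : ℝ → ℂ → Fin n → ℂ}
    (hY : ∀ l ∈ Ω, IsYPlus A μplus Vplus l fun x => Y x l) {η : ℝ → Fin n → ℂ}
    (hη : ∀ x, HasDerivAt η (A x l₀ *ᵥ η x) x) :
    wedge v (Vplus l₀) ≠ 0 ∧
      IntegrableOn (fun x => wedge ((deriv (A x) l₀ -
        deriv μplus l₀ • (1 : Matrix (Fin n) (Fin n) ℂ)) *ᵥ η x) (Y x l₀)) (Ioi 0) ∧
      wedge (η 0) (deriv (Y 0) l₀) =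
        wedge v (deriv Vplus l₀) / wedge v (Vplus l₀) * wedge (η 0) (Y 0 l₀) +
          ∫ x in Ioi 0, wedge ((deriv (A x) l₀ -
            deriv μplus l₀ • (1 : Matrix (Fin n) (Fin n) ℂ)) *ᵥ η x) (Y x l₀) := by
  have hω : (wedgeCLM n v).comp (negTildeCLM n (Aplus l₀)) = μplus l₀ • wedgeCLM n v := by
    rw [← wedgeCLM_mulVec, hve, map_smul]
  obtain ⟨hωv, hlv, hdiv⟩ := h.left_eigenvector_pairing hl hω (wedgeCLM_ne_zero hv0) hV0
    (by rw [negTildeCLM_apply, hVe, neg_smul, neg_neg])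
  obtain ⟨hi, hd⟩ := h.hasDerivAt_pairing hl hV hlv (y := fun x l => Y (-x) l)
    (fun l hl => isYPlus_iff.1 (hY l hl)) (p := fun x => wedgeCLM n (η (-x)))
    fun x => hasDerivAt_wedge_left (M := fun x => A x l₀) (hη (-x))
  set F : ℝ → ℂ := fun x => wedge ((deriv (A x) l₀ -
        deriv μplus l₀ • (1 : Matrix (Fin n) (Fin n) ℂ)) *ᵥ η x) (Y x l₀) with hF
  have hfun : (fun x => wedgeCLM n (η (-x))
      ((deriv (fun l => negTildeCLM n (A (-x) l)) l₀ - deriv μplus l₀ • 1) (Y (-x) l₀))) =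
      fun x => F (-x) := by
    funext x
    rw [deriv_clm_apply (negTildeCLM n) ((hA (-x)).differentiableAt (h.isOpen.mem_nhds hl)), hF]
    simp only
    rw [← wedgeCLM_apply, sub_mulVec, smul_mulVec, one_mulVec, map_sub, map_smul, wedgeCLM_mulVec]
    exact (map_sub (wedgeCLM n (η (-x))) _ _).trans
      (congrArg₂ (· - ·) rfl (map_smul (wedgeCLM n (η (-x))) _ _))
  rw [hfun] at hi hd
  rw [hdiv, integral_comp_neg_Iic 0 F] at hd
  simp only [neg_zero] at hd
  refine ⟨hωv, ?_, hd⟩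
  have h1 := ((Measure.measurePreserving_neg (volume : Measure ℝ)).integrableOn_comp_preimage
    (Homeomorph.neg ℝ).measurableEmbedding (f := F) (s := Ici 0)).1
      (by simpa [Function.comp_def] using hi)
  exact h1.mono_set Ioi_subset_Ici_self

end Evans

end EvansWedge

theorem mainTheorem5 (n : ℕ) (hn : 2 ≤ n) (I : Set ℝ) (hIopen : IsOpen I)
    (hIconn : I.OrdConnected) (Ω : Set ℂ)
    (A : ℝ → ℂ → Matrix (Fin n) (Fin n) ℂ)
    (Aminus Aplus : ℂ → Matrix (Fin n) (Fin n) ℂ) (μminus μplus : ℂ → ℂ)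
    (hA : EvansWedge.AssumptionA I Ω A)
    (hB : EvansWedge.AssumptionB Ω A Aminus Aplus)
    (hCminus : EvansWedge.AssumptionC Ω Aminus μminus)
    (hCplus : EvansWedge.AssumptionC Ω Aplus μplus)
    (hD : EvansWedge.AssumptionD Ω A Aminus Aplus)
    (vminus vplus Vminus Vplus : ℂ → Fin n → ℂ)
    (hvminus : EvansWedge.IsEigenvectorOn Ω Aminus μminus vminus)
    (hvminus_an : AnalyticOnNhd ℂ vminus Ω)
    (hVminus : EvansWedge.IsEigenvectorOn Ω (fun lam => EvansWedge.tilde (Aminus lam))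
      (fun lam => -μminus lam) Vminus)
    (hvplus : EvansWedge.IsEigenvectorOn Ω Aplus μplus vplus)
    (hVplus : EvansWedge.IsEigenvectorOn Ω (fun lam => EvansWedge.tilde (Aplus lam))
      (fun lam => -μplus lam) Vplus)
    (hVplus_an : AnalyticOnNhd ℂ Vplus Ω) :
    -- the Evans function is well defined on `Ω`
    (∀ lam ∈ Ω,
      (∃! y : ℝ → Fin n → ℂ, EvansWedge.IsEtaMinus A μminus vminus lam y) ∧
      (∃! Y : ℝ → Fin n → ℂ, EvansWedge.IsYPlus A μplus Vplus lam Y) ∧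
      ∀ x : ℝ, EvansWedge.wedge (EvansWedge.etaMinus A μminus vminus x lam)
          (EvansWedge.yPlus A μplus Vplus x lam) =
        EvansWedge.evansFunction A μminus μplus vminus Vplus lam) ∧
    -- the derivative formula on `I`
    ∀ lam ∈ Complex.ofReal '' I,
      EvansWedge.wedge (vminus lam) (Vminus lam) ≠ 0 ∧
      EvansWedge.wedge (vplus lam) (Vplus lam) ≠ 0 ∧
      IntegrableOn (EvansWedge.evansIntegrand A μminus μplus vminus Vplus μminus lam)
        (Set.Iio 0) ∧
      IntegrableOn (EvansWedge.evansIntegrand A μminus μplus vminus Vplus μplus lam)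
        (Set.Ioi 0) ∧
      HasDerivAt (EvansWedge.evansFunction A μminus μplus vminus Vplus)
        ((EvansWedge.wedge (deriv vminus lam) (Vminus lam) /
              EvansWedge.wedge (vminus lam) (Vminus lam) +
            EvansWedge.wedge (vplus lam) (deriv Vplus lam) /
              EvansWedge.wedge (vplus lam) (Vplus lam)) *
            EvansWedge.evansFunction A μminus μplus vminus Vplus lam +
          (∫ x in Set.Iio (0 : ℝ),
            EvansWedge.evansIntegrand A μminus μplus vminus Vplus μminus lam x) +
          ∫ x in Set.Ioi (0 : ℝ),
            EvansWedge.evansIntegrand A μminus μplus vminus Vplus μplus lam x)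
        lam := by
  have h₁ : ∀ l ∈ Ω, ∃! y : ℝ → Fin n → ℂ, EvansWedge.IsEtaMinus A μminus vminus l y := fun l hl =>
    (EvansWedge.exists_leftEnd_minus hA hB hCminus hD).choose_spec.choose_spec.existsUnique hl
      (hvminus.mulVec_eq hl)
  have h₂ : ∀ l ∈ Ω, ∃! Y : ℝ → Fin n → ℂ, EvansWedge.IsYPlus A μplus Vplus l Y := fun l hl =>
    EvansWedge.existsUnique_isYPlus
      ((EvansWedge.exists_leftEnd_plus hA hB hCplus hD).choose_spec.choose_spec.existsUnique hl (by
        rw [EvansWedge.negTildeCLM_apply, hVplus.mulVec_eq hl, neg_smul, neg_neg]))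
  have hη := fun l hl => EvansWedge.isEtaMinus_etaMinus (h₁ l hl)
  have hY := fun l hl => EvansWedge.isYPlus_yPlus (h₂ l hl)
  refine ⟨fun l hl => ⟨h₁ l hl, h₂ l hl,
    EvansWedge.wedge_eq_wedge_zero (M := fun x => A x l) (hη l hl).1 (hY l hl).1⟩, ?_⟩
  rintro _ ⟨t, ht, rfl⟩
  have hl := hA.subset t ht
  set l : ℂ := (t : ℂ)
  obtain ⟨r, ℓ, hm⟩ := EvansWedge.exists_leftEnd_minus hA hB hCminus hD
  obtain ⟨r', ℓ', hp⟩ := EvansWedge.exists_leftEnd_plus hA hB hCplus hD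
  have hvd := (hvminus_an l hl).differentiableAt
  have hVd := (hVplus_an l hl).differentiableAt
  have hηd : DifferentiableAt ℂ (EvansWedge.etaMinus A μminus vminus 0) l :=
    hm.differentiableAt hl hvd hη
  have hYd : DifferentiableAt ℂ (EvansWedge.yPlus A μplus Vplus 0) l := by
    have h := hp.differentiableAt hl hVd (y := fun x l => EvansWedge.yPlus A μplus Vplus (-x) l)
      fun l hl => EvansWedge.isYPlus_iff.1 (hY l hl)
    simpa only [neg_zero] using h
  obtain ⟨hne, hi, hd⟩ := EvansWedge.wedge_deriv_left hA.differentiableOn hm hl hvd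
    (hvminus.ne_zero hl) (hvminus.mulVec_eq hl) (hVminus.ne_zero hl) (hVminus.mulVec_eq hl) hη
    (hY l hl).1
  obtain ⟨hne', hi', hd'⟩ := EvansWedge.wedge_deriv_right hA.differentiableOn hp hl hVd
    (hVplus.ne_zero hl) (hVplus.mulVec_eq hl) (hvplus.ne_zero hl) (hvplus.mulVec_eq hl) hY
    (hη l hl).1
  refine ⟨hne, hne', hi, hi', ?_⟩
  -- the product rule for `η⁻ ∧ Ỹ⁺` at `x = 0`
  refine (((EvansWedge.wedgeCLM n).hasFDerivAt.comp_hasDerivAt l hηd.hasDerivAt).clm_apply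
    hYd.hasDerivAt).congr_deriv ?_
  simp only [Function.comp_apply, EvansWedge.wedgeCLM_apply, hd, hd', EvansWedge.evansFunction,
    EvansWedge.evansIntegrand]
  ring
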